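/- Fix $c>0$, $q>0$ and $m\in\mathbb N$. Let $G$ be the Barnes function, $K(\lambda)=\frac{2c}{\lambda^2+c^2}$ the derivative of $\theta(\lambda)=i\ln\frac{ic+\lambda}{ic-\lambda}$, and $C[F](\lambda)=\int_{-q}^{q}\frac{F(\mu)}{\mu-\lambda}\frac{d\mu}{2i\pi}$. For $\delta,\epsilon>0$ and $\beta_0\in\mathbb C$ put $$U_\delta=\{|\Im z|<\delta\},\qquad \mathcal K_\epsilon=\{|\Im z|<\delta/2,\ |\Re z|<q+\epsilon\},\qquad \boldsymbol U_{\beta_0}=\{\Re\beta_0\le\Re z\le 10\,\Re\beta_0,\ |\Im z|\le\Im\beta_0\},$$ and let $D_{0,r}$ be the open disk of radius $r$ centred at $0$. For $\{\mu_{p_a}\}_1^n,\{\mu_{h_a}\}_1^n$ and a function $F$ consider the kernel $$U[F](\omega,\omega')=\frac{-1}{2\pi}\,\frac{\omega-q}{\omega-q+ic}\prod_{a=1}^n\frac{(\omega-\mu_{p_a})(\omega-\mu_{h_a}+ic)}{(\omega-\mu_{h_a})(\omega-\mu_{p_a}+ic)}\; e^{C[2i\pi F](\omega)-C[2i\pi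 F](\omega+ic)}\;\frac{K(\omega-\omega')}{e^{-2i\pi F(\omega)}-1}.$$ There are $\epsilon_0,\delta_0>0$ such that the following holds for all $0<\epsilon\le\epsilon_0$ and $0<\delta\le\delta_0$. Let $\nu$ and $h$ be holomorphic on $U_{2\delta}$ with $\Re h>0$ on $U_{2\delta}$ and $\Im h$ bounded on $U_{2\delta}$, and write $\nu_\beta=\nu+i\beta h$. Then there is a simple closed counterclockwise loop $\mathcal C_q\subset U_{2\delta}$ around $\overline{\mathcal K_\epsilon}$ such that for every $\beta_0$ with $\Re\beta_0$ large enough and $\Im\beta_0>0$ small enough, and then for every small enough $\gamma_0>0$: 1. For all $\beta\in\boldsymbol U_{\beta_0}$, all $\gamma\in D_{0,\gamma_0}\setminus\{0\}$ and all $\lambda$ on or inside $\mathcal C_q$ one has $e^{-2i\pi\gamma\nu_\beta(\lambda)}-1\neq0$; moreover, for some $\kappa>0$, $|e^{-2i\pi\gamma\nu_\beta(\lambda)}-1|\ge\kappa|\gamma|$ uniformly in such $\lambda$, $\beta$ and $\gamma$. 2. For every $0\le n\le m$, with $\beta_0,\gamma_0,\mathcal C_q$ not depending on $n$, the kernel $\gamma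 U[\gamma\nu_\beta]$ (understood at $\gamma=0$ as its limit $\gamma\to0$) is continuous on $\mathcal C_q\times\mathcal C_q$, its Fredholm series along $\mathcal C_q$ converges absolutely, and $$\mathcal F(\boldsymbol z)=G\big(1-\gamma\nu_\beta(-q)\big)\,G\big(2+\gamma\nu_\beta(q)\big)\prod_{a=1}^n\big(e^{-2i\pi\gamma\nu_\beta(\mu_{h_a})}-1\big)\cdot\det{}_{\mathcal C_q}\big[I+\gamma U[\gamma\nu_\beta](\{\mu_{p_a}\}_1^n,\{\mu_{h_a}\}_1^n)\big]$$ is a holomorphic function of $\boldsymbol z=(\{\mu_{p_a}\}_1^n,\{\mu_{h_a}\}_1^n,\beta,\gamma)$ on $\mathcal D_0=U_\delta^n\times\mathcal K_\epsilon^n\times\boldsymbol U_{\beta_0}\times D_{0,\gamma_0}$. 3. For every $0\le n\le m$ one has $\mathcal D_0\subset\mathcal D=U_\delta^n\times\mathcal K_\epsilon^n\times\{z:\Re z\ge-\epsilon\}\times D_{0,1+\epsilon}$, and $\mathcal F$ has a unique analytic continuation from $\mathcal D_0$ to $\mathcal D$. Here a function is called holomorphic (analytic) on a set that is not open if it is analytic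 in a neighbourhood of each of the points of the set. -/

import Mathlib

open Complex Set MeasureTheory

noncomputable section

namespace NLSM

/-! ### Special functions -/

/-- The Barnes `G` function, through its Weierstrass product
`G(1+z) = (2π)^{z/2} e^{-(z + (1+γ_E) z²)/2} ∏_{k ≥ 1} (1 + z/k)^k e^{z²/(2k) - z}`. -/
def barnesG (w : ℂ) : ℂ :=
  exp ((w - 1) / 2 * (Real.log (2 * Real.pi) : ℂ)) *
    exp (-((w - 1) + (1 + (Real.eulerMascheroniConstant : ℂ)) * (w - 1) ^ 2) / 2) *
    ∏' k : ℕ, ((1 + (w - 1) / ((k : ℂ) + 1)) ^ (k + 1) *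
      exp ((w - 1) ^ 2 / (2 * ((k : ℂ) + 1)) - (w - 1)))

/-- The bare phase `θ(x) = i ln((ic + x)/(ic - x))`. -/
def theta (c : ℝ) (x : ℂ) : ℂ := I * log ((I * c + x) / (I * c - x))

/-- The Lieb kernel `K = θ'`, in closed form. -/
def lieb (c : ℝ) (x : ℂ) : ℂ := 2 * c / (x ^ 2 + c ^ 2)

/-- The Cauchy transform on `[-q, q]`: `C[F](x) = ∫_{-q}^{q} F(s) / (s - x) ds / (2iπ)`. -/
def cauchyTransform (q : ℝ) (F : ℂ → ℂ) (x : ℂ) : ℂ :=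
  (2 * I * Real.pi)⁻¹ * ∫ s in (-q)..q, F s / ((s : ℂ) - x)

/-! ### Domains -/

/-- The strip `U_δ`. -/
def strip (δ : ℝ) : Set ℂ := {z | |z.im| < δ}

/-- The rectangle `K_ε` (it depends on `q` and `δ` as well). -/
def rect (q δ ε : ℝ) : Set ℂ := {z | |z.im| < δ / 2 ∧ |z.re| < q + ε}

/-- The rectangle `U_{β₀}` of parameters `β`. -/
def betaRect (β₀ : ℂ) : Set ℂ :=
  {z | β₀.re ≤ z.re ∧ z.re ≤ 10 * β₀.re ∧ |z.im| ≤ β₀.im}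

/-- The space of parameters `(μ_p, μ_h, β, γ)`. -/
abbrev Params (n : ℕ) : Type := (Fin n → ℂ) × (Fin n → ℂ) × ℂ × ℂ

/-- The domain `D₀ = U_δⁿ × K_εⁿ × U_{β₀} × D_{0,γ₀}`. -/
def smallDomain (q δ ε : ℝ) (β₀ : ℂ) (γ₀ : ℝ) (n : ℕ) : Set (Params n) :=
  (univ.pi fun _ => strip δ) ×ˢ (univ.pi fun _ => rect q δ ε) ×ˢ
    betaRect β₀ ×ˢ Metric.ball 0 γ₀

/-- The domain `D = U_δⁿ × K_εⁿ × {Re z ≥ -ε} × D_{0,1+ε}`. -/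
def largeDomain (q δ ε : ℝ) (n : ℕ) : Set (Params n) :=
  (univ.pi fun _ => strip δ) ×ˢ (univ.pi fun _ => rect q δ ε) ×ˢ
    {z : ℂ | -ε ≤ z.re} ×ˢ Metric.ball 0 (1 + ε)

/-! ### Loops and Fredholm determinants on loops -/

/-- `Γ` is a regular parametrization, with period `1`, of a simple closed `C¹` curve. -/
structure IsSimpleLoop (Γ : ℝ → ℂ) : Prop where
  contDiff : ContDiff ℝ 1 Γ
  periodic : Function.Periodic Γ 1
  injOn : InjOn Γ (Ico 0 1)
  deriv_ne_zero : ∀ t, deriv Γ t ≠ 0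

/-- The winding number `(2iπ)⁻¹ ∮ dw / (w - z)` of the loop `Γ` around a point `z` off `Γ`. -/
def windingNumber (Γ : ℝ → ℂ) (z : ℂ) : ℂ :=
  (2 * I * Real.pi)⁻¹ * ∫ t in (0 : ℝ)..1, deriv Γ t / (Γ t - z)

/-- The points strictly inside the loop `Γ`. -/
def inside (Γ : ℝ → ℂ) : Set ℂ := {z | z ∉ range Γ ∧ windingNumber Γ z ≠ 0}

/-- `Γ` is a simple loop that goes once, counterclockwise, around every point of `S`. -/
def CounterclockwiseAround (Γ : ℝ → ℂ) (S : Set ℂ) : Prop :=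
  IsSimpleLoop Γ ∧ ∀ z ∈ S, z ∉ range Γ ∧ windingNumber Γ z = 1

/-- The `k`-th term of the Fredholm series,
`(1/k!) ∮ … ∮ det_k [V(ω_a, ω_b)] dω_1 ⋯ dω_k`, all integrals being along `Γ`. -/
def fredholmTerm (Γ : ℝ → ℂ) (V : ℂ → ℂ → ℂ) (k : ℕ) : ℂ :=
  ((k.factorial : ℂ))⁻¹ * ∫ t in (univ.pi fun _ : Fin k => Icc (0 : ℝ) 1),
    (Matrix.of fun a b => V (Γ (t a)) (Γ (t b))).det * ∏ a, deriv Γ (t a)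

/-- The Fredholm determinant `det_Γ [I + V]`. -/
def fredholmDet (Γ : ℝ → ℂ) (V : ℂ → ℂ → ℂ) : ℂ := ∑' k, fredholmTerm Γ V k

/-! ### The integral kernel -/

/-- The kernel `U[F](ω, ω')` multiplied by `e^{-2iπF(ω)} - 1`. -/
def kernelNum (c q : ℝ) {n : ℕ} (μp μh : Fin n → ℂ) (F : ℂ → ℂ) (ω ω' : ℂ) : ℂ :=
  (-1 / (2 * Real.pi)) * ((ω - q) / (ω - q + I * c)) *
    (∏ a, ((ω - μp a) * (ω - μh a + I * c)) / ((ω - μh a) * (ω - μp a + I * c))) *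
    exp (cauchyTransform q (fun x => 2 * I * Real.pi * F x) ω -
      cauchyTransform q (fun x => 2 * I * Real.pi * F x) (ω + I * c)) *
    lieb c (ω - ω')

/-- The kernel `U[F]({μ_p}, {μ_h})(ω, ω')`. -/
def kernelU (c q : ℝ) {n : ℕ} (μp μh : Fin n → ℂ) (F : ℂ → ℂ) (ω ω' : ℂ) : ℂ :=
  kernelNum c q μp μh F ω ω' / (exp (-2 * I * Real.pi * F ω) - 1)

/-- The kernel `γ U[γ f](ω, ω')`; at `γ = 0` it stands for its limit
(as `γ / (e^{-2iπγw} - 1) → -1 / (2iπw)` for `w ≠ 0`). -/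
def scaledKernel (c q : ℝ) {n : ℕ} (μp μh : Fin n → ℂ) (f : ℂ → ℂ) (γ : ℂ) (ω ω' : ℂ) : ℂ :=
  if γ = 0 then kernelNum c q μp μh 0 ω ω' / (-2 * I * Real.pi * f ω)
  else γ * kernelU c q μp μh (fun x => γ * f x) ω ω'

/-- `ν_β = ν + iβh`. -/
def nuBeta (ν h : ℂ → ℂ) (β : ℂ) (x : ℂ) : ℂ := ν x + I * β * h x

/-- The kernel `γ U[γ ν_β]({μ_p}, {μ_h})` at the parameters `z = (μ_p, μ_h, β, γ)`. -/
def paramKernel (c q : ℝ) (ν h : ℂ → ℂ) {n : ℕ} (z : Params n) : ℂ → ℂ → ℂ :=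
  scaledKernel c q z.1 z.2.1 (nuBeta ν h z.2.2.1) z.2.2.2

/-- The function `𝓕(z)`: Barnes factors, times `∏ (e^{-2iπγν_β(μ_h)} - 1)`, times
`det_Γ [I + γ U[γ ν_β]]`. -/
def regDet (c q : ℝ) (ν h : ℂ → ℂ) (Γ : ℝ → ℂ) {n : ℕ} (z : Params n) : ℂ :=
  barnesG (1 - z.2.2.2 * nuBeta ν h z.2.2.1 (-q)) *
    barnesG (2 + z.2.2.2 * nuBeta ν h z.2.2.1 q) *
    (∏ a, (exp (-2 * I * Real.pi * (z.2.2.2 * nuBeta ν h z.2.2.1 (z.2.1 a))) - 1)) *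
    fredholmDet Γ (paramKernel c q ν h z)

/-- `lieb` is the derivative of `theta` around the real axis. -/
theorem hasDerivAt_theta {c : ℝ} {x : ℂ} (hx : |x.im| < c) :
    HasDerivAt (theta c) (lieb c x) x := by
  have h1 : I * c - x ≠ 0 := by
    intro h
    have := congrArg Complex.im h
    simp at this
    rw [abs_lt] at hx; linarith
  have h2 : I * c + x ≠ 0 := by
    intro h
    have := congrArg Complex.im h
    simp at this
    rw [abs_lt] at hx; linarith
  have hs : (I * c + x) / (I * c - x) ∈ slitPlane := by
    rw [mem_slitPlane_iff_not_le_zero]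
    intro hle
    rw [Complex.le_def] at hle
    obtain ⟨hre, him⟩ := hle
    set r : ℂ := (I * c + x) / (I * c - x) with hr
    have hrr : r = ((r.re : ℝ) : ℂ) := by
      apply Complex.ext <;> simp
      simpa using him
    have hm : I * c + x = r * (I * c - x) := by rw [hr]; field_simp
    rw [hrr] at hm
    have := congrArg Complex.im hm
    simp at this hre
    rw [abs_lt] at hx
    nlinarith
  have hd : HasDerivAt (fun y : ℂ => (I * c + y) / (I * c - y))
      ((1 * (I * c - x) - (I * c + x) * (-1)) / (I * c - x) ^ 2) x :=
    ((hasDerivAt_id x).const_add _).div ((hasDerivAt_id x).const_sub _) h1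
  have := (hd.clog hs).const_mul I
  refine this.congr_deriv ?_
  have h3 : x ^ 2 + (c : ℂ) ^ 2 ≠ 0 := by
    have : x ^ 2 + (c : ℂ) ^ 2 = -((I * c - x) * (I * c + x)) := by
      ring_nf; rw [I_sq]; ring
    rw [this]; exact neg_ne_zero.mpr (mul_ne_zero h1 h2)
  unfold lieb
  field_simp
  ring_nf
  simp only [I_sq]
  ring

end NLSM

end

/-! The kernel is a product `weight(ω) · lieb(ω - ω')`. The second factor is holomorphic and bounded
on a box around the loop, so every term of the Fredholm series sees the weight only through the
functional `ψ ↦ ∮ w ψ` on functions `ψ` holomorphic inside the loop. The continuation comes from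
rewriting this functional.

Put `u = γ ν_β(ω)` and `ℓ = log ((ω - q)/(ω + q))`. Separating the logarithm from the Cauchy
transform (`segmentTransform_eq`) shows that, for `γ ≠ 0`, the weight is elementary up to the factor
`e^{uℓ} / (e^{-2iπu} - 1)`. This has poles only at integer values of `u`. Its partial fractions
(`regularQuotient_eq`) consist of a part regular for `|u + 1/2| < N + 1`, where nothing goes wrong
near the loop, and of the terms `e^{kℓ} / (u - k)`. In the latter the logarithm disappears: `e^{kℓ}`
is the rational function `((ω - q)/(ω + q))^k`. While the phase avoids the integers inside the loop,
such a term is meromorphic there, its only possible poles being the `μ_h`, together with `-q` to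
order `j` if `k = j` and `q` to order `j` if `k = -1 - j` (`pole_residue_eq`).

If these poles are simple, the residue theorem turns the polar terms into point masses whose
denominators are `γ ν_β(x) - k` at the poles `x`. A determinant with a repeated point vanishes, so
each atom enters the Fredholm determinant at most linearly (`fredDet_cons_atom`), and multiplication
by the product of the denominators leaves a holomorphic expression (`fredExp_eq`). That product is
what the prefactor supplies: `G(1 - γν_β(-q))` and `G(2 + γν_β(q))` vanish to order `j` at the
values `j` and `-1 - j` of the phase, and `∏ (e^{-2iπγν_β(μ_h)} - 1)` vanishes at every integer
(`exists_barnesG_mul_eq`).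

Multiple and colliding poles are handled by giving them distinct velocities and moving them for a
complex time `t`. On a suitable circle `|t| = r` all poles of a given term are simple. The wanted
quantity is holomorphic in `t`, so its value at `t = 0` is a Cauchy integral over this circle, and
the integral still makes sense when the phase meets integers (`exists_moving_poles`).

This gives continuations over bounded sets of `β` and `γ`, with `μ_h` near a given point. All
domains are convex and share points where the original determinant is defined, so the pieces glue by
the identity theorem (`Admissible.exists_continuation`); the result is analytic for all complex `β`
and `γ`. Holomorphy in several variables rests on Osgood's lemma for Banach-valued functions,
convergence of the series on Hadamard's inequality. -/

noncomputable section
namespace NLSM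

/-! ### Holomorphy in several variables -/

section Osgood

open Metric Topology

variable {E F : Type} [NormedAddCommGroup E] [NormedSpace ℂ E]
  [NormedAddCommGroup F] [NormedSpace ℂ F]

/-- Continuity together with holomorphy along every complex line. -/
def IsLineHolo (f : E → F) (U : Set E) : Prop :=
  ContinuousOn f U ∧ ∀ z ∈ U, ∀ v, DifferentiableAt ℂ (fun s : ℂ => f (z + s • v)) 0

theorem differentiableAt_line_of_zero {f : E → F} {z v : E} {s₀ : ℂ}
    (h : DifferentiableAt ℂ (fun s : ℂ => f (z + s₀ • v + s • v)) 0) :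
    DifferentiableAt ℂ (fun s : ℂ => f (z + s • v)) s₀ := by
  have h2 : DifferentiableAt ℂ (fun s : ℂ => s - s₀) s₀ := by fun_prop
  have h3 : DifferentiableAt ℂ (fun s : ℂ => f (z + s₀ • v + s • v)) (s₀ - s₀) := by
    simpa using h
  have := DifferentiableAt.comp (g := fun s : ℂ => f (z + s₀ • v + s • v)) (f := fun s : ℂ => s - s₀)
    s₀ h3 h2
  refine this.congr_of_eventuallyEq (Filter.Eventually.of_forall fun s => ?_)
  simp only [Function.comp]
  congr 1
  module

theorem exists_line_subset {U : Set E} (hU : IsOpen U) {z : E} (hz : z ∈ U) (v : E) :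
    ∃ R > (0 : ℝ), ∀ s ∈ closedBall (0 : ℂ) R, z + s • v ∈ U := by
  have hc : Continuous fun s : ℂ => z + s • v := by fun_prop
  have : (fun s : ℂ => z + s • v) ⁻¹' U ∈ 𝓝 (0 : ℂ) :=
    hc.continuousAt.preimage_mem_nhds (hU.mem_nhds (by simpa using hz))
  obtain ⟨R, hR, h⟩ := Metric.nhds_basis_closedBall.mem_iff.1 this
  exact ⟨R, hR, h⟩

theorem isLineHolo_of_differentiableOn {f : E → F} {U : Set E} (hU : IsOpen U)
    (h : DifferentiableOn ℂ f U) : IsLineHolo f U := by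
  refine ⟨h.continuousOn, fun z hz v => ?_⟩
  have h1 : DifferentiableAt ℂ f (z + (0 : ℂ) • v) := by
    simpa using h.differentiableAt (hU.mem_nhds hz)
  exact h1.comp (0 : ℂ) (by fun_prop)

variable {K : Type} [TopologicalSpace K] [CompactSpace K]

/-- Evaluation at `k` is a continuous linear map and commutes with the circle integral. Hence the
Cauchy integral of `g`, a power series with values in `C(K, F)`, agrees with `g` by the Cauchy
formula at each `k`. -/
theorem analyticAt_continuousMap [CompleteSpace F] {g : ℂ → C(K, F)} {c : ℂ} {R : ℝ} (hR : 0 < R)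
    (hg : ContinuousOn g (closedBall c R))
    (hd : ∀ k, DifferentiableOn ℂ (fun s => g s k) (closedBall c R)) : AnalyticAt ℂ g c := by
  lift R to NNReal using hR.le
  have hR' : 0 < R := by exact_mod_cast hR
  have hci : CircleIntegrable g c R :=
    ContinuousOn.circleIntegrable R.2 (hg.mono sphere_subset_closedBall)
  have h1 := (hasFPowerSeriesOn_cauchy_integral hci hR').analyticAt
  refine h1.congr ?_
  filter_upwards [Metric.ball_mem_nhds c hR] with s hs
  ext k
  let ev : C(K, F) →L[ℂ] F := ContinuousMap.evalCLM ℂ k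
  have hint : CircleIntegrable (fun z => (z - s)⁻¹ • g z) c R := by
    refine ContinuousOn.circleIntegrable R.2 (ContinuousOn.fun_smul ?_
      (hg.mono sphere_subset_closedBall))
    refine ContinuousOn.inv₀ (by fun_prop) fun z hz h0 => ?_
    rw [sub_eq_zero] at h0
    subst h0
    simp only [mem_sphere, mem_ball] at hz hs
    linarith
  have h2 : ev (∮ z in C(c, R), (z - s)⁻¹ • g z) = ∮ z in C(c, R), (z - s)⁻¹ • (g z k) := by
    simp only [circleIntegral]
    rw [← ContinuousLinearMap.intervalIntegral_comp_comm _ hint.out]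
    refine intervalIntegral.integral_congr fun θ _ => ?_
    simp [ev]
  have h3 := (hd k).circleIntegral_sub_inv_smul hs
  change ev ((2 * (Real.pi : ℂ) * I)⁻¹ • ∮ z in C(c, R), (z - s)⁻¹ • g z) = g s k
  rw [map_smul, h2, h3, smul_smul, inv_mul_cancel₀ (by simp [Real.pi_ne_zero]), one_smul]

/-- A family indexed by a compact space becomes a single function with values in the Banach space
`C(K, F)`. Osgood's lemma for such values gives holomorphy uniformly in `k`, which is what
integration over `k` needs. -/
theorem exists_curry_isLineHolo [CompleteSpace F] {U : Set E} (hU : IsOpen U) {f : E → K → F}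
    (hc : ContinuousOn (fun p : E × K => f p.1 p.2) (U ×ˢ univ))
    (hl : ∀ k, ∀ z ∈ U, ∀ v, DifferentiableAt ℂ (fun s : ℂ => f (z + s • v) k) 0) :
    ∃ g : E → C(K, F), IsLineHolo g U ∧ ∀ x ∈ U, ∀ k, g x k = f x k := by
  classical
  let c : C(U × K, F) := ⟨fun p => f p.1 p.2, by
    refine hc.comp_continuous (f := fun p : U × K => ((p.1 : E), p.2)) (by fun_prop) fun p => ?_
    simp⟩
  let g : E → C(K, F) := fun x => if h : x ∈ U then c.curry ⟨x, h⟩ else 0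
  have hgv : ∀ x ∈ U, ∀ k, g x k = f x k := by
    intro x hx k
    simp [g, hx, c]
  have hgc : ContinuousOn g U := by
    rw [continuousOn_iff_continuous_domRestrict]
    have : U.domRestrict g = c.curry := by
      funext x
      simp [g, Set.domRestrict]
    rw [this]
    exact c.curry.continuous
  refine ⟨g, ⟨hgc, fun z hz v => ?_⟩, hgv⟩
  obtain ⟨R, hR, hsub⟩ := exists_line_subset hU hz v
  refine (analyticAt_continuousMap hR ?_ fun k => ?_).differentiableAt
  · exact hgc.comp (by fun_prop) hsub
  · intro s hs
    have h1 : DifferentiableAt ℂ (fun s : ℂ => f (z + s • v) k) s :=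
      differentiableAt_line_of_zero (f := fun x => f x k) (hl k _ (hsub s hs) v)
    have h2 : (fun s : ℂ => g (z + s • v) k) =ᶠ[𝓝 s] fun s => f (z + s • v) k := by
      have : (fun s : ℂ => z + s • v) ⁻¹' U ∈ 𝓝 s :=
        ContinuousAt.preimage_mem_nhds (by fun_prop) (hU.mem_nhds (hsub s hs))
      filter_upwards [this] with s' hs'
      exact hgv _ hs' k
    exact (h1.congr_of_eventuallyEq h2).differentiableWithinAt

/-- Bilinear pairing of continuous functions on `K` along a path. -/
def pathPairing (a b : ℝ) (κ : C(ℝ, K)) (F : Type) [NormedAddCommGroup F] [NormedSpace ℂ F] :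
    C(K, ℂ) →L[ℂ] C(K, F) →L[ℂ] F :=
  LinearMap.mkContinuous₂
    (LinearMap.mk₂ ℂ (fun (φ : C(K, ℂ)) (ψ : C(K, F)) => ∫ t in a..b, φ (κ t) • ψ (κ t))
      (fun φ₁ φ₂ ψ => by
        simp only [ContinuousMap.add_apply, add_smul]
        exact intervalIntegral.integral_add
          (Continuous.intervalIntegrable (by fun_prop) _ _)
          (Continuous.intervalIntegrable (by fun_prop) _ _))
      (fun c φ ψ => by
        simp only [ContinuousMap.smul_apply, smul_assoc]
        exact intervalIntegral.integral_smul _ _)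
      (fun φ ψ₁ ψ₂ => by
        simp only [ContinuousMap.add_apply, smul_add]
        exact intervalIntegral.integral_add
          (Continuous.intervalIntegrable (by fun_prop) _ _)
          (Continuous.intervalIntegrable (by fun_prop) _ _))
      (fun c φ ψ => by
        simp only [ContinuousMap.smul_apply, smul_comm _ c]
        exact intervalIntegral.integral_smul _ _))
    |b - a|
    (fun φ ψ => by
      simp only [LinearMap.mk₂_apply]
      refine (intervalIntegral.norm_integral_le_of_norm_le_const (C := ‖φ‖ * ‖ψ‖)
        fun t _ => ?_).trans (le_of_eq (by ring))
      rw [norm_smul]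
      exact mul_le_mul (φ.norm_coe_le_norm _) (ψ.norm_coe_le_norm _) (norm_nonneg _)
        (norm_nonneg _))

@[simp] theorem pathPairing_apply (a b : ℝ) (κ : C(ℝ, K)) (φ : C(K, ℂ)) (ψ : C(K, F)) :
    pathPairing a b κ F φ ψ = ∫ t in a..b, φ (κ t) • ψ (κ t) := rfl

/-- The space `E` satisfies Osgood's lemma. -/
def HasOsgood (E : Type) [NormedAddCommGroup E] [NormedSpace ℂ E] : Prop :=
  ∀ (F : Type) [NormedAddCommGroup F] [NormedSpace ℂ F] [CompleteSpace F] (U : Set E) (f : E → F),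
    IsOpen U → IsLineHolo f U → AnalyticOnNhd ℂ f U

theorem HasOsgood.of_equiv {E' : Type} [NormedAddCommGroup E'] [NormedSpace ℂ E']
    (h : HasOsgood E) (e : E' ≃L[ℂ] E) : HasOsgood E' := by
  intro F _ _ _ U f hU hf z hz
  have h1 := h F (e.symm ⁻¹' U) (f ∘ e.symm) (hU.preimage e.symm.continuous)
    ⟨hf.1.comp e.symm.continuous.continuousOn fun _ hx => hx, fun x hx v => by
      simpa using hf.2 _ hx (e.symm v)⟩
  have h2 : AnalyticAt ℂ (f ∘ e.symm) (e z) := h1 (e z) (by simpa using hz)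
  have h3 : AnalyticAt ℂ e z := e.toContinuousLinearMap.analyticAt z
  have := h2.comp h3
  refine this.congr (Filter.Eventually.of_forall fun x => by simp)

/-- Cauchy's formula in the scalar variable writes `f (y, x)` as a continuous bilinear pairing of
the Cauchy kernel, analytic in `y`, with the restriction of `f (·, x)` to a circle, analytic in `x`
by the hypothesis on `E`. -/
theorem HasOsgood.prod (h : HasOsgood E) : HasOsgood (ℂ × E) := by
  intro F _ _ _ U f hU hf w hw
  obtain ⟨y₀, x₀⟩ := w
  obtain ⟨r, hr, hsub⟩ := Metric.nhds_basis_closedBall.mem_iff.1 (hU.mem_nhds hw)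
  have hsub' : ∀ y ∈ closedBall y₀ r, ∀ x ∈ ball x₀ r, (y, x) ∈ U := fun y hy x hx => hsub <| by
    rw [← closedBall_prod_same]
    exact ⟨hy, ball_subset_closedBall hx⟩
  have hs : ∀ k : sphere y₀ r, (k : ℂ) ∈ closedBall y₀ r := fun k => sphere_subset_closedBall k.2
  obtain ⟨g, hg, hgv⟩ := exists_curry_isLineHolo (K := sphere y₀ r) (isOpen_ball (x := x₀) (ε := r))
    (f := fun x k => f (k, x))
    (hf.1.comp (f := fun p : E × sphere y₀ r => ((p.2 : ℂ), p.1)) (by fun_prop)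
      fun p hp => hsub' _ (hs _) _ hp.1)
    (fun k z hz v => by simpa using hf.2 _ (hsub' _ (hs k) _ hz) (0, v))
  have hne : ∀ y ∈ ball y₀ r, ∀ k : sphere y₀ r, (k : ℂ) - y ≠ 0 := by
    intro y hy k h0
    have := k.2
    rw [sub_eq_zero.1 h0, mem_sphere] at this
    rw [mem_ball] at hy
    linarith
  obtain ⟨R, hR, hRv⟩ := exists_curry_isLineHolo (K := sphere y₀ r) (F := ℂ)
    (isOpen_ball (x := y₀) (ε := r))
    (f := fun y k => ((k : ℂ) - y)⁻¹)
    (ContinuousOn.inv₀ (by fun_prop) fun p hp => hne _ hp.1 _)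
    (fun k z hz v => DifferentiableAt.inv (by fun_prop) (by simpa using hne z hz k))
  have hgA : AnalyticAt ℂ g x₀ := h _ _ _ isOpen_ball hg x₀ (mem_ball_self hr)
  have hRA : AnalyticAt ℂ R y₀ := by
    have hd : DifferentiableOn ℂ R (ball y₀ r) := by
      intro y hy
      have := hR.2 y hy 1
      have h2 := differentiableAt_line_of_zero (f := R) (z := 0) (v := (1 : ℂ)) (s₀ := y)
        (by simpa using this)
      simpa using h2.differentiableWithinAt
    exact hd.analyticOnNhd isOpen_ball y₀ (mem_ball_self hr)
  let κ : C(ℝ, sphere y₀ r) := ⟨fun θ => ⟨circleMap y₀ r θ, circleMap_mem_sphere _ hr.le _⟩, by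
    fun_prop⟩
  -- `S` is the velocity of the circle `κ`; it makes the pairing over the angle a contour integral.
  obtain ⟨S, hSv⟩ : ∃ S : C(sphere y₀ r, ℂ), ∀ k, S k = ((k : ℂ) - y₀) * I :=
    ⟨⟨fun k => ((k : ℂ) - y₀) * I, by fun_prop⟩, fun k => rfl⟩
  have hfin : AnalyticAt ℂ (fun p : ℂ × E =>
      (2 * (Real.pi : ℂ) * I)⁻¹ • pathPairing 0 (2 * Real.pi) κ F (S * R p.1) (g p.2)) (y₀, x₀) := by
    refine AnalyticAt.const_smul ?_
    have h1 : AnalyticAt ℂ (fun p : ℂ × E => (S * R p.1, g p.2)) (y₀, x₀) := by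
      refine AnalyticAt.prod (analyticAt_const.mul (hRA.comp analyticAt_fst))
        (AnalyticAt.comp (g := g) (f := Prod.snd) hgA analyticAt_snd)
    exact ((pathPairing 0 (2 * Real.pi) κ F).analyticAt_bilinear _).comp h1
  refine hfin.congr ?_
  filter_upwards [(isOpen_ball.prod isOpen_ball).mem_nhds
    (show (y₀, x₀) ∈ ball y₀ r ×ˢ ball x₀ r from ⟨mem_ball_self hr, mem_ball_self hr⟩)] with p hp
  obtain ⟨y, x⟩ := p
  have hd : DifferentiableOn ℂ (fun y => f (y, x)) (closedBall y₀ r) := by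
    intro y hy
    have := hf.2 (y, x) (hsub' y hy x hp.2) (1, 0)
    have h2 := differentiableAt_line_of_zero (f := fun y => f (y, x)) (z := 0) (v := (1 : ℂ))
      (s₀ := y) (by simpa using this)
    simpa using h2.differentiableWithinAt
  have h3 := hd.circleIntegral_sub_inv_smul hp.1
  simp only [pathPairing_apply]
  have h4 : (∫ t in (0 : ℝ)..2 * Real.pi, (S * R y) (κ t) • g x (κ t)) =
      ∮ z in C(y₀, r), (z - y)⁻¹ • f (z, x) := by
    rw [circleIntegral]
    refine intervalIntegral.integral_congr fun θ _ => ?_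
    simp only [ContinuousMap.mul_apply]
    rw [hgv x hp.2, hRv y hp.1, hSv, mul_smul]
    simp [κ, circleMap]
  rw [h4, h3, smul_smul, inv_mul_cancel₀ (by simp [Real.pi_ne_zero]), one_smul]

theorem hasOsgood_fin (n : ℕ) : HasOsgood (Fin n → ℂ) := by
  induction n with
  | zero =>
    intro F _ _ _ U f _ _ z _
    have : f = fun _ => f z := by
      funext x
      rw [Subsingleton.elim x z]
    rw [this]
    exact analyticAt_const
  | succ n ih =>
    refine ih.prod.of_equiv (ContinuousLinearEquiv.ofFinrankEq ?_)
    simp [Module.finrank_prod]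
    ring

theorem hasOsgood_of_finiteDimensional [FiniteDimensional ℂ E] : HasOsgood E :=
  (hasOsgood_fin (Module.finrank ℂ E)).of_equiv (ContinuousLinearEquiv.ofFinrankEq (by simp))

theorem analyticOnNhd_of_isLineHolo [FiniteDimensional ℂ E] [CompleteSpace F] {U : Set E}
    (hU : IsOpen U) {f : E → F} (h : IsLineHolo f U) : AnalyticOnNhd ℂ f U :=
  hasOsgood_of_finiteDimensional F U f hU h

theorem analyticOnNhd_of_differentiableOn [FiniteDimensional ℂ E] [CompleteSpace F] {U : Set E}
    (hU : IsOpen U) {f : E → F} (h : DifferentiableOn ℂ f U) : AnalyticOnNhd ℂ f U :=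
  analyticOnNhd_of_isLineHolo hU (isLineHolo_of_differentiableOn hU h)

/-- Integrals along a path of a jointly holomorphic function are holomorphic in the parameters. -/
theorem differentiableOn_pathIntegral [FiniteDimensional ℂ E] {U : Set E} (hU : IsOpen U)
    {V : Set ℂ} {f : E → ℂ → ℂ} {γ κ : ℝ → ℂ} {a b : ℝ} (hab : a ≤ b)
    (hf : DifferentiableOn ℂ (fun p : E × ℂ => f p.1 p.2) (U ×ˢ V))
    (hγ : ContinuousOn γ (Icc a b)) (hκ : ContinuousOn κ (Icc a b)) (hV : MapsTo γ (Icc a b) V) :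
    DifferentiableOn ℂ (fun z => ∫ t in a..b, κ t * f z (γ t)) U := by
  have hγ' : Continuous fun t : Icc a b => γ t := hγ.domRestrict
  have hκ' : Continuous fun t : Icc a b => κ t := hκ.domRestrict
  obtain ⟨g, hg, hgv⟩ := exists_curry_isLineHolo (K := Icc a b) hU (f := fun z t => f z (γ t))
    (hf.continuousOn.comp (f := fun p : E × Icc a b => (p.1, γ p.2))
      (continuous_fst.prodMk (hγ'.comp continuous_snd)).continuousOn
      fun p hp => ⟨hp.1, hV p.2.2⟩)
    (fun k z hz v => by
      have h1 : DifferentiableOn ℂ (fun z => f z (γ k)) U :=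
        hf.comp (f := fun z => (z, γ k)) (by fun_prop) fun z hz => ⟨hz, hV k.2⟩
      exact (isLineHolo_of_differentiableOn hU h1).2 z hz v)
  -- After this, the integral is a continuous linear functional applied to a holomorphic function
  -- with values in `C(Icc a b, ℂ)`.
  have hgd := (analyticOnNhd_of_isLineHolo hU hg).differentiableOn
  let κ' : C(Icc a b, ℂ) := ⟨fun t => κ t, hκ'⟩
  let π : C(ℝ, Icc a b) := ⟨projIcc a b hab, continuous_projIcc⟩
  have h2 : DifferentiableOn ℂ (fun z => pathPairing a b π ℂ κ' (g z)) U :=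
    (pathPairing a b π ℂ κ').differentiable.comp_differentiableOn hgd
  refine h2.congr fun z hz => ?_
  rw [pathPairing_apply]
  refine intervalIntegral.integral_congr fun t ht => ?_
  rw [uIcc_of_le hab] at ht
  simp only [smul_eq_mul]
  rw [hgv z hz]
  simp [π, κ', projIcc_of_mem hab ht]

/-- Locally normally convergent series of holomorphic functions. -/
theorem differentiableOn_tsum_of_locally_bounded [FiniteDimensional ℂ E] {U : Set E}
    (hU : IsOpen U) {f : ℕ → E → ℂ} (hf : ∀ n, DifferentiableOn ℂ (f n) U)
    (hb : ∀ z ∈ U, ∃ V ∈ 𝓝 z, ∃ u : ℕ → ℝ, Summable u ∧ ∀ n, ∀ w ∈ V ∩ U, ‖f n w‖ ≤ u n) :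
    DifferentiableOn ℂ (fun z => ∑' n, f n z) U := by
  refine (analyticOnNhd_of_isLineHolo hU ⟨fun z hz => ?_, fun z hz v => ?_⟩).differentiableOn
  · obtain ⟨V, hV, u, hu, hfu⟩ := hb z hz
    have h1 : ContinuousOn (fun z => ∑' n, f n z) (V ∩ U) :=
      continuousOn_tsum (fun n => (hf n).continuousOn.mono inter_subset_right) hu hfu
    exact (h1.continuousAt (Filter.inter_mem hV (hU.mem_nhds hz))).continuousWithinAt
  · obtain ⟨V, hV, u, hu, hfu⟩ := hb z hz
    have hm : V ∩ U ∈ 𝓝 z := Filter.inter_mem hV (hU.mem_nhds hz)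
    obtain ⟨W, hW, hWo, hzW⟩ := _root_.mem_nhds_iff.1 hm
    have hL : Continuous fun s : ℂ => z + s • v := by fun_prop
    have h2 : DifferentiableOn ℂ (fun s : ℂ => ∑' n, f n (z + s • v))
        ((fun s : ℂ => z + s • v) ⁻¹' W) :=
      differentiableOn_tsum_of_summable_norm hu
        (fun n => (hf n).comp (by fun_prop) fun s hs => (hW hs).2) (hWo.preimage hL)
        (fun n s hs => hfu n _ (hW hs))
    exact h2.differentiableAt ((hWo.preimage hL).mem_nhds (by simpa using hzW))

end Osgood

/-! ### Elliptic loops -/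

section Ellipse

open Topology

/-- The ellipse with half-axes `a` and `b`. -/
def ellipse (a b : ℝ) (t : ℝ) : ℂ :=
  a * Real.cos (2 * Real.pi * t) + I * (b * Real.sin (2 * Real.pi * t))

/-- The quadratic form whose unit circle is the ellipse. -/
def ellipseForm (a b : ℝ) (z : ℂ) : ℝ := (z.re / a) ^ 2 + (z.im / b) ^ 2

@[simp] theorem ellipse_re (a b t : ℝ) : (ellipse a b t).re = a * Real.cos (2 * Real.pi * t) := by
  simp [ellipse, -ofReal_cos, -ofReal_sin]

@[simp] theorem ellipse_im (a b t : ℝ) : (ellipse a b t).im = b * Real.sin (2 * Real.pi * t) := by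
  simp [ellipse, -ofReal_cos, -ofReal_sin]

theorem ellipseForm_ellipse {a b : ℝ} (ha : 0 < a) (hb : 0 < b) (t : ℝ) :
    ellipseForm a b (ellipse a b t) = 1 := by
  simp only [ellipseForm, ellipse_re, ellipse_im]
  rw [mul_div_cancel_left₀ _ ha.ne', mul_div_cancel_left₀ _ hb.ne']
  exact Real.cos_sq_add_sin_sq _

/-- The derivative of the elliptic loop. -/
def ellipseDeriv (a b : ℝ) (t : ℝ) : ℂ :=
  2 * Real.pi * (-(a * Real.sin (2 * Real.pi * t)) + I * (b * Real.cos (2 * Real.pi * t)))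

theorem hasDerivAt_ellipse (a b t : ℝ) : HasDerivAt (ellipse a b) (ellipseDeriv a b t) t := by
  have h0 : HasDerivAt (fun t : ℝ => 2 * Real.pi * t) (2 * Real.pi) t := by
    simpa using (hasDerivAt_id t).const_mul (2 * Real.pi)
  have h1 := (h0.cos.ofReal_comp).const_mul (a : ℂ)
  have h2 := ((h0.sin.ofReal_comp).const_mul (b : ℂ)).const_mul I
  refine (h1.add h2).congr_deriv ?_
  simp only [ellipseDeriv]
  push_cast
  ring

theorem deriv_ellipse (a b : ℝ) : deriv (ellipse a b) = ellipseDeriv a b :=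
  funext fun t => (hasDerivAt_ellipse a b t).deriv

theorem continuous_ellipseDeriv (a b : ℝ) : Continuous (ellipseDeriv a b) := by
  unfold ellipseDeriv
  fun_prop

theorem continuous_ellipse (a b : ℝ) : Continuous (ellipse a b) := by
  unfold ellipse
  fun_prop

theorem ellipse_periodic (a b : ℝ) : Function.Periodic (ellipse a b) 1 := by
  intro t
  have : 2 * Real.pi * (t + 1) = 2 * Real.pi * t + 2 * Real.pi := by ring
  simp only [ellipse, this, Real.cos_add_two_pi, Real.sin_add_two_pi]

theorem isSimpleLoop_ellipse {a b : ℝ} (ha : 0 < a) (hb : 0 < b) : IsSimpleLoop (ellipse a b) where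
  contDiff := by
    rw [contDiff_one_iff_deriv]
    exact ⟨fun t => (hasDerivAt_ellipse a b t).differentiableAt,
      deriv_ellipse a b ▸ continuous_ellipseDeriv a b⟩
  periodic := ellipse_periodic a b
  injOn := by
    intro s hs t ht hst
    have h1 := congrArg Complex.re hst
    have h2 := congrArg Complex.im hst
    simp only [ellipse_re, ellipse_im] at h1 h2
    have h3 := mul_left_cancel₀ ha.ne' h1
    have h4 := mul_left_cancel₀ hb.ne' h2
    have h5 : Complex.exp ((2 * Real.pi * s : ℝ) * I) = Complex.exp ((2 * Real.pi * t : ℝ) * I) := by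
      rw [Complex.exp_mul_I, Complex.exp_mul_I, ← ofReal_cos, ← ofReal_cos, ← ofReal_sin,
        ← ofReal_sin, h3, h4]
    obtain ⟨n, hn⟩ := Complex.exp_eq_exp_iff_exists_int.1 h5
    have h6 : s = t + n := by
      have := congrArg Complex.im hn
      simp at this
      have hp := Real.pi_pos
      have h7 : 2 * Real.pi * (s - t - n) = 0 := by linarith
      have := (mul_eq_zero.1 h7).resolve_left (by positivity)
      linarith
    have hn0 : n = 0 := by
      have h8 : (n : ℝ) < 1 := by linarith [hs.2, ht.1]
      have h9 : (-1 : ℝ) < n := by linarith [hs.1, ht.2]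
      have : n < 1 := by exact_mod_cast h8
      have : -1 < n := by exact_mod_cast h9
      omega
    rw [h6, hn0]; simp
  deriv_ne_zero := by
    intro t h0
    rw [deriv_ellipse] at h0
    unfold ellipseDeriv at h0
    have h1 : (-(a * Real.sin (2 * Real.pi * t)) + I * (b * Real.cos (2 * Real.pi * t)) : ℂ) = 0 :=
      (mul_eq_zero.1 h0).resolve_left (by simp [Real.pi_ne_zero])
    have h2 := congrArg Complex.re h1
    have h3 := congrArg Complex.im h1
    simp [-ofReal_cos, -ofReal_sin, ha.ne', hb.ne'] at h2 h3
    have := Real.sin_sq_add_cos_sq (2 * Real.pi * t)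
    rw [h2, h3] at this
    norm_num at this

/-! ### Winding numbers of ellipses through the Joukowski map -/

/-- The point `e^{2iπt}` of the unit circle. -/
def unitPoint (t : ℝ) : ℂ := exp (2 * Real.pi * t * I)

theorem unitPoint_eq (t : ℝ) :
    unitPoint t = Real.cos (2 * Real.pi * t) + Real.sin (2 * Real.pi * t) * I := by
  rw [unitPoint, Complex.exp_mul_I]; push_cast; rfl

theorem unitPoint_inv (t : ℝ) :
    (unitPoint t)⁻¹ = Real.cos (2 * Real.pi * t) - Real.sin (2 * Real.pi * t) * I := by
  rw [unitPoint, ← Complex.exp_neg, ← neg_mul, Complex.exp_mul_I, Complex.cos_neg,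
    Complex.sin_neg]; push_cast; ring

theorem ellipse_eq_joukowski (a b t : ℝ) :
    ellipse a b t = (a + b) / 2 * unitPoint t + (a - b) / 2 * (unitPoint t)⁻¹ := by
  rw [unitPoint_inv, unitPoint_eq, ellipse]; ring

theorem ellipseDeriv_eq_joukowski (a b t : ℝ) :
    ellipseDeriv a b t =
      2 * Real.pi * I * ((a + b) / 2 * unitPoint t - (a - b) / 2 * (unitPoint t)⁻¹) := by
  rw [unitPoint_inv, unitPoint_eq, ellipseDeriv]
  linear_combination (-(2 * Real.pi * a * Real.sin (2 * Real.pi * t)) : ℂ) * I_mul_I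

theorem unitPoint_ne_zero (t : ℝ) : unitPoint t ≠ 0 := Complex.exp_ne_zero _

theorem continuous_unitPoint : Continuous unitPoint := by unfold unitPoint; fun_prop

theorem integral_unitPoint (f : ℂ → ℂ) :
    ∫ t in (0 : ℝ)..1, 2 * Real.pi * I * (unitPoint t * f (unitPoint t)) = ∮ u in C(0, 1), f u := by
  rw [circleIntegral]
  have h := intervalIntegral.integral_comp_mul_left (a := 0) (b := 1)
    (fun θ => deriv (circleMap 0 1) θ • f (circleMap 0 1 θ))
    (show (2 * Real.pi) ≠ 0 by positivity)
  simp only [mul_zero, mul_one] at h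
  rw [← inv_smul_smul₀ (show (2 * Real.pi) ≠ 0 by positivity)
    (∫ θ in (0 : ℝ)..2 * Real.pi, deriv (circleMap 0 1) θ • f (circleMap 0 1 θ)), smul_comm, ← h,
    ← intervalIntegral.integral_smul]
  refine intervalIntegral.integral_congr fun t _ => ?_
  simp [circleMap, unitPoint]
  ring

theorem integral_unitPoint_sub_inv {w : ℂ} (hw : ‖w‖ ≠ 1) :
    ∫ t in (0 : ℝ)..1, 2 * Real.pi * I * (unitPoint t * (unitPoint t - w)⁻¹) =
      if ‖w‖ < 1 then 2 * Real.pi * I else 0 := by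
  rw [integral_unitPoint (fun u => (u - w)⁻¹)]
  split_ifs with h
  · exact circleIntegral.integral_sub_inv_of_mem_ball (by simpa using h)
  · refine DiffContOnCl.circleIntegral_eq_zero zero_le_one ?_
    refine DifferentiableOn.diffContOnCl ?_
    intro u hu
    have hu' : ‖u‖ ≤ 1 := by
      have := Metric.closure_ball_subset_closedBall hu
      simpa using this
    refine (DifferentiableAt.inv (by fun_prop) fun h0 => ?_).differentiableWithinAt
    rw [sub_eq_zero.1 h0] at hu'
    exact hw (le_antisymm hu' (not_lt.1 h))

/-- In polar coordinates of `u` the Joukowski map acts separately on the real and the imaginary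
part. The form becomes a convex combination of two squares that depend only on `‖u‖`. -/
theorem ellipseForm_joukowski {a b : ℝ} {u z : ℂ} (hu : u ≠ 0)
    (hz : z = (a + b) / 2 * u + (a - b) / 2 * u⁻¹) :
    ellipseForm a b z =
      (u.re / ‖u‖) ^ 2 * (((a + b) / 2 * ‖u‖ + (a - b) / 2 / ‖u‖) / a) ^ 2 +
      (u.im / ‖u‖) ^ 2 * (((a + b) / 2 * ‖u‖ - (a - b) / 2 / ‖u‖) / b) ^ 2 := by
  have hn : ‖u‖ ≠ 0 := norm_ne_zero_iff.2 hu
  have h1 : z = ((a + b) / 2 : ℝ) * u + ((a - b) / 2 : ℝ) * u⁻¹ := by rw [hz]; push_cast; ring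
  have hre : z.re = u.re / ‖u‖ * ((a + b) / 2 * ‖u‖ + (a - b) / 2 / ‖u‖) := by
    rw [h1, add_re, re_ofReal_mul, re_ofReal_mul, inv_re, normSq_eq_norm_sq]
    field_simp
  have him : z.im = u.im / ‖u‖ * ((a + b) / 2 * ‖u‖ - (a - b) / 2 / ‖u‖) := by
    rw [h1, add_im, im_ofReal_mul, im_ofReal_mul, inv_im, normSq_eq_norm_sq]
    field_simp
    ring
  rw [ellipseForm, hre, him]
  ring

theorem one_le_ellipseForm_of_one_le {a b : ℝ} (hb : 0 < b) (hab : b < a) {u z : ℂ}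
    (hu : 1 ≤ ‖u‖) (hz : z = (a + b) / 2 * u + (a - b) / 2 * u⁻¹) : 1 ≤ ellipseForm a b z := by
  have hn : 0 < ‖u‖ := by linarith
  rw [ellipseForm_joukowski (norm_pos_iff.1 hn) hz]
  have hs : (u.re / ‖u‖) ^ 2 + (u.im / ‖u‖) ^ 2 = 1 := by
    rw [div_pow, div_pow, ← add_div, ← Complex.sq_norm_sub_sq_im u]
    field_simp
    ring
  have hinv : (‖u‖)⁻¹ ≤ 1 := inv_le_one_of_one_le₀ hu
  have hmul : ‖u‖ * ‖u‖⁻¹ = 1 := mul_inv_cancel₀ hn.ne'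
  have h1 : 1 ≤ (((a + b) / 2 * ‖u‖ + (a - b) / 2 / ‖u‖) / a) ^ 2 := by
    refine one_le_pow₀ ?_
    rw [le_div_iff₀ (by linarith), div_eq_mul_inv ((a - b) / 2)]
    nlinarith [mul_nonneg (sub_nonneg.2 hu) (sub_nonneg.2 hinv),
      mul_nonneg (sub_nonneg.2 hu) hb.le]
  have h2 : 1 ≤ (((a + b) / 2 * ‖u‖ - (a - b) / 2 / ‖u‖) / b) ^ 2 := by
    refine one_le_pow₀ ?_
    rw [le_div_iff₀ (by linarith), div_eq_mul_inv ((a - b) / 2)]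
    nlinarith [mul_nonneg (sub_nonneg.2 hu) hb.le, mul_nonneg (sub_nonneg.2 hab.le)
      (sub_nonneg.2 hinv), mul_nonneg (sub_nonneg.2 hab.le) (sub_nonneg.2 hu)]
  nlinarith [sq_nonneg (u.re / ‖u‖), sq_nonneg (u.im / ‖u‖)]

/-- The lower bound on `‖u‖` says that the other preimage of `z`, whose product with `u` is `(a -
b)/(a + b)`, is also in the closed unit disc. This keeps both squares at most `1`. -/
theorem ellipseForm_le_one_of_le {a b : ℝ} (hb : 0 < b) (hab : b < a) {u z : ℂ}
    (hu : ‖u‖ ≤ 1) (hu' : (a - b) / (a + b) ≤ ‖u‖)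
    (hz : z = (a + b) / 2 * u + (a - b) / 2 * u⁻¹) : ellipseForm a b z ≤ 1 := by
  have hd : 0 < (a - b) / (a + b) := div_pos (by linarith) (by linarith)
  have hn : 0 < ‖u‖ := by linarith
  rw [ellipseForm_joukowski (norm_pos_iff.1 hn) hz]
  have hs : (u.re / ‖u‖) ^ 2 + (u.im / ‖u‖) ^ 2 = 1 := by
    rw [div_pow, div_pow, ← add_div, ← Complex.sq_norm_sub_sq_im u]
    field_simp
    ring
  have h3 : (a - b) / 2 / ‖u‖ ≤ (a + b) / 2 := by
    rw [div_le_iff₀ hn]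
    rw [div_le_iff₀ (by linarith)] at hu'
    linarith
  have h4 : (a - b) / 2 ≤ (a - b) / 2 / ‖u‖ := by
    rw [le_div_iff₀ hn]
    nlinarith
  have h5 : (a - b) / 2 / ‖u‖ * ‖u‖ = (a - b) / 2 := div_mul_cancel₀ _ hn.ne'
  have h1 : (((a + b) / 2 * ‖u‖ + (a - b) / 2 / ‖u‖) / a) ^ 2 ≤ 1 := by
    rw [sq_le_one_iff_abs_le_one, abs_le, le_div_iff₀ (by linarith), div_le_iff₀ (by linarith)]
    constructor
    · have : 0 ≤ (a + b) / 2 * ‖u‖ := mul_nonneg (by linarith) (norm_nonneg _)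
      have h6 : 0 ≤ (a - b) / 2 := by linarith
      linarith
    · nlinarith [mul_nonneg (sub_nonneg.2 hu) (sub_nonneg.2 h3)]
  have h2 : (((a + b) / 2 * ‖u‖ - (a - b) / 2 / ‖u‖) / b) ^ 2 ≤ 1 := by
    rw [sq_le_one_iff_abs_le_one, abs_le, le_div_iff₀ (by linarith), div_le_iff₀ (by linarith)]
    rw [div_le_iff₀ (by linarith)] at hu'
    constructor <;> nlinarith
  nlinarith [sq_nonneg (u.re / ‖u‖), sq_nonneg (u.im / ‖u‖)]

/-- In the Joukowski coordinate, `Γ - z = A (u - u₁)(u - u₂) / u`, so the winding number is the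
number of preimages `u₁`, `u₂` in the unit disc minus one. Since `u₁ u₂ = (a - b)/(a + b) < 1`, at
least one is in the disc; the number is `1` exactly when both are. -/
theorem windingNumber_ellipse {a b : ℝ} (hb : 0 < b) (hab : b < a) {z : ℂ}
    (hz : z ∉ range (ellipse a b)) :
    (ellipseForm a b z < 1 → windingNumber (ellipse a b) z = 1) ∧
      (windingNumber (ellipse a b) z ≠ 0 → ellipseForm a b z ≤ 1) := by
  set A : ℂ := (a + b) / 2 with hA
  set B : ℂ := (a - b) / 2 with hB
  have hA0 : A ≠ 0 := by
    rw [hA]; norm_cast; exact (by linarith : (0 : ℝ) < (a + b) / 2).ne'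
  have hB0 : B ≠ 0 := by
    rw [hB]; norm_cast
    exact (by linarith : (0 : ℝ) < (a - b) / 2).ne'
  -- A square root of the discriminant of `A u² - z u + B`, whose roots are the preimages of `z`.
  obtain ⟨s, hs⟩ := IsAlgClosed.exists_pow_nat_eq (discrim A (-z) B) zero_lt_two
  set u₁ : ℂ := (z + s) / (2 * A) with hu₁
  set u₂ : ℂ := (z - s) / (2 * A) with hu₂
  have hsum : A * (u₁ + u₂) = z := by rw [hu₁, hu₂]; field_simp; ring
  have hprod : A * (u₁ * u₂) = B := by
    rw [hu₁, hu₂]; unfold discrim at hs; field_simp; linear_combination (-1 : ℂ) * hs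
  have h10 : u₁ ≠ 0 := by rintro h; rw [h] at hprod; simp at hprod; exact hB0 hprod.symm
  have h20 : u₂ ≠ 0 := by rintro h; rw [h] at hprod; simp at hprod; exact hB0 hprod.symm
  have hz1 : z = A * u₁ + B * u₁⁻¹ := by rw [← hprod, ← hsum]; field_simp
  have hz2 : z = A * u₂ + B * u₂⁻¹ := by rw [← hprod, ← hsum]; field_simp; ring
  have hfac : ∀ t, ellipse a b t - z =
      A * (unitPoint t - u₁) * (unitPoint t - u₂) * (unitPoint t)⁻¹ := by
    intro t
    have h0 := unitPoint_ne_zero t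
    rw [ellipse_eq_joukowski, ← hA, ← hB, ← hprod, ← hsum]
    field_simp
    ring
  have hne : ∀ t, (unitPoint t - u₁ ≠ 0) ∧ (unitPoint t - u₂ ≠ 0) := by
    intro t
    have h0 : ellipse a b t - z ≠ 0 := fun h => hz ⟨t, sub_eq_zero.1 h⟩
    rw [hfac] at h0
    constructor <;> intro h <;> rw [h] at h0 <;> simp at h0
  have hn : ∀ u : ℂ, (∀ t, unitPoint t - u ≠ 0) → ‖u‖ ≠ 1 := by
    intro u hu h1
    refine hu (arg u / (2 * Real.pi)) ?_
    have : unitPoint (arg u / (2 * Real.pi)) = u := by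
      conv_rhs => rw [← Complex.norm_mul_exp_arg_mul_I u, h1]
      rw [unitPoint]
      push_cast
      rw [one_mul]
      congr 2
      have : (Real.pi : ℂ) ≠ 0 := by simp [Real.pi_ne_zero]
      field_simp
    rw [this, sub_self]
  have hn1 := hn u₁ fun t => (hne t).1
  have hn2 := hn u₂ fun t => (hne t).2
  have hci : ∀ u : ℂ, (∀ t, unitPoint t - u ≠ 0) → IntervalIntegrable
      (fun t => 2 * Real.pi * I * (unitPoint t * (unitPoint t - u)⁻¹)) volume 0 1 := by
    intro u hu
    have hc := continuous_unitPoint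
    exact Continuous.intervalIntegrable
      (continuous_const.mul (hc.mul ((hc.sub continuous_const).inv₀ hu))) _ _
  have hW : windingNumber (ellipse a b) z =
      (if ‖u₁‖ < 1 then 1 else 0) + (if ‖u₂‖ < 1 then 1 else 0) - 1 := by
    have h1 : ∀ t, deriv (ellipse a b) t / (ellipse a b t - z) =
        2 * Real.pi * I * (unitPoint t * (unitPoint t - u₁)⁻¹) +
        2 * Real.pi * I * (unitPoint t * (unitPoint t - u₂)⁻¹) - 2 * Real.pi * I := by
      intro t
      have h0 := unitPoint_ne_zero t
      have h1 := (hne t).1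
      have h2 := (hne t).2
      rw [deriv_ellipse, ellipseDeriv_eq_joukowski, hfac, ← hA, ← hB, ← hprod]
      field_simp
      ring
    rw [windingNumber]
    simp_rw [h1]
    rw [intervalIntegral.integral_sub ((hci _ fun t => (hne t).1).add (hci _ fun t => (hne t).2))
      (by simp), intervalIntegral.integral_add (hci _ fun t => (hne t).1) (hci _ fun t => (hne t).2),
      integral_unitPoint_sub_inv hn1, integral_unitPoint_sub_inv hn2]
    have hpi : (Real.pi : ℂ) ≠ 0 := by simp [Real.pi_ne_zero]
    simp only [intervalIntegral.integral_const, sub_zero, one_smul]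
    split_ifs <;> field_simp <;> ring
  have hnp : ‖u₁‖ * ‖u₂‖ = (a - b) / (a + b) := by
    rw [← norm_mul, show u₁ * u₂ = (((a - b) / (a + b) : ℝ) : ℂ) by
      have : u₁ * u₂ = B / A := by rw [← hprod]; field_simp
      rw [this, hA, hB]; push_cast
      have : (a + b : ℂ) ≠ 0 := by
        intro h; rw [hA, h] at hA0; simp at hA0
      field_simp, Complex.norm_real, Real.norm_of_nonneg]
    exact div_nonneg (by linarith) (by linarith)
  constructor
  · intro hlt
    have h1 : ‖u₁‖ < 1 := by
      by_contra h
      exact absurd (one_le_ellipseForm_of_one_le hb hab (not_lt.1 h) hz1) (not_le.2 hlt)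
    have h2 : ‖u₂‖ < 1 := by
      by_contra h
      exact absurd (one_le_ellipseForm_of_one_le hb hab (not_lt.1 h) hz2) (not_le.2 hlt)
    rw [hW, if_pos h1, if_pos h2]; norm_num
  · intro hne0
    have hlt1 : (a - b) / (a + b) < 1 := by rw [div_lt_one (by linarith)]; linarith
    by_cases h1 : ‖u₁‖ < 1
    · by_cases h2 : ‖u₂‖ < 1
      · refine ellipseForm_le_one_of_le hb hab h1.le ?_ hz1
        rw [← hnp]
        exact mul_le_of_le_one_right (norm_nonneg _) h2.le
      · rw [hW, if_pos h1, if_neg h2] at hne0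
        norm_num at hne0
    · by_cases h2 : ‖u₂‖ < 1
      · rw [hW, if_neg h1, if_pos h2] at hne0
        norm_num at hne0
      · exfalso
        have := mul_le_mul (not_lt.1 h1) (not_lt.1 h2) zero_le_one (norm_nonneg _)
        rw [hnp] at this
        linarith

/-- On a set star-shaped about `0` the radial integral `P(w) = ∫₀¹ w g(sw) ds` is a primitive of `g`
away from `0`, and the ellipse avoids `0`. As `P` is already known to be holomorphic, its derivative
can be read off along a single ray. -/
theorem integral_ellipse_eq_zero {a b : ℝ} (ha : 0 < a) (hb : 0 < b) {V : Set ℂ} (hV : IsOpen V)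
    (hs : StarConvex ℝ 0 V) (hΓ : ∀ t, ellipse a b t ∈ V) {g : ℂ → ℂ}
    (hg : DifferentiableOn ℂ g V) :
    ∫ t in (0 : ℝ)..1, g (ellipse a b t) * ellipseDeriv a b t = 0 := by
  set P : ℂ → ℂ := fun w => ∫ s in (0 : ℝ)..1, 1 * (w * g (s * w)) with hP
  have hseg : ∀ w ∈ V, ∀ s ∈ Icc (0 : ℝ) 1, (s : ℂ) * w ∈ V := by
    intro w hw s hs'
    have := hs.smul_mem hw hs'.1 hs'.2
    simpa using this
  have hPd : ∀ w ∈ V, DifferentiableAt ℂ P w := by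
    intro w hw
    have hn : IsOpen {p : ℂ × ℂ | p.2 * p.1 ∈ V} := hV.preimage (by fun_prop)
    -- The segment from `0` to `w` is compact, so its product structure persists for nearby `w`;
    -- this provides the open product on which the integrand is holomorphic.
    obtain ⟨U, T, hU, hT, hwU, hIT, hUT⟩ := generalized_tube_lemma (isCompact_singleton (x := w))
      ((isCompact_Icc (a := (0 : ℝ)) (b := 1)).image continuous_ofReal) hn (by
        rintro ⟨x, y⟩ ⟨hx, s, hs', rfl⟩
        rw [mem_singleton_iff] at hx
        subst hx
        exact hseg _ hw s hs')
    have h1 : DifferentiableOn ℂ (fun p : ℂ × ℂ => p.1 * g (p.2 * p.1)) (U ×ˢ T) := by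
      refine DifferentiableOn.mul (by fun_prop) ?_
      exact hg.comp (f := fun p : ℂ × ℂ => p.2 * p.1) (by fun_prop) fun p hp => hUT hp
    have h2 := differentiableOn_pathIntegral hU (f := fun w s => w * g (s * w)) (γ := fun s => (s : ℂ))
      (κ := fun _ => 1) zero_le_one h1 (by fun_prop) (by fun_prop) fun s hs' => hIT ⟨s, hs', rfl⟩
    exact h2.differentiableAt (hU.mem_nhds (hwU rfl))
  have hPg : ∀ w ∈ V, w ≠ 0 → HasDerivAt P (g w) w := by
    intro w hw hw0
    have h1 : HasDerivAt P (deriv P w) ((1 : ℝ) * w) := by simpa using (hPd w hw).hasDerivAt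
    have h2 : HasDerivAt (fun τ : ℝ => P (τ * w)) (deriv P w * w) 1 := by
      have h3 : HasDerivAt (fun τ : ℝ => (τ : ℂ) * w) w 1 := by
        simpa using (hasDerivAt_id (1 : ℝ)).ofReal_comp.mul_const w
      exact h1.comp (1 : ℝ) h3
    have hc : ∀ s ∈ Icc (0 : ℝ) 1, ContinuousAt (fun s : ℝ => w * g (s * w)) s := by
      intro s hs'
      have hgc : ContinuousAt g (s * w) := (hg.differentiableAt
        (hV.mem_nhds (hseg w hw s hs'))).continuousAt
      exact continuousAt_const.mul (ContinuousAt.comp (f := fun s : ℝ => (s : ℂ) * w) hgc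
        (by fun_prop))
    have hO : IsOpen ((fun s : ℝ => (s : ℂ) * w) ⁻¹' V) := hV.preimage (by fun_prop)
    have h4 : HasDerivAt (fun τ : ℝ => ∫ s in (0 : ℝ)..τ, w * g (s * w)) (w * g ((1 : ℝ) * w)) 1 := by
      refine intervalIntegral.integral_hasDerivAt_right (f := fun s : ℝ => w * g (s * w)) ?_ ?_
        (hc 1 (by simp))
      · refine ContinuousOn.intervalIntegrable fun s hs' => (hc s ?_).continuousWithinAt
        rwa [uIcc_of_le zero_le_one] at hs'
      · refine ContinuousOn.stronglyMeasurableAtFilter hO ?_ 1 (by simpa using hw)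
        refine continuousOn_const.mul (hg.continuousOn.comp (by fun_prop) fun s hs' => hs')
    have h5 : (fun τ : ℝ => ∫ s in (0 : ℝ)..τ, w * g (s * w)) =ᶠ[𝓝 1] fun τ => P (τ * w) := by
      filter_upwards [lt_mem_nhds (zero_lt_one (α := ℝ))] with τ hτ
      have h6 := intervalIntegral.integral_comp_mul_left (a := 0) (b := 1)
        (fun s : ℝ => w * g (s * w)) hτ.ne'
      simp only [mul_zero, mul_one] at h6
      simp only [hP]
      rw [← smul_inv_smul₀ hτ.ne' (∫ s in (0 : ℝ)..τ, w * g (s * w)), ← h6,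
        ← intervalIntegral.integral_smul]
      refine intervalIntegral.integral_congr fun s _ => ?_
      simp only [real_smul, ofReal_mul]
      rw [show (τ : ℂ) * s * w = s * (τ * w) by ring]
      ring
    have h7 := (h4.congr_of_eventuallyEq h5.symm).unique h2
    simp only [ofReal_one, one_mul] at h7
    rw [mul_comm] at h7
    rw [mul_right_cancel₀ hw0 h7]
    exact (hPd w hw).hasDerivAt
  have hΓ0 : ∀ t, ellipse a b t ≠ 0 := by
    intro t h
    have := ellipseForm_ellipse ha hb t
    rw [h] at this
    simp [ellipseForm] at this
  have hd : ∀ t ∈ uIcc (0 : ℝ) 1, HasDerivAt (fun t => P (ellipse a b t))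
      (g (ellipse a b t) * ellipseDeriv a b t) t := fun t _ =>
    (hPg _ (hΓ t) (hΓ0 t)).comp t (hasDerivAt_ellipse a b t)
  rw [intervalIntegral.integral_eq_sub_of_hasDerivAt hd]
  · have := ellipse_periodic a b 0
    rw [zero_add] at this
    rw [this, sub_self]
  · exact Continuous.intervalIntegrable ((hg.continuousOn.comp_continuous (continuous_ellipse a b)
      hΓ).mul (continuous_ellipseDeriv a b)) _ _

theorem notMem_range_ellipse {a b : ℝ} (ha : 0 < a) (hb : 0 < b) {x : ℂ}
    (hx : ellipseForm a b x < 1) : x ∉ range (ellipse a b) := by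
  rintro ⟨t, rfl⟩
  rw [ellipseForm_ellipse ha hb] at hx
  exact lt_irrefl _ hx

/-- Cauchy's formula on an ellipse. -/
theorem cauchy_ellipse {a b : ℝ} (hb : 0 < b) (hab : b < a) {V : Set ℂ} (hV : IsOpen V)
    (hs : StarConvex ℝ 0 V) (hΓ : ∀ t, ellipse a b t ∈ V) {g : ℂ → ℂ}
    (hg : DifferentiableOn ℂ g V) {x : ℂ} (hxV : x ∈ V) (hx : ellipseForm a b x < 1) :
    ∫ t in (0 : ℝ)..1, g (ellipse a b t) * (ellipse a b t - x)⁻¹ * ellipseDeriv a b t =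
      2 * Real.pi * I * g x := by
  have ha : 0 < a := hb.trans hab
  have hnr := notMem_range_ellipse ha hb hx
  have hne : ∀ t, ellipse a b t - x ≠ 0 := fun t h => hnr ⟨t, sub_eq_zero.1 h⟩
  -- The difference quotient has a removable singularity at `x`, so its integral vanishes; what is
  -- left is `g x` times the winding number.
  have h1 := integral_ellipse_eq_zero ha hb hV hs hΓ
    ((Complex.differentiableOn_dslope (hV.mem_nhds hxV)).2 hg)
  have hw := (windingNumber_ellipse hb hab hnr).1 hx
  rw [windingNumber, deriv_ellipse] at hw
  have hw' : ∫ t in (0 : ℝ)..1, ellipseDeriv a b t / (ellipse a b t - x) = 2 * Real.pi * I := by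
    have h2 : (2 * I * Real.pi : ℂ) ≠ 0 := by simp [Real.pi_ne_zero]
    rw [inv_mul_eq_iff_eq_mul₀ h2] at hw
    rw [hw]; ring
  have hgc : Continuous fun t => g (ellipse a b t) :=
    hg.continuousOn.comp_continuous (continuous_ellipse a b) hΓ
  have hic : Continuous fun t => (ellipse a b t - x)⁻¹ :=
    ((continuous_ellipse a b).sub continuous_const).inv₀ hne
  have hdc := continuous_ellipseDeriv a b
  have h3 : ∀ t, g (ellipse a b t) * (ellipse a b t - x)⁻¹ * ellipseDeriv a b t =
      dslope g x (ellipse a b t) * ellipseDeriv a b t +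
        g x * (ellipseDeriv a b t / (ellipse a b t - x)) := by
    intro t
    rw [dslope_of_ne _ (sub_ne_zero.1 (hne t)), slope_def_field]
    have := hne t
    field_simp
    ring
  simp_rw [h3]
  rw [intervalIntegral.integral_add, h1, intervalIntegral.integral_const_mul, hw', zero_add]
  · ring
  · refine Continuous.intervalIntegrable (Continuous.mul ?_ hdc) _ _
    have : (fun t => dslope g x (ellipse a b t)) =
        fun t => (g (ellipse a b t) - g x) * (ellipse a b t - x)⁻¹ := by
      funext t
      rw [dslope_of_ne _ (sub_ne_zero.1 (hne t)), slope_def_field, div_eq_mul_inv]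
    rw [this]
    exact (hgc.sub continuous_const).mul hic
  · exact Continuous.intervalIntegrable (by simp_rw [div_eq_mul_inv]; fun_prop) _ _

/-- Partial fractions for simple poles. -/
theorem inv_prod_sub_eq_sum {ι : Type*} [Fintype ι] [DecidableEq ι] [Nonempty ι] {x : ι → ℂ}
    (hinj : Function.Injective x) {w : ℂ} (hw : ∀ i, w - x i ≠ 0) :
    (∏ i, (w - x i))⁻¹ = ∑ i, (∏ j ∈ Finset.univ.erase i, (x i - x j))⁻¹ * (w - x i)⁻¹ := by
  have h2 := Lagrange.eval_interpolate_not_at_node (s := Finset.univ) (v := x) (r := fun _ => (1:ℂ))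
    (x := w) (fun i _ => sub_ne_zero.1 (hw i))
  have h3 : Lagrange.interpolate Finset.univ x (fun _ => (1 : ℂ)) = 1 :=
    Lagrange.interpolate_one hinj.injOn Finset.univ_nonempty
  rw [h3, Polynomial.eval_one, Lagrange.eval_nodal] at h2
  rw [inv_eq_iff_eq_inv, eq_comm, inv_eq_of_mul_eq_one_left]
  simpa [Lagrange.nodalWeight, Finset.prod_inv_distrib] using h2.symm

/-- The residue formula on an ellipse, for finitely many simple poles. -/
theorem residue_ellipse {a b : ℝ} (hb : 0 < b) (hab : b < a) {V : Set ℂ} (hV : IsOpen V)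
    (hs : StarConvex ℝ 0 V) (hΓ : ∀ t, ellipse a b t ∈ V) {g : ℂ → ℂ}
    (hg : DifferentiableOn ℂ g V) {ι : Type*} [Fintype ι] [DecidableEq ι] {x : ι → ℂ}
    (hinj : Function.Injective x) (hxV : ∀ i, x i ∈ V) (hx : ∀ i, ellipseForm a b (x i) < 1) :
    ∫ t in (0 : ℝ)..1, g (ellipse a b t) / (∏ i, (ellipse a b t - x i)) * ellipseDeriv a b t =
      2 * Real.pi * I * ∑ i, g (x i) / ∏ j ∈ Finset.univ.erase i, (x i - x j) := by
  have ha : 0 < a := hb.trans hab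
  rcases isEmpty_or_nonempty ι with he | hne
  · simpa using integral_ellipse_eq_zero ha hb hV hs hΓ hg
  have hnt : ∀ i t, ellipse a b t - x i ≠ 0 := fun i t h =>
    notMem_range_ellipse ha hb (hx i) ⟨t, sub_eq_zero.1 h⟩
  have h1 : ∀ t, g (ellipse a b t) / (∏ i, (ellipse a b t - x i)) * ellipseDeriv a b t =
      ∑ i, (∏ j ∈ Finset.univ.erase i, (x i - x j))⁻¹ *
        (g (ellipse a b t) * (ellipse a b t - x i)⁻¹ * ellipseDeriv a b t) := by
    intro t
    rw [div_eq_mul_inv, inv_prod_sub_eq_sum hinj fun i => hnt i t, Finset.mul_sum, Finset.sum_mul]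
    exact Finset.sum_congr rfl fun i _ => by ring
  simp_rw [h1]
  have hgc : Continuous fun t => g (ellipse a b t) :=
    hg.continuousOn.comp_continuous (continuous_ellipse a b) hΓ
  have hdc := continuous_ellipseDeriv a b
  rw [intervalIntegral.integral_finsetSum]
  · rw [Finset.mul_sum]
    refine Finset.sum_congr rfl fun i _ => ?_
    rw [intervalIntegral.integral_const_mul, cauchy_ellipse hb hab hV hs hΓ hg (hxV i) (hx i)]
    ring
  · intro i _
    have hic : Continuous fun t => (ellipse a b t - x i)⁻¹ :=
      ((continuous_ellipse a b).sub continuous_const).inv₀ (hnt i)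
    exact Continuous.intervalIntegrable (continuous_const.mul ((hgc.mul hic).mul hdc)) _ _

/-- The residue formula on a circle, for finitely many simple poles. -/
theorem residue_circle {c : ℂ} {R : ℝ} {g : ℂ → ℂ}
    (hg : DifferentiableOn ℂ g (Metric.closedBall c R)) {ι : Type*} [Fintype ι] [DecidableEq ι]
    [Nonempty ι] {x : ι → ℂ} (hinj : Function.Injective x) (hx : ∀ i, x i ∈ Metric.ball c R) :
    ∮ w in C(c, R), g w / (∏ i, (w - x i)) =
      2 * Real.pi * I * ∑ i, g (x i) / ∏ j ∈ Finset.univ.erase i, (x i - x j) := by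
  have hR : 0 < R := Metric.pos_of_mem_ball (hx (Classical.arbitrary ι))
  have hnt : ∀ i, ∀ w ∈ Metric.sphere c R, w - x i ≠ 0 := by
    intro i w hw h
    have := hx i
    rw [← sub_eq_zero.1 h, Metric.mem_ball, Metric.mem_sphere.1 hw] at this
    exact lt_irrefl _ this
  have h1 : EqOn (fun w => g w / (∏ i, (w - x i)))
      (fun w => ∑ i, (∏ j ∈ Finset.univ.erase i, (x i - x j))⁻¹ * ((w - x i)⁻¹ * g w))
      (Metric.sphere c R) := by
    intro w hw
    simp only
    rw [div_eq_mul_inv, inv_prod_sub_eq_sum hinj fun i => hnt i w hw, Finset.mul_sum]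
    exact Finset.sum_congr rfl fun i _ => by ring
  rw [circleIntegral.integral_congr hR.le h1, circleIntegral.integral_fun_sum, Finset.mul_sum]
  · refine Finset.sum_congr rfl fun i _ => ?_
    have h2 := hg.circleIntegral_sub_inv_smul (hx i)
    simp only [smul_eq_mul] at h2
    rw [circleIntegral.integral_const_mul, h2]
    ring
  · intro i _
    refine ContinuousOn.circleIntegrable hR.le (continuousOn_const.mul (ContinuousOn.mul ?_ ?_))
    · exact ContinuousOn.inv₀ (by fun_prop) (hnt i)
    · exact hg.continuousOn.mono Metric.sphere_subset_closedBall

end Ellipse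

/-! ### Hadamard's inequality -/

section Hadamard

/-- Gram–Schmidt on the rows gives an orthonormal basis in which the family is triangular. The
change of basis has determinant of modulus `1`, and each diagonal entry is an inner product of a row
with a unit vector. -/
theorem norm_det_le_prod_norm {n : ℕ} (M : Matrix (Fin n) (Fin n) ℂ) :
    ‖M.det‖ ≤ ∏ i, ‖WithLp.toLp 2 (M i)‖ := by
  classical
  let f : Fin n → EuclideanSpace ℂ (Fin n) := fun i => WithLp.toLp 2 (M i)
  have hf : Module.finrank ℂ (EuclideanSpace ℂ (Fin n)) = Fintype.card (Fin n) := by simp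
  let b := InnerProductSpace.gramSchmidtOrthonormalBasis hf f
  let e := EuclideanSpace.basisFun (Fin n) ℂ
  have h1 : e.toBasis.toMatrix f = M.transpose := by
    ext i j
    simp [Module.Basis.toMatrix_apply, e, f]
  have h2 : M.det = e.toBasis.det b * b.toBasis.det f := by
    rw [Module.Basis.det_apply, Module.Basis.det_apply, ← Matrix.det_mul, ← Matrix.det_transpose M,
      ← h1]
    congr 1
    have := Module.Basis.toMatrix_mul_toMatrix (b := e.toBasis) (b' := b.toBasis) (b'' := f)
    rw [← this]
    simp
  rw [h2, norm_mul, e.det_to_matrix_orthonormalBasis b, one_mul,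
    InnerProductSpace.gramSchmidtOrthonormalBasis_det, norm_prod]
  refine Finset.prod_le_prod (fun _ _ => norm_nonneg _) fun i _ => ?_
  refine (norm_inner_le_norm _ _).trans ?_
  rw [show ‖InnerProductSpace.gramSchmidtOrthonormalBasis hf f i‖ = 1 from b.orthonormal.1 i,
    one_mul]

theorem norm_det_le_of_norm_le {n : ℕ} {M : Matrix (Fin n) (Fin n) ℂ} {C : ℝ}
    (hM : ∀ i j, ‖M i j‖ ≤ C) : ‖M.det‖ ≤ (C * √n) ^ n := by
  refine (norm_det_le_prod_norm M).trans ?_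
  refine (Finset.prod_le_prod (g := fun _ => C * √n) (fun _ _ => norm_nonneg _) fun i _ => ?_).trans
    (by simp)
  have hC : 0 ≤ C := (norm_nonneg _).trans (hM i i)
  rw [EuclideanSpace.norm_eq]
  refine Real.sqrt_le_iff.2 ⟨by positivity, ?_⟩
  rw [mul_pow, Real.sq_sqrt (Nat.cast_nonneg _)]
  refine (Finset.sum_le_card_nsmul _ _ (C ^ 2) fun j _ => ?_).trans (by simp [mul_comm])
  exact pow_le_pow_left₀ (norm_nonneg _) (hM i j) 2

/-- From `n^n / n! ≤ e^n`, the `n`-th term is at most `(|X| e / √n)^n` in modulus, which is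
eventually below `2^{-n}`. -/
theorem summable_pow_mul_sqrt_div_factorial (X : ℝ) :
    Summable fun n : ℕ => (X * √n) ^ n / n.factorial := by
  refine Summable.of_norm_bounded_eventually_nat (g := fun n : ℕ => (1 / 2 : ℝ) ^ n)
    (summable_geometric_of_lt_one (by norm_num) (by norm_num)) ?_
  filter_upwards [Filter.eventually_ge_atTop (max 1 ⌈(2 * |X| * Real.exp 1) ^ 2⌉₊)] with n hn
  have hn1 : 1 ≤ n := (le_max_left _ _).trans hn
  have hn2 : (2 * |X| * Real.exp 1) ^ 2 ≤ n :=
    (Nat.le_ceil _).trans (by exact_mod_cast (le_max_right _ _).trans hn)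
  have hn0 : (0 : ℝ) < n := by exact_mod_cast hn1
  have hs : 2 * |X| * Real.exp 1 ≤ √n := Real.le_sqrt_of_sq_le hn2
  have hs0 : 0 < √(n : ℝ) := Real.sqrt_pos.2 hn0
  have hfac : (0 : ℝ) < n.factorial := by exact_mod_cast n.factorial_pos
  have h1 : (n : ℝ) ^ n / n.factorial ≤ Real.exp 1 ^ n := by
    rw [← Real.exp_nat_mul, mul_one]
    exact Real.pow_div_factorial_le_exp _ hn0.le n
  rw [norm_div, norm_pow, norm_mul, Real.norm_eq_abs, Real.norm_of_nonneg hs0.le,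
    Real.norm_of_nonneg hfac.le]
  have h2 : (|X| * √n) ^ n / n.factorial = (|X| / √n) ^ n * ((n : ℝ) ^ n / n.factorial) := by
    rw [← mul_div_assoc, ← mul_pow]
    congr 2
    rw [div_mul_eq_mul_div, eq_div_iff hs0.ne', mul_assoc, Real.mul_self_sqrt hn0.le]
  rw [h2]
  refine (mul_le_mul_of_nonneg_left h1 (by positivity)).trans ?_
  rw [← mul_pow]
  refine pow_le_pow_left₀ (by positivity) ?_ n
  rw [div_mul_eq_mul_div, div_le_iff₀ hs0]
  linarith

end Hadamard

/-! ### Fredholm series with discrete and continuous parts -/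

section Fredholm

open Topology

/-- The determinant of the kernel `K` at the points `p`. -/
def kernelDet (K : ℂ → ℂ → ℂ) {ι : Type} [Fintype ι] [DecidableEq ι] (p : ι → ℂ) : ℂ :=
  (Matrix.of fun i j => K (p i) (p j)).det

theorem kernelDet_comp_equiv (K : ℂ → ℂ → ℂ) {ι ι' : Type} [Fintype ι] [DecidableEq ι]
    [Fintype ι'] [DecidableEq ι'] (e : ι ≃ ι') (p : ι' → ℂ) :
    kernelDet K (p ∘ e) = kernelDet K p :=
  Matrix.det_submatrix_equiv_self e (Matrix.of fun i j => K (p i) (p j))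

/-- The unnormalized `a`-th term of the Fredholm series of the kernel `K` with respect to the
measure with density `w` on the path `Γ` and with atoms `L` (pairs of a mass and a point), bordered
by the points `p`. -/
def fredIter (K : ℂ → ℂ → ℂ) (Γ w : ℝ → ℂ) (L : List (ℂ × ℂ)) : ℕ → ∀ {b : ℕ}, (Fin b → ℂ) → ℂ
  | 0, _, p => kernelDet K p
  | a + 1, _, p => (∫ t in (0 : ℝ)..1, w t * fredIter K Γ w L a (Fin.cons (Γ t) p : Fin _ → ℂ)) +
      (L.map fun cx => cx.1 * fredIter K Γ w L a (Fin.cons cx.2 p : Fin _ → ℂ)).sum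

/-- The bordered Fredholm determinant. -/
def fredDet (K : ℂ → ℂ → ℂ) (Γ w : ℝ → ℂ) (L : List (ℂ × ℂ)) {b : ℕ} (p : Fin b → ℂ) : ℂ :=
  ∑' a : ℕ, fredIter K Γ w L a p / a.factorial

variable {K : ℂ → ℂ → ℂ} {Γ w : ℝ → ℂ} {L : List (ℂ × ℂ)}

/-- Integration points are put in front of `p`, so a permutation of `p` extends by fixing the index
`0`; for the determinant itself, rows and columns are permuted together. -/
theorem fredIter_comp_perm (a : ℕ) : ∀ {b : ℕ} (p : Fin b → ℂ) (σ : Equiv.Perm (Fin b)),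
    fredIter K Γ w L a (p ∘ σ) = fredIter K Γ w L a p := by
  induction a with
  | zero => exact fun p σ => kernelDet_comp_equiv K σ p
  | succ a ih =>
    intro b p σ
    have h : ∀ x : ℂ, fredIter K Γ w L a (Fin.cons x (p ∘ σ) : Fin _ → ℂ) =
        fredIter K Γ w L a (Fin.cons x p : Fin _ → ℂ) := by
      intro x
      rw [← ih (Fin.cons x p : Fin _ → ℂ) (Equiv.Perm.decomposeFin.symm (0, σ))]
      congr 1
      funext i
      refine Fin.cases ?_ (fun i => ?_) i <;> simp
    simp only [fredIter, h]

theorem fredIter_swap (a : ℕ) {b : ℕ} (p : Fin b → ℂ) (x y : ℂ) :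
    fredIter K Γ w L a (Fin.cons x (Fin.cons y p : Fin _ → ℂ) : Fin _ → ℂ) =
      fredIter K Γ w L a (Fin.cons y (Fin.cons x p : Fin _ → ℂ) : Fin _ → ℂ) := by
  rw [← fredIter_comp_perm a (Fin.cons x (Fin.cons y p : Fin _ → ℂ) : Fin _ → ℂ)
    (Equiv.swap 0 1)]
  congr 1
  funext i
  refine Fin.cases ?_ (fun i => ?_) i
  · simp only [Function.comp, Equiv.swap_apply_left, Fin.cons_zero]
    rfl
  · refine Fin.cases ?_ (fun i => ?_) i
    · simp only [Function.comp, Fin.succ_zero_eq_one, Equiv.swap_apply_right, Fin.cons_zero]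
      rfl
    · rw [Function.comp, Equiv.swap_apply_of_ne_of_ne (Fin.succ_ne_zero _) (by
        rw [← Fin.succ_zero_eq_one]
        exact fun h => Fin.succ_ne_zero _ (Fin.succ_injective _ h))]
      simp

theorem fredIter_eq_zero (a : ℕ) : ∀ {b : ℕ} (p : Fin b → ℂ) {i j : Fin b}, i ≠ j → p i = p j →
    fredIter K Γ w L a p = 0 := by
  induction a with
  | zero =>
    intro b p i j hij h
    exact Matrix.det_zero_of_row_eq hij (by funext k; simp [h])
  | succ a ih =>
    intro b p i j hij h
    have h0 : ∀ x : ℂ, fredIter K Γ w L a (Fin.cons x p : Fin _ → ℂ) = 0 := fun x =>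
      ih _ (i := i.succ) (j := j.succ) (by simpa using hij) (by simpa using h)
    simp [fredIter, h0]

/-- This is what makes the determinant affine in the mass of each atom: no point can be used twice.
-/
theorem fredIter_cons_cons_self (a : ℕ) {b : ℕ} (p : Fin b → ℂ) (x : ℂ) :
    fredIter K Γ w L a (Fin.cons x (Fin.cons x p : Fin _ → ℂ) : Fin _ → ℂ) = 0 :=
  fredIter_eq_zero a _ (i := 0) (j := (0 : Fin (b + 1)).succ) (Fin.succ_ne_zero _).symm (by simp)

theorem mem_pi_cons {V : Set ℂ} {b : ℕ} {p : Fin b → ℂ} {x : ℂ} (hx : x ∈ V)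
    (hp : p ∈ univ.pi fun _ => V) : (Fin.cons x p : Fin (b + 1) → ℂ) ∈ univ.pi fun _ => V := by
  intro i _
  refine Fin.cases ?_ (fun i => ?_) i
  · simpa using hx
  · simpa using hp i trivial

variable {V Ω : Set ℂ}

theorem differentiableOn_finsetProd {E ι : Type*} [NormedAddCommGroup E] [NormedSpace ℂ E]
    {f : ι → E → ℂ} {s : Finset ι} {U : Set E} (h : ∀ i ∈ s, DifferentiableOn ℂ (f i) U) :
    DifferentiableOn ℂ (fun z => ∏ i ∈ s, f i z) U := by
  classical
  induction s using Finset.induction_on with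
  | empty => simp
  | insert i s hi ih =>
    simp only [Finset.prod_insert hi]
    exact (h i (Finset.mem_insert_self ..)).mul
      (ih fun j hj => h j (Finset.mem_insert_of_mem hj))

theorem differentiableOn_kernelDet {b : ℕ}
    (hK : DifferentiableOn ℂ (fun p : ℂ × ℂ => K p.1 p.2) (V ×ˢ V)) :
    DifferentiableOn ℂ (fun p : Fin b → ℂ => kernelDet K p) (univ.pi fun _ => V) := by
  unfold kernelDet
  simp only [Matrix.det_apply, Matrix.of_apply]
  refine DifferentiableOn.fun_sum fun σ _ => DifferentiableOn.const_smul ?_ _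
  refine differentiableOn_finsetProd fun i _ => ?_
  exact hK.comp (f := fun p : Fin b → ℂ => (p (σ i), p i)) (by fun_prop)
    fun p hp => ⟨hp _ trivial, hp _ trivial⟩

theorem differentiable_cons {E : Type} [NormedAddCommGroup E] [NormedSpace ℂ E] {b : ℕ}
    {x : E → ℂ} {p : E → Fin b → ℂ} {s : Set E} (hx : DifferentiableOn ℂ x s)
    (hp : DifferentiableOn ℂ p s) :
    DifferentiableOn ℂ (fun z => (Fin.cons (x z) (p z) : Fin (b + 1) → ℂ)) s := by
  rw [differentiableOn_pi]
  intro i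
  refine Fin.cases ?_ (fun i => ?_) i
  · simpa using hx
  · simpa using differentiableOn_pi.1 hp i

/-! ### Holomorphic dependence of the terms on parameters -/

section Holomorphy

variable {E : Type} [NormedAddCommGroup E] [NormedSpace ℂ E] [FiniteDimensional ℂ E] {U : Set E}
  {ρ : E → ℂ → ℂ} {κ : ℝ → ℂ}

/-- The border points are kept as variables, for every `b` at once, because the term `a + 1`
integrates the term `a` over one of its border points. -/
theorem differentiableOn_fredIter (hU : IsOpen U) (hV : IsOpen V) (hΩ : Ω ⊆ V)
    (hK : DifferentiableOn ℂ (fun p : ℂ × ℂ => K p.1 p.2) (V ×ˢ V))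
    (hΓ : Continuous Γ) (hΓΩ : ∀ t, Γ t ∈ Ω) (hκ : Continuous κ)
    (hρ : DifferentiableOn ℂ (fun p : E × ℂ => ρ p.1 p.2) (U ×ˢ Ω))
    (hL : ∀ cx ∈ L, cx.2 ∈ V) (a : ℕ) : ∀ b : ℕ,
    DifferentiableOn ℂ (fun p : E × (Fin b → ℂ) =>
      fredIter K Γ (fun t => κ t * ρ p.1 (Γ t)) L a p.2) (U ×ˢ univ.pi fun _ => V) := by
  induction a with
  | zero =>
    intro b
    exact (differentiableOn_kernelDet hK).comp differentiableOn_snd fun p hp => hp.2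
  | succ a ih =>
    intro b
    have hO : IsOpen (U ×ˢ (univ : Set (Fin b)).pi fun _ => V) :=
      hU.prod (isOpen_set_pi finite_univ fun _ _ => hV)
    simp only [fredIter]
    refine DifferentiableOn.add ?_ ?_
    · have h1 := differentiableOn_pathIntegral (a := 0) (b := 1) hO (V := Ω) (γ := Γ) (κ := κ)
        (f := fun (p : E × (Fin b → ℂ)) ω => ρ p.1 ω *
          fredIter K Γ (fun t => κ t * ρ p.1 (Γ t)) L a (Fin.cons ω p.2 : Fin _ → ℂ))
        zero_le_one ?_ hΓ.continuousOn hκ.continuousOn fun t _ => hΓΩ t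
      · simpa only [mul_assoc] using h1
      · refine DifferentiableOn.mul ?_ ?_
        · exact hρ.comp (f := fun p : (E × (Fin b → ℂ)) × ℂ => (p.1.1, p.2)) (by fun_prop)
            fun p hp => ⟨hp.1.1, hp.2⟩
        · refine (ih (b + 1)).comp (f := fun p : (E × (Fin b → ℂ)) × ℂ =>
            (p.1.1, (Fin.cons p.2 p.1.2 : Fin _ → ℂ))) ?_ ?_
          · exact DifferentiableOn.prodMk (by fun_prop)
              (differentiable_cons (by fun_prop) (by fun_prop))
          · exact fun p hp => ⟨hp.1.1, mem_pi_cons (hΩ hp.2) hp.1.2⟩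
    · clear hρ
      have key : ∀ L' : List (ℂ × ℂ), (∀ cx ∈ L', cx.2 ∈ V) →
          DifferentiableOn ℂ (fun p : E × (Fin b → ℂ) => (L'.map fun cx => cx.1 *
            fredIter K Γ (fun t => κ t * ρ p.1 (Γ t)) L a (Fin.cons cx.2 p.2 : Fin _ → ℂ)).sum)
            (U ×ˢ univ.pi fun _ => V) := by
        intro L' hL'
        induction L' with
        | nil => simp
        | cons cx L' ih' =>
          simp only [List.map_cons, List.sum_cons]
          refine DifferentiableOn.add (DifferentiableOn.const_mul ?_ _)
            (ih' fun y hy => hL' y (List.mem_cons_of_mem _ hy))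
          refine (ih (b + 1)).comp (f := fun p : E × (Fin b → ℂ) =>
            (p.1, (Fin.cons cx.2 p.2 : Fin _ → ℂ))) ?_ ?_
          · exact DifferentiableOn.prodMk (by fun_prop)
              (differentiable_cons (by fun_prop) (by fun_prop))
          · exact fun p hp => ⟨hp.1, mem_pi_cons (hL' cx (List.mem_cons_self ..)) hp.2⟩
      exact key L hL

end Holomorphy

/-! ### Convergence of the series and expansion in atoms -/

variable {M m : ℝ}

theorem sum_map_norm_nonneg (L : List (ℂ × ℂ)) : 0 ≤ (L.map fun cx => ‖cx.1‖).sum := by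
  refine List.sum_nonneg fun x hx => ?_
  obtain ⟨y, -, rfl⟩ := List.mem_map.1 hx
  exact norm_nonneg _

/-- After `a` integrations the determinant has size `a + b` and Hadamard's bound applies; each
integration contributes a factor bounded by the total mass of the density and the atoms. -/
theorem norm_fredIter_le (hK : ∀ x ∈ V, ∀ y ∈ V, ‖K x y‖ ≤ M) (hM : 0 ≤ M)
    (hΓ : ∀ t ∈ Icc (0 : ℝ) 1, Γ t ∈ V)
    (hw : ∀ t ∈ Icc (0 : ℝ) 1, ‖w t‖ ≤ m) (hL : ∀ cx ∈ L, cx.2 ∈ V) (a : ℕ) :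
    ∀ {b : ℕ} (p : Fin b → ℂ), p ∈ univ.pi (fun _ => V) →
    ‖fredIter K Γ w L a p‖ ≤
      (m + (L.map fun cx => ‖cx.1‖).sum) ^ a * (M * √(a + b : ℕ)) ^ (a + b) := by
  have hm : 0 ≤ m := (norm_nonneg _).trans (hw 0 (by simp))
  have hS : 0 ≤ (L.map fun cx => ‖cx.1‖).sum := sum_map_norm_nonneg L
  induction a with
  | zero =>
    intro b p hp
    simp only [fredIter, pow_zero, one_mul, zero_add]
    exact norm_det_le_of_norm_le fun i j => hK _ (hp i trivial) _ (hp j trivial)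
  | succ a ih =>
    intro b p hp
    set B := (m + (L.map fun cx => ‖cx.1‖).sum) ^ a * (M * √(a + (b + 1) : ℕ)) ^ (a + (b + 1)) with hB
    have hB0 : 0 ≤ B := by positivity
    have h1 : ∀ x ∈ V, ‖fredIter K Γ w L a (Fin.cons x p : Fin _ → ℂ)‖ ≤ B := fun x hx =>
      ih _ (mem_pi_cons hx hp)
    have h2 : ‖∫ t in (0 : ℝ)..1, w t * fredIter K Γ w L a (Fin.cons (Γ t) p : Fin _ → ℂ)‖ ≤
        m * B := by
      refine (intervalIntegral.norm_integral_le_of_norm_le_const (C := m * B) fun t ht => ?_).trans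
        (by simp)
      rw [uIoc_of_le zero_le_one] at ht
      have ht' := Ioc_subset_Icc_self ht
      rw [norm_mul]
      exact mul_le_mul (hw t ht') (h1 _ (hΓ t ht')) (norm_nonneg _) hm
    have h3 : ∀ L' : List (ℂ × ℂ), (∀ cx ∈ L', cx.2 ∈ V) →
        ‖(L'.map fun cx => cx.1 * fredIter K Γ w L a (Fin.cons cx.2 p : Fin _ → ℂ)).sum‖ ≤
          (L'.map fun cx => ‖cx.1‖).sum * B := by
      intro L' hL'
      induction L' with
      | nil => simp
      | cons cx L' ih' =>
        simp only [List.map_cons, List.sum_cons, add_mul]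
        refine (norm_add_le _ _).trans (add_le_add ?_
          (ih' fun y hy => hL' y (List.mem_cons_of_mem _ hy)))
        rw [norm_mul]
        exact mul_le_mul_of_nonneg_left (h1 _ (hL' cx (List.mem_cons_self ..))) (norm_nonneg _)
    simp only [fredIter]
    refine (norm_add_le _ _).trans ((add_le_add h2 (h3 L hL)).trans (le_of_eq ?_))
    rw [hB, show a + 1 + b = a + (b + 1) by ring]
    ring

/-- As `(a + b)! ≤ 2^{a + b} a! b!`, replacing `a!` by `(a + b)!` costs only a geometric factor,
which is absorbed in `X`. A tail of the unbordered series remains. -/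
theorem summable_fredIter_bound (hM : 0 ≤ M) (hm : 0 ≤ m) (b : ℕ) :
    Summable fun a : ℕ => m ^ a * (M * √(a + b : ℕ)) ^ (a + b) / a.factorial := by
  set X := 2 * M * max m 1 with hX
  have h1 : Summable fun a : ℕ => (b.factorial : ℝ) *
      ((X * √(a + b : ℕ)) ^ (a + b) / (a + b).factorial) :=
    ((summable_nat_add_iff b).2 (summable_pow_mul_sqrt_div_factorial X)).mul_left _
  refine Summable.of_nonneg_of_le (fun a => by positivity) (fun a => ?_) h1
  have hc : ((a + b).factorial : ℝ) ≤ 2 ^ (a + b) * a.factorial * b.factorial := by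
    have h2 := Nat.add_choose_mul_factorial_mul_factorial a b
    have h3 := Nat.choose_le_two_pow (a + b) b
    have h4 : (a + b).factorial ≤ 2 ^ (a + b) * a.factorial * b.factorial := by
      rw [← h2]
      gcongr
    exact_mod_cast h4
  have hmm : m ^ a ≤ (max m 1) ^ (a + b) :=
    (pow_le_pow_left₀ hm (le_max_left _ _) a).trans
      (pow_le_pow_right₀ (le_max_right _ _) (Nat.le_add_right _ _))
  have hfa : (0 : ℝ) < a.factorial := by exact_mod_cast a.factorial_pos
  have hfab : (0 : ℝ) < (a + b).factorial := by exact_mod_cast (a + b).factorial_pos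
  rw [← mul_div_assoc, div_le_div_iff₀ hfa hfab]
  calc m ^ a * (M * √(a + b : ℕ)) ^ (a + b) * (a + b).factorial
      ≤ (max m 1) ^ (a + b) * (M * √(a + b : ℕ)) ^ (a + b) *
        (2 ^ (a + b) * a.factorial * b.factorial) := by gcongr
    _ = b.factorial * (X * √(a + b : ℕ)) ^ (a + b) * a.factorial := by
        rw [hX]; ring

theorem summable_norm_fredIter (hK : ∀ x ∈ V, ∀ y ∈ V, ‖K x y‖ ≤ M)
    (hΓ : ∀ t ∈ Icc (0 : ℝ) 1, Γ t ∈ V) (hw : ContinuousOn w (Icc 0 1)) (hL : ∀ cx ∈ L, cx.2 ∈ V)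
    {b : ℕ} {p : Fin b → ℂ} (hp : p ∈ univ.pi fun _ => V) :
    Summable fun a : ℕ => ‖fredIter K Γ w L a p / a.factorial‖ := by
  obtain ⟨m, hm⟩ := isCompact_Icc.exists_bound_of_continuousOn hw
  have h0 := hΓ 0 (by simp)
  have hM : 0 ≤ M := (norm_nonneg _).trans (hK _ h0 _ h0)
  have hm0 : 0 ≤ m := (norm_nonneg _).trans (hm 0 (by simp))
  have hS : 0 ≤ (L.map fun cx => ‖cx.1‖).sum := sum_map_norm_nonneg L
  refine Summable.of_nonneg_of_le (fun _ => norm_nonneg _) (fun a => ?_)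
    (summable_fredIter_bound hM (add_nonneg hm0 hS) b)
  rw [norm_div, Complex.norm_natCast]
  gcongr
  exact norm_fredIter_le hK hM hΓ hm hL a p hp

/-- Holomorphic dependence of the bordered Fredholm determinant on parameters. -/
theorem differentiableOn_fredDet {E : Type} [NormedAddCommGroup E] [NormedSpace ℂ E]
    [FiniteDimensional ℂ E] {U : Set E} {ρ : E → ℂ → ℂ} {κ : ℝ → ℂ}
    (hU : IsOpen U) (hV : IsOpen V) (hΩ : Ω ⊆ V)
    (hK : DifferentiableOn ℂ (fun p : ℂ × ℂ => K p.1 p.2) (V ×ˢ V))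
    (hKM : ∀ x ∈ V, ∀ y ∈ V, ‖K x y‖ ≤ M)
    (hΓ : Continuous Γ) (hΓΩ : ∀ t, Γ t ∈ Ω) (hκ : Continuous κ)
    (hρ : DifferentiableOn ℂ (fun p : E × ℂ => ρ p.1 p.2) (U ×ˢ Ω))
    (hL : ∀ cx ∈ L, cx.2 ∈ V) (b : ℕ) :
    DifferentiableOn ℂ (fun p : E × (Fin b → ℂ) =>
      fredDet K Γ (fun t => κ t * ρ p.1 (Γ t)) L p.2) (U ×ˢ univ.pi fun _ => V) := by
  have hO : IsOpen (U ×ˢ (univ : Set (Fin b)).pi fun _ => V) :=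
    hU.prod (isOpen_set_pi finite_univ fun _ _ => hV)
  unfold fredDet
  refine differentiableOn_tsum_of_locally_bounded hO (fun a => ?_) ?_
  · simp_rw [div_eq_mul_inv]
    exact (differentiableOn_fredIter hU hV hΩ hK hΓ hΓΩ hκ hρ hL a b).mul_const _
  · rintro ⟨z₀, p₀⟩ ⟨hz₀, hp₀⟩
    obtain ⟨r, hr, hsub⟩ := Metric.nhds_basis_closedBall.mem_iff.1 (hU.mem_nhds hz₀)
    have : ProperSpace E := FiniteDimensional.proper ℂ E
    have hcomp : IsCompact (Metric.closedBall z₀ r ×ˢ Icc (0 : ℝ) 1) :=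
      (isCompact_closedBall _ _).prod isCompact_Icc
    obtain ⟨m, hm⟩ := hcomp.exists_bound_of_continuousOn
      (f := fun p : E × ℝ => κ p.2 * ρ p.1 (Γ p.2)) (by
        refine ContinuousOn.mul (by fun_prop) ?_
        exact hρ.continuousOn.comp (f := fun p : E × ℝ => (p.1, Γ p.2)) (by fun_prop)
          fun p hp => ⟨hsub hp.1, hΓΩ _⟩)
    have h0 := hΩ (hΓΩ 0)
    have hM : 0 ≤ M := (norm_nonneg _).trans (hKM _ h0 _ h0)
    have hm0 : 0 ≤ m := (norm_nonneg _).trans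
      (hm (z₀, 0) ⟨Metric.mem_closedBall_self hr.le, by simp⟩)
    have hS : 0 ≤ (L.map fun cx => ‖cx.1‖).sum := sum_map_norm_nonneg L
    refine ⟨Metric.closedBall z₀ r ×ˢ univ,
      prod_mem_nhds (Metric.closedBall_mem_nhds _ hr) Filter.univ_mem, _,
      summable_fredIter_bound hM (add_nonneg hm0 hS) b, ?_⟩
    rintro a ⟨z, p⟩ ⟨⟨hz, -⟩, -, hp⟩
    rw [norm_div, Complex.norm_natCast]
    gcongr
    exact norm_fredIter_le hKM hM (fun t _ => hΩ (hΓΩ t)) (fun t ht => hm (z, t) ⟨hz, ht⟩) hL a p hp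

/-- Holomorphic dependence of the terms on one extra point. -/
theorem differentiableOn_fredIter_cons (hV : IsOpen V)
    (hK : DifferentiableOn ℂ (fun p : ℂ × ℂ => K p.1 p.2) (V ×ˢ V))
    (hΓ : Continuous Γ) (hΓV : ∀ t, Γ t ∈ V) (hw : Continuous w)
    (hL : ∀ cx ∈ L, cx.2 ∈ V) (a : ℕ) {b : ℕ} {p : Fin b → ℂ} (hp : p ∈ univ.pi fun _ => V) :
    DifferentiableOn ℂ (fun x => fredIter K Γ w L a (Fin.cons x p : Fin _ → ℂ)) V := by
  have h := differentiableOn_fredIter (E := ℂ) (ρ := fun _ _ => 1) (κ := w) isOpen_univ hV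
    (subset_refl V) hK hΓ hΓV hw (by fun_prop) hL a (b + 1)
  simp only [mul_one] at h
  refine h.comp (f := fun x : ℂ => ((0 : ℂ), (Fin.cons x p : Fin _ → ℂ))) ?_ ?_
  · exact DifferentiableOn.prodMk (by fun_prop) (differentiable_cons (by fun_prop) (by fun_prop))
  · exact fun x hx => ⟨trivial, mem_pi_cons hx hp⟩

theorem intervalIntegrable_fredIter (hV : IsOpen V)
    (hK : DifferentiableOn ℂ (fun p : ℂ × ℂ => K p.1 p.2) (V ×ˢ V))
    (hΓ : Continuous Γ) (hΓV : ∀ t, Γ t ∈ V) (hw : Continuous w)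
    (hL : ∀ cx ∈ L, cx.2 ∈ V) (a : ℕ) {b : ℕ} {p : Fin b → ℂ} (hp : p ∈ univ.pi fun _ => V) :
    IntervalIntegrable (fun t => w t * fredIter K Γ w L a (Fin.cons (Γ t) p : Fin _ → ℂ))
      volume 0 1 :=
  (hw.mul ((differentiableOn_fredIter_cons hV hK hΓ hΓV hw hL a hp).continuousOn.comp_continuous
    hΓ hΓV)).intervalIntegrable _ _

/-- The expansion in the number of uses of the new atom stops after the linear term, since two uses
give a repeated point. The factor `a + 1` counts the slots in which the atom may appear. -/
theorem fredIter_cons_atom (hV : IsOpen V)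
    (hK : DifferentiableOn ℂ (fun p : ℂ × ℂ => K p.1 p.2) (V ×ˢ V))
    (hΓ : Continuous Γ) (hΓV : ∀ t, Γ t ∈ V) (hw : Continuous w)
    (hL : ∀ cx ∈ L, cx.2 ∈ V) {c x : ℂ} (hx : x ∈ V) (a : ℕ) :
    ∀ {b : ℕ} {p : Fin b → ℂ}, (p ∈ univ.pi fun _ => V) →
    fredIter K Γ w ((c, x) :: L) (a + 1) p = fredIter K Γ w L (a + 1) p +
      (a + 1) * c * fredIter K Γ w L a (Fin.cons x p : Fin _ → ℂ) := by
  induction a with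
  | zero =>
    intro b p hp
    simp only [fredIter, List.map_cons, List.sum_cons]
    push_cast
    ring
  | succ a ih =>
    intro b p hp
    have h1 : ∀ y ∈ V, fredIter K Γ w ((c, x) :: L) (a + 1) (Fin.cons y p : Fin _ → ℂ) =
        fredIter K Γ w L (a + 1) (Fin.cons y p : Fin _ → ℂ) + (a + 1) * c *
          fredIter K Γ w L a (Fin.cons y (Fin.cons x p : Fin _ → ℂ) : Fin _ → ℂ) := by
      intro y hy
      rw [ih (mem_pi_cons hy hp), fredIter_swap]
    have hxp := mem_pi_cons hx hp
    rw [fredIter, List.map_cons, List.sum_cons, h1 x hx, fredIter_cons_cons_self]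
    have h2 : (∫ t in (0 : ℝ)..1,
        w t * fredIter K Γ w ((c, x) :: L) (a + 1) (Fin.cons (Γ t) p : Fin _ → ℂ)) =
        (∫ t in (0 : ℝ)..1, w t * fredIter K Γ w L (a + 1) (Fin.cons (Γ t) p : Fin _ → ℂ)) +
        (a + 1) * c * ∫ t in (0 : ℝ)..1, w t *
          fredIter K Γ w L a (Fin.cons (Γ t) (Fin.cons x p : Fin _ → ℂ) : Fin _ → ℂ) := by
      rw [← intervalIntegral.integral_const_mul, ← intervalIntegral.integral_add
        (intervalIntegrable_fredIter hV hK hΓ hΓV hw hL _ hp)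
        ((intervalIntegrable_fredIter hV hK hΓ hΓV hw hL _ hxp).const_mul _)]
      refine intervalIntegral.integral_congr fun t _ => ?_
      simp only [h1 _ (hΓV t)]
      ring
    have h3 : ∀ L' : List (ℂ × ℂ), (∀ cx ∈ L', cx.2 ∈ V) →
        (L'.map fun cx => cx.1 *
          fredIter K Γ w ((c, x) :: L) (a + 1) (Fin.cons cx.2 p : Fin _ → ℂ)).sum =
        (L'.map fun cx => cx.1 * fredIter K Γ w L (a + 1) (Fin.cons cx.2 p : Fin _ → ℂ)).sum +
        (a + 1) * c * (L'.map fun cx => cx.1 *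
          fredIter K Γ w L a (Fin.cons cx.2 (Fin.cons x p : Fin _ → ℂ) : Fin _ → ℂ)).sum := by
      intro L' hL'
      induction L' with
      | nil => simp
      | cons cx L' ih' =>
        simp only [List.map_cons, List.sum_cons]
        rw [ih' fun y hy => hL' y (List.mem_cons_of_mem _ hy),
          h1 _ (hL' cx (List.mem_cons_self ..))]
        ring
    rw [h2, h3 L hL]
    have e1 : fredIter K Γ w L (a + 1 + 1) p =
        (∫ t in (0 : ℝ)..1, w t * fredIter K Γ w L (a + 1) (Fin.cons (Γ t) p : Fin _ → ℂ)) +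
        (L.map fun cx => cx.1 * fredIter K Γ w L (a + 1) (Fin.cons cx.2 p : Fin _ → ℂ)).sum := rfl
    have e2 : fredIter K Γ w L (a + 1) (Fin.cons x p : Fin _ → ℂ) =
        (∫ t in (0 : ℝ)..1, w t *
          fredIter K Γ w L a (Fin.cons (Γ t) (Fin.cons x p : Fin _ → ℂ) : Fin _ → ℂ)) +
        (L.map fun cx => cx.1 *
          fredIter K Γ w L a (Fin.cons cx.2 (Fin.cons x p : Fin _ → ℂ) : Fin _ → ℂ)).sum := rfl
    push_cast
    linear_combination (-1 : ℂ) * e1 - (a + 1) * c * e2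

/-- The slot count combines with the factorial, `(a + 1)/(a + 1)! = 1/a!`, so the linear term is
exactly the determinant with one more border point. -/
theorem fredDet_cons_atom (hV : IsOpen V)
    (hK : DifferentiableOn ℂ (fun p : ℂ × ℂ => K p.1 p.2) (V ×ˢ V))
    (hKM : ∀ x ∈ V, ∀ y ∈ V, ‖K x y‖ ≤ M)
    (hΓ : Continuous Γ) (hΓV : ∀ t, Γ t ∈ V) (hw : Continuous w)
    (hL : ∀ cx ∈ L, cx.2 ∈ V) {c x : ℂ} (hx : x ∈ V)
    {b : ℕ} {p : Fin b → ℂ} (hp : p ∈ univ.pi fun _ => V) :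
    fredDet K Γ w ((c, x) :: L) p = fredDet K Γ w L p +
      c * fredDet K Γ w L (Fin.cons x p : Fin _ → ℂ) := by
  have hL' : ∀ cx ∈ (c, x) :: L, cx.2 ∈ V := by
    intro cx h
    rcases List.mem_cons.1 h with rfl | h
    · exact hx
    · exact hL _ h
  have hs : ∀ (L : List (ℂ × ℂ)), (∀ cx ∈ L, cx.2 ∈ V) → ∀ {b : ℕ} {p : Fin b → ℂ},
      (p ∈ univ.pi fun _ => V) → Summable fun a : ℕ => fredIter K Γ w L a p / a.factorial :=
    fun L hL b p hp => (summable_norm_fredIter hKM (fun t _ => hΓV t) hw.continuousOn hL hp).of_norm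
  have hxp := mem_pi_cons hx hp
  simp only [fredDet]
  rw [(hs _ hL' hp).tsum_eq_zero_add, (hs _ hL hp).tsum_eq_zero_add, ← tsum_mul_left, add_assoc,
    ← ((summable_nat_add_iff 1).2 (hs _ hL hp)).tsum_add ((hs _ hL hxp).mul_left c)]
  congr 1
  refine tsum_congr fun a => ?_
  rw [fredIter_cons_atom hV hK hΓ hΓV hw hL hx a hp, Nat.factorial_succ]
  have h1 : (a.factorial : ℂ) ≠ 0 := by exact_mod_cast a.factorial_ne_zero
  have h2 : (a + 1 : ℂ) ≠ 0 := by exact_mod_cast a.succ_ne_zero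
  push_cast
  field_simp

/-- Two densities that differ, on holomorphic functions, by atoms give the same terms. -/
theorem fredIter_eq_of_functional_eq {w' : ℝ → ℂ} (hV : IsOpen V)
    (hK : DifferentiableOn ℂ (fun p : ℂ × ℂ => K p.1 p.2) (V ×ˢ V))
    (hΓ : Continuous Γ) (hΓV : ∀ t, Γ t ∈ V) (hw : Continuous w)
    (hL : ∀ cx ∈ L, cx.2 ∈ V)
    (hww : ∀ ψ : ℂ → ℂ, DifferentiableOn ℂ ψ V → (∫ t in (0 : ℝ)..1, w' t * ψ (Γ t)) =
      (∫ t in (0 : ℝ)..1, w t * ψ (Γ t)) + (L.map fun cx => cx.1 * ψ cx.2).sum) (a : ℕ) :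
    ∀ {b : ℕ} {p : Fin b → ℂ}, (p ∈ univ.pi fun _ => V) →
    fredIter K Γ w' [] a p = fredIter K Γ w L a p := by
  induction a with
  | zero => exact fun _ => rfl
  | succ a ih =>
    intro b p hp
    simp only [fredIter, List.map_nil, List.sum_nil, add_zero]
    -- As a function of the newly added point the previous term is holomorphic on `V`, so it is an
    -- admissible `ψ`.
    rw [← hww _ (differentiableOn_fredIter_cons hV hK hΓ hΓV hw hL a hp)]
    exact intervalIntegral.integral_congr fun t _ => by simp only [ih (mem_pi_cons (hΓV t) hp)]

/-- The Fredholm determinant with atoms of masses `b / f` at `x`, multiplied by the product of the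
`f`'s; here the list consists of the triples `(f, b, x)`. -/
def fredExp (K : ℂ → ℂ → ℂ) (Γ w : ℝ → ℂ) : List (ℂ × ℂ × ℂ) → ∀ {b : ℕ}, (Fin b → ℂ) → ℂ
  | [], _, p => fredDet K Γ w [] p
  | fbx :: l, _, p => fbx.1 * fredExp K Γ w l p +
      fbx.2.1 * fredExp K Γ w l (Fin.cons fbx.2.2 p : Fin _ → ℂ)

/-- One atom at a time, `f (D + (b/f) D') = f D + b D'`. The point of `fredExp` is that it keeps a
meaning, and its holomorphy, where some `f` vanishes. -/
theorem fredExp_eq (hV : IsOpen V)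
    (hK : DifferentiableOn ℂ (fun p : ℂ × ℂ => K p.1 p.2) (V ×ˢ V))
    (hKM : ∀ x ∈ V, ∀ y ∈ V, ‖K x y‖ ≤ M)
    (hΓ : Continuous Γ) (hΓV : ∀ t, Γ t ∈ V) (hw : Continuous w)
    (l : List (ℂ × ℂ × ℂ)) (hl : ∀ y ∈ l, y.1 ≠ 0 ∧ y.2.2 ∈ V) :
    ∀ {b : ℕ} {p : Fin b → ℂ}, (p ∈ univ.pi fun _ => V) →
    fredExp K Γ w l p = (l.map fun y => y.1).prod *
      fredDet K Γ w (l.map fun y => (y.2.1 / y.1, y.2.2)) p := by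
  induction l with
  | nil => intro b p hp; simp [fredExp]
  | cons y l ih =>
    intro b p hp
    have hl' : ∀ y ∈ l, y.1 ≠ 0 ∧ y.2.2 ∈ V := fun y hy => hl y (List.mem_cons_of_mem _ hy)
    have hy := hl y (List.mem_cons_self ..)
    rw [fredExp, ih hl' hp, ih hl' (mem_pi_cons hy.2 hp), List.map_cons, List.map_cons,
      List.prod_cons, fredDet_cons_atom hV hK hKM hΓ hΓV hw ?_ hy.2 hp]
    · have := hy.1
      field_simp
    · intro cx hcx
      obtain ⟨z, hz, rfl⟩ := List.mem_map.1 hcx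
      exact (hl' z hz).2

theorem differentiableOn_fredExp {E : Type} [NormedAddCommGroup E] [NormedSpace ℂ E]
    [FiniteDimensional ℂ E] {U : Set E} {ρ : E → ℂ → ℂ} {κ : ℝ → ℂ}
    (hU : IsOpen U) (hV : IsOpen V) (hΩ : Ω ⊆ V)
    (hK : DifferentiableOn ℂ (fun p : ℂ × ℂ => K p.1 p.2) (V ×ˢ V))
    (hKM : ∀ x ∈ V, ∀ y ∈ V, ‖K x y‖ ≤ M)
    (hΓ : Continuous Γ) (hΓΩ : ∀ t, Γ t ∈ Ω) (hκ : Continuous κ)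
    (hρ : DifferentiableOn ℂ (fun p : E × ℂ => ρ p.1 p.2) (U ×ˢ Ω))
    (l : List (E → ℂ × ℂ × ℂ)) (hl : ∀ y ∈ l, DifferentiableOn ℂ y U ∧ ∀ z ∈ U, (y z).2.2 ∈ V) :
    ∀ b : ℕ, DifferentiableOn ℂ (fun p : E × (Fin b → ℂ) =>
      fredExp K Γ (fun t => κ t * ρ p.1 (Γ t)) (l.map fun y => y p.1) p.2)
      (U ×ˢ univ.pi fun _ => V) := by
  induction l with
  | nil =>
    intro b
    exact differentiableOn_fredDet hU hV hΩ hK hKM hΓ hΓΩ hκ hρ (by simp) b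
  | cons y l ih =>
    intro b
    have ih' := ih fun y hy => hl y (List.mem_cons_of_mem _ hy)
    have hy := hl y (List.mem_cons_self ..)
    have hy1 : DifferentiableOn ℂ (fun p : E × (Fin b → ℂ) => y p.1) (U ×ˢ univ.pi fun _ => V) :=
      hy.1.comp differentiableOn_fst fun p hp => hp.1
    simp only [List.map_cons, fredExp]
    refine DifferentiableOn.add (hy1.fst.mul (ih' b)) (hy1.snd.fst.mul ?_)
    refine (ih' (b + 1)).comp (f := fun p : E × (Fin b → ℂ) =>
      (p.1, (Fin.cons (y p.1).2.2 p.2 : Fin _ → ℂ))) ?_ ?_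
    · exact DifferentiableOn.prodMk (by fun_prop)
        (differentiable_cons hy1.snd.snd (by fun_prop))
    · exact fun p hp => ⟨hp.1, mem_pi_cons (hy.2 _ hp.1) hp.2⟩

/-! ### Comparison with the multiple integrals of the Fredholm series -/

/-- Moving a point from the second to the first block. -/
def sumFinSuccEquiv (k b : ℕ) : Fin k ⊕ Fin (b + 1) ≃ Fin (k + 1) ⊕ Fin b where
  toFun := Sum.elim (fun i => Sum.inl i.succ)
    (fun j => Fin.cases (motive := fun _ => Fin (k + 1) ⊕ Fin b) (Sum.inl 0) (fun j => Sum.inr j) j)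
  invFun := Sum.elim
    (fun i => Fin.cases (motive := fun _ => Fin k ⊕ Fin (b + 1)) (Sum.inr 0) (fun i => Sum.inl i) i)
    (fun j => Sum.inr j.succ)
  left_inv := by
    rintro (i | j)
    · simp
    · refine Fin.cases ?_ (fun j => ?_) j <;> simp
  right_inv := by
    rintro (i | j)
    · refine Fin.cases ?_ (fun i => ?_) i <;> simp
    · simp

theorem kernelDet_sumElim_cons (K : ℂ → ℂ → ℂ) {k b : ℕ} (x : ℂ) (s : Fin k → ℂ) (p : Fin b → ℂ) :
    kernelDet K (Sum.elim s (Fin.cons x p : Fin _ → ℂ)) =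
      kernelDet K (Sum.elim (Fin.cons x s : Fin _ → ℂ) p) := by
  rw [← kernelDet_comp_equiv K (sumFinSuccEquiv k b)]
  congr 1
  funext i
  rcases i with i | j
  · simp [sumFinSuccEquiv]
  · refine Fin.cases ?_ (fun j => ?_) j <;> simp [sumFinSuccEquiv]

theorem setIntegral_pi_Icc_succ {k : ℕ} {f : (Fin (k + 1) → ℝ) → ℂ}
    (hf : ContinuousOn f (univ.pi fun _ => Icc (0 : ℝ) 1)) :
    ∫ t in univ.pi (fun _ : Fin (k + 1) => Icc (0 : ℝ) 1), f t =
      ∫ x in (0 : ℝ)..1, ∫ s in univ.pi (fun _ : Fin k => Icc (0 : ℝ) 1), f (Fin.cons x s) := by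
  set e : ℝ × (Fin k → ℝ) ≃ᵐ (Fin (k + 1) → ℝ) :=
    (MeasurableEquiv.piFinSuccAbove (fun _ => ℝ) 0).symm
  have hem : MeasurePreserving e :=
    (volume_preserving_piFinSuccAbove (fun _ : Fin (k + 1) => ℝ) 0).symm _
  have hev : ∀ y, e y = (Fin.cons y.1 y.2 : Fin (k + 1) → ℝ) := fun y => by
    simp [e]
    rfl
  have heπ : e ⁻¹' (univ.pi fun _ : Fin (k + 1) => Icc (0 : ℝ) 1) =
      Icc (0 : ℝ) 1 ×ˢ univ.pi (fun _ : Fin k => Icc (0 : ℝ) 1) := by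
    ext y
    rw [mem_preimage, hev]
    constructor
    · intro h
      exact ⟨by simpa using h 0 trivial, fun i _ => by simpa using h i.succ trivial⟩
    · rintro ⟨h1, h2⟩ i -
      refine Fin.cases ?_ (fun i => ?_) i
      · simpa using h1
      · simpa using h2 i trivial
  have hint : IntegrableOn f (univ.pi fun _ : Fin (k + 1) => Icc (0 : ℝ) 1) :=
    hf.integrableOn_compact (isCompact_univ_pi fun _ => isCompact_Icc)
  rw [← hem.map_eq, setIntegral_map_equiv, heπ, Measure.volume_eq_prod, setIntegral_prod,
    intervalIntegral.integral_of_le zero_le_one, Measure.restrict_congr_set Ioc_ae_eq_Icc]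
  · simp only [hev]
  · rw [← hem.integrableOn_comp_preimage e.measurableEmbedding, heπ] at hint
    exact hint

/-- Fubini, one variable at a time. Indexing by a sum type separates integration points from border
points, so that a point can pass from one block to the other. -/
theorem fredIter_eq_setIntegral
    (hK : DifferentiableOn ℂ (fun p : ℂ × ℂ => K p.1 p.2) (V ×ˢ V))
    (hΓ : Continuous Γ) (hΓV : ∀ t, Γ t ∈ V) (hw : Continuous w) (k : ℕ) :
    ∀ {b : ℕ} {p : Fin b → ℂ}, (p ∈ univ.pi fun _ => V) →
    fredIter K Γ w [] k p = ∫ t in univ.pi (fun _ : Fin k => Icc (0 : ℝ) 1),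
      (∏ a, w (t a)) * kernelDet K (Sum.elim (Γ ∘ t) p) := by
  induction k with
  | zero =>
    intro b p hp
    have h1 : ∀ t : Fin 0 → ℝ, kernelDet K (Sum.elim (Γ ∘ t) p) = kernelDet K p := by
      intro t
      rw [← kernelDet_comp_equiv K (Equiv.emptySum (Fin 0) (Fin b)).symm]
      rfl
    have h2 : (univ.pi fun _ : Fin 0 => Icc (0 : ℝ) 1) = univ := by ext; simp
    simp only [h1, h2, fredIter, Finset.univ_eq_empty, Finset.prod_empty, one_mul]
    rw [setIntegral_univ, volume_pi, Measure.pi_of_empty, integral_dirac]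
  | succ k ih =>
    intro b p hp
    rw [setIntegral_pi_Icc_succ]
    · simp only [fredIter, List.map_nil, List.sum_nil, add_zero]
      refine intervalIntegral.integral_congr fun x _ => ?_
      rw [ih (mem_pi_cons (hΓV x) hp), ← integral_const_mul]
      refine integral_congr_ae (Filter.Eventually.of_forall fun s => ?_)
      simp only [Fin.prod_univ_succ, Fin.cons_zero, Fin.cons_succ]
      rw [kernelDet_sumElim_cons, mul_assoc]
      congr 4
      funext i
      refine Fin.cases ?_ (fun i => ?_) i <;> simp
    · refine Continuous.continuousOn (Continuous.mul (by fun_prop) ?_)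
      unfold kernelDet
      refine Continuous.matrix_det (continuous_matrix fun i j => ?_)
      refine hK.continuousOn.comp_continuous (f := fun t : Fin (k + 1) → ℝ =>
        (Sum.elim (Γ ∘ t) p i, Sum.elim (Γ ∘ t) p j)) ?_ ?_
      · refine Continuous.prodMk ?_ ?_
        · rcases i with i | i <;> simp <;> fun_prop
        · rcases j with i | i <;> simp <;> fun_prop
      · intro t
        constructor
        · rcases i with i | i
          · exact hΓV _
          · exact hp i trivial
        · rcases j with i | i
          · exact hΓV _
          · exact hp i trivial

/-- The Fredholm series of a kernel `ρ(ω) K(ω, ω')` on a loop. -/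
theorem fredholmTerm_eq
    (hK : DifferentiableOn ℂ (fun p : ℂ × ℂ => K p.1 p.2) (V ×ˢ V))
    (hΓ : Continuous Γ) (hΓV : ∀ t, Γ t ∈ V) {ρ : ℂ → ℂ}
    (hw : Continuous fun t => deriv Γ t * ρ (Γ t)) (k : ℕ) :
    fredholmTerm Γ (fun x y => ρ x * K x y) k =
      fredIter K Γ (fun t => deriv Γ t * ρ (Γ t)) [] k (Fin.elim0 : Fin 0 → ℂ) / k.factorial := by
  rw [fredholmTerm, div_eq_inv_mul, fredIter_eq_setIntegral hK hΓ hΓV hw k (fun i => i.elim0)]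
  congr 1
  refine integral_congr_ae (Filter.Eventually.of_forall fun t => ?_)
  simp only
  have h1 : (Matrix.of fun a b => ρ (Γ (t a)) * K (Γ (t a)) (Γ (t b))).det =
      (∏ a, ρ (Γ (t a))) * kernelDet K (Γ ∘ t) :=
    Matrix.det_mul_column (fun a => ρ (Γ (t a))) (Matrix.of fun a b => K (Γ (t a)) (Γ (t b)))
  have h2 : kernelDet K (Sum.elim (Γ ∘ t) (Fin.elim0 : Fin 0 → ℂ)) = kernelDet K (Γ ∘ t) := by
    rw [← kernelDet_comp_equiv K (Equiv.sumEmpty (Fin k) (Fin 0)).symm]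
    rfl
  rw [h1, h2, Finset.prod_mul_distrib]
  ring

end Fredholm

/-! ### The Barnes function and other entire functions -/

section Entire

open Topology Filter

/-- The factors of the Weierstrass product of the Barnes function at `1 + u`. -/
def barnesFactor (k : ℕ) (u : ℂ) : ℂ :=
  (1 + u / ((k : ℂ) + 1)) ^ (k + 1) * exp (u ^ 2 / (2 * ((k : ℂ) + 1)) - u)

theorem differentiable_barnesFactor (k : ℕ) : Differentiable ℂ (barnesFactor k) := by
  unfold barnesFactor
  fun_prop

/-- With `z = u/(k + 1)` the factor is the exponential of `(k + 1)(log (1 + z) - z + z²/2)`. The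
cubic Taylor remainder makes this exponent `O(R³/(k + 1)²)`; the condition on `k` keeps `‖z‖ ≤ 1/2`.
-/
theorem norm_barnesFactor_sub_one_le {R : ℝ} (hR : 1 ≤ R) {k : ℕ} (hk : 2 * R ^ 3 ≤ k + 1) {u : ℂ}
    (hu : ‖u‖ ≤ R) : ‖barnesFactor k u - 1‖ ≤ 2 * R ^ 3 / (k + 1) ^ 2 := by
  have hk0 : (0 : ℝ) < k + 1 := by positivity
  have hkc : (k + 1 : ℂ) ≠ 0 := by exact_mod_cast hk0.ne'
  set z : ℂ := u / (k + 1) with hz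
  have hnk : ‖(k + 1 : ℂ)‖ = k + 1 := by
    rw [show (k + 1 : ℂ) = ((k + 1 : ℝ) : ℂ) by push_cast; rfl, Complex.norm_real,
      Real.norm_of_nonneg hk0.le]
  have hzn : ‖z‖ ≤ R / (k + 1) := by
    rw [hz, norm_div, hnk]
    gcongr
  have hR3 : R ≤ R ^ 3 := le_self_pow₀ hR (by norm_num)
  have hz2 : ‖z‖ ≤ 1 / 2 := hzn.trans (by rw [div_le_div_iff₀ hk0 two_pos]; linarith)
  have hlog : ‖log (1 + z) - (z - z ^ 2 / 2)‖ ≤ ‖z‖ ^ 3 := by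
    have h := norm_log_sub_logTaylor_le 2 (lt_of_le_of_lt hz2 (by norm_num) : ‖z‖ < 1)
    have h2 : logTaylor 3 z = z - z ^ 2 / 2 := by
      simp [logTaylor, Finset.sum_range_succ]
      ring
    norm_num at h
    rw [h2] at h
    refine h.trans ?_
    have h3 : (1 - ‖z‖)⁻¹ ≤ 2 := by
      rw [inv_le_comm₀ (by linarith) two_pos]
      linarith
    have h4 : 0 ≤ ‖z‖ ^ 3 := by positivity
    nlinarith
  set x : ℂ := (k + 1) * (log (1 + z) - (z - z ^ 2 / 2)) with hx
  have hxn : ‖x‖ ≤ R ^ 3 / (k + 1) ^ 2 := by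
    rw [hx, norm_mul, hnk]
    calc (k + 1 : ℝ) * ‖log (1 + z) - (z - z ^ 2 / 2)‖ ≤ (k + 1) * (R / (k + 1)) ^ 3 := by
          gcongr
          exact hlog.trans (by gcongr)
      _ = R ^ 3 / (k + 1) ^ 2 := by field_simp
  have h1 : barnesFactor k u = exp x := by
    have hne : 1 + z ≠ 0 := by
      intro h
      have : z = -1 := by linear_combination h
      rw [this] at hz2
      norm_num at hz2
    have hkk : ((k + 1 : ℕ) : ℂ) = (k : ℂ) + 1 := by push_cast; rfl
    rw [barnesFactor, ← hz, ← Complex.exp_log hne, ← Complex.exp_nat_mul, ← Complex.exp_add, hx,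
      hkk]
    congr 1
    have : u = (k + 1) * z := by rw [hz]; field_simp
    rw [this]
    field_simp
    ring
  have hx1 : ‖x‖ ≤ 1 := by
    refine hxn.trans ?_
    rw [div_le_one (by positivity)]
    have : R ^ 3 ≤ k + 1 := by nlinarith [pow_nonneg (zero_le_one.trans hR) 3]
    nlinarith
  have h2 := Complex.norm_exp_sub_one_sub_id_le hx1
  rw [h1]
  calc ‖exp x - 1‖ ≤ ‖exp x - 1 - x‖ + ‖x‖ := by
        simpa using norm_add_le (exp x - 1 - x) x
    _ ≤ ‖x‖ ^ 2 + ‖x‖ := by gcongr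
    _ ≤ 2 * ‖x‖ := by nlinarith [norm_nonneg x]
    _ ≤ 2 * (R ^ 3 / (k + 1) ^ 2) := by gcongr
    _ = 2 * R ^ 3 / (k + 1) ^ 2 := by ring

/-- The shift by `N` leaves aside the first `N` factors, whose zeros are to be exhibited separately.
-/
theorem hasProdLocallyUniformlyOn_barnesFactor (N : ℕ) (R : ℝ) :
    HasProdLocallyUniformlyOn (fun n u => barnesFactor (n + N) u)
      (fun u => ∏' n, barnesFactor (n + N) u) (Metric.ball 0 R) := by
  set R' := max R 1
  have h := Summable.hasProdLocallyUniformlyOn_nat_one_add (K := Metric.ball (0 : ℂ) R)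
    (f := fun n u => barnesFactor (n + N) u - 1)
    (u := fun n => 2 * R' ^ 3 / ((n + N : ℕ) + 1 : ℝ) ^ 2) Metric.isOpen_ball ?_ ?_ ?_
  · simpa using h
  · have h1 : Summable fun n : ℕ => 2 * R' ^ 3 * (1 / (n : ℝ) ^ 2) :=
      (Real.summable_one_div_nat_pow.2 one_lt_two).mul_left _
    have h2 := (summable_nat_add_iff (N + 1)).2 h1
    refine h2.congr fun n => ?_
    push_cast
    ring
  · filter_upwards [eventually_ge_atTop ⌈2 * R' ^ 3⌉₊] with n hn u hu
    refine norm_barnesFactor_sub_one_le (le_max_right _ _) ?_ ?_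
    · have := Nat.ceil_le.1 hn
      push_cast
      have h0 : (0 : ℝ) ≤ N := Nat.cast_nonneg N
      linarith
    · exact (le_of_lt (by simpa using hu)).trans (le_max_left _ _)
  · intro n
    exact ((differentiable_barnesFactor _).continuous.sub continuous_const).continuousOn

/-- The zeros of the Barnes function: `-j` is a zero of order `j + 1` (here `j < N`). -/
theorem exists_barnesG_factorization (N : ℕ) : ∃ g : ℂ → ℂ, Differentiable ℂ g ∧
    ∀ u, barnesG (1 + u) = (∏ j ∈ Finset.range N, (u + (j + 1)) ^ (j + 1)) * g u := by
  have hd : Differentiable ℂ fun u => ∏' n, barnesFactor (n + N) u := by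
    intro u
    have h1 : DifferentiableOn ℂ (fun u => ∏' n, barnesFactor (n + N) u)
        (Metric.ball 0 (‖u‖ + 1)) := by
      refine TendstoLocallyUniformlyOn.differentiableOn
        (hasProdLocallyUniformlyOn_barnesFactor N (‖u‖ + 1)) (Eventually.of_forall fun s => ?_)
        Metric.isOpen_ball
      exact differentiableOn_finsetProd fun i _ => (differentiable_barnesFactor _).differentiableOn
    exact h1.differentiableAt (Metric.isOpen_ball.mem_nhds (by simp))
  refine ⟨fun u => exp (u / 2 * (Real.log (2 * Real.pi) : ℂ)) *
    exp (-(u + (1 + (Real.eulerMascheroniConstant : ℂ)) * u ^ 2) / 2) *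
    (∏ j ∈ Finset.range N, (((j : ℂ) + 1)⁻¹ ^ (j + 1) * exp (u ^ 2 / (2 * ((j : ℂ) + 1)) - u))) *
    ∏' n, barnesFactor (n + N) u, ?_, fun u => ?_⟩
  · refine Differentiable.mul (Differentiable.mul (by fun_prop) ?_) hd
    rw [← differentiableOn_univ]
    exact differentiableOn_finsetProd fun i _ => by fun_prop
  · have hm : Multipliable fun n => barnesFactor (n + N) u :=
      ((hasProdLocallyUniformlyOn_barnesFactor N (‖u‖ + 1)).hasProd (by simp)).multipliable
    have h2 := hm.prod_mul_tprod_nat_mul' (f := fun n => barnesFactor n u)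
    have h3 : ∏' k : ℕ, ((1 + (1 + u - 1) / ((k : ℂ) + 1)) ^ (k + 1) *
      exp ((1 + u - 1) ^ 2 / (2 * ((k : ℂ) + 1)) - (1 + u - 1))) = ∏' k, barnesFactor k u := by
      simp only [add_sub_cancel_left, barnesFactor]
    rw [barnesG, h3, ← h2]
    have h4 : ∏ j ∈ Finset.range N, barnesFactor j u =
        (∏ j ∈ Finset.range N, (u + (j + 1)) ^ (j + 1)) *
        ∏ j ∈ Finset.range N, (((j : ℂ) + 1)⁻¹ ^ (j + 1) *
          exp (u ^ 2 / (2 * ((j : ℂ) + 1)) - u)) := by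
      rw [← Finset.prod_mul_distrib]
      refine Finset.prod_congr rfl fun j _ => ?_
      have : (j + 1 : ℂ) ≠ 0 := by exact_mod_cast j.succ_ne_zero
      rw [barnesFactor, ← mul_assoc, ← mul_pow]
      congr 2
      field_simp
      ring
    rw [h4, add_sub_cancel_left]
    ring

theorem differentiable_barnesG : Differentiable ℂ barnesG := by
  obtain ⟨g, hg, h⟩ := exists_barnesG_factorization 0
  have : barnesG = fun w => g (w - 1) := by
    funext w
    have := h (w - 1)
    simpa using this
  rw [this]
  exact hg.comp (by fun_prop)

theorem exists_factorization_of_zeros {ι : Type*} (s : Finset ι) (a : ι → ℂ) (ha : InjOn a s) :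
    ∀ f : ℂ → ℂ, Differentiable ℂ f → (∀ i ∈ s, f (a i) = 0) →
    ∃ g : ℂ → ℂ, Differentiable ℂ g ∧ ∀ u, f u = (∏ i ∈ s, (u - a i)) * g u := by
  classical
  induction s using Finset.induction_on with
  | empty => exact fun f hf _ => ⟨f, hf, by simp⟩
  | insert i s hi ih =>
    intro f hf h0
    have hfi := h0 i (Finset.mem_insert_self ..)
    have hd : Differentiable ℂ (dslope f (a i)) := by
      rw [← differentiableOn_univ] at hf ⊢
      exact (Complex.differentiableOn_dslope Filter.univ_mem).2 hf
    have hsl : ∀ u, f u = (u - a i) * dslope f (a i) u := by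
      intro u
      have := sub_smul_dslope f (a i) u
      rw [hfi, sub_zero, smul_eq_mul] at this
      exact this.symm
    obtain ⟨g, hg, hgf⟩ := ih (ha.mono (by simp)) (dslope f (a i)) hd (by
      intro j hj
      have h1 := hsl (a j)
      rw [h0 j (Finset.mem_insert_of_mem hj)] at h1
      refine (mul_eq_zero.1 h1.symm).resolve_left (sub_ne_zero.2 fun h => ?_)
      have := ha (by simp [hj]) (by simp) h
      exact hi (this ▸ hj))
    refine ⟨g, hg, fun u => ?_⟩
    rw [hsl, hgf, Finset.prod_insert hi, mul_assoc]

/-! ### Zeros of `e^{-2iπu} - 1` and partial fractions -/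

/-- The function `e^{-2iπu} - 1`. -/
def expSubOne (u : ℂ) : ℂ := exp (-2 * I * Real.pi * u) - 1

theorem differentiable_expSubOne : Differentiable ℂ expSubOne := by unfold expSubOne; fun_prop

theorem expSubOne_eq_zero_iff {u : ℂ} : expSubOne u = 0 ↔ ∃ n : ℤ, u = n := by
  rw [expSubOne, sub_eq_zero, Complex.exp_eq_one_iff]
  have h : (2 * Real.pi * I : ℂ) ≠ 0 := by simp [Real.pi_ne_zero]
  constructor
  · rintro ⟨n, hn⟩
    refine ⟨-n, mul_left_cancel₀ h ?_⟩
    push_cast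
    linear_combination (-1 : ℂ) * hn
  · rintro ⟨n, rfl⟩
    exact ⟨-n, by push_cast; ring⟩

theorem hasDerivAt_expSubOne_int (n : ℤ) : HasDerivAt expSubOne (-2 * I * Real.pi) n := by
  have h1 : HasDerivAt (fun u : ℂ => -2 * I * Real.pi * u) (-2 * I * Real.pi) (n : ℂ) := by
    simpa using (hasDerivAt_id (n : ℂ)).const_mul (-2 * I * (Real.pi : ℂ))
  have h2 := h1.cexp.sub_const 1
  have h3 : exp (-2 * I * Real.pi * (n : ℂ)) = 1 := by
    have := (expSubOne_eq_zero_iff (u := n)).2 ⟨n, rfl⟩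
    rwa [expSubOne, sub_eq_zero] at this
  rwa [h3, one_mul] at h2

/-- Indices of the integers between `-1 - N` and `N`. -/
abbrev PoleIndex (N : ℕ) : Type := Bool × Fin (N + 1)

/-- The integer with a given index: `j` or `-1 - j`. -/
def poleInt {N : ℕ} (k : PoleIndex N) : ℤ := if k.1 then k.2 else -1 - k.2

theorem poleInt_injective (N : ℕ) : Function.Injective (poleInt (N := N)) := by
  rintro ⟨s, i⟩ ⟨s', j⟩ h
  unfold poleInt at h
  cases s <;> cases s' <;> simp at h ⊢ <;> omega

theorem poleInt_bounds {N : ℕ} (k : PoleIndex N) : -1 - (N : ℤ) ≤ poleInt k ∧ poleInt k ≤ N := by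
  obtain ⟨s, j, hj⟩ := k
  cases s <;> simp [poleInt] <;> omega

theorem exists_poleInt {N : ℕ} {n : ℤ} (h1 : -1 - (N : ℤ) ≤ n) (h2 : n ≤ N) :
    ∃ k : PoleIndex N, poleInt k = n := by
  by_cases hn : 0 ≤ n
  · refine ⟨(true, ⟨n.toNat, by omega⟩), ?_⟩
    simp [poleInt, hn]
  · refine ⟨(false, ⟨(-1 - n).toNat, by omega⟩), ?_⟩
    simp only [poleInt, Bool.false_eq_true, if_false]
    omega

theorem norm_poleInt_add_half {N : ℕ} (k : PoleIndex N) : ‖(poleInt k : ℂ) + 1 / 2‖ < N + 1 := by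
  obtain ⟨h1, h2⟩ := poleInt_bounds k
  have h1' : -1 - (N : ℝ) ≤ poleInt k := by exact_mod_cast h1
  have h2' : (poleInt k : ℝ) ≤ N := by exact_mod_cast h2
  have : (poleInt k : ℂ) + 1 / 2 = ((poleInt k + 1 / 2 : ℝ) : ℂ) := by push_cast; rfl
  rw [this, Complex.norm_real, Real.norm_eq_abs, abs_lt]
  constructor <;> linarith

/-- The nearest integers left out, `-2 - N` and `N + 1`, lie at distance exactly `N + 3/2` from
`-1/2`. The last identity compares the derivatives of both sides at an integer: it shows that the
zeros are simple and gives the residues of the inverse. -/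
theorem exists_expSubOne_factorization (N : ℕ) : ∃ g : ℂ → ℂ, Differentiable ℂ g ∧
    (∀ u, expSubOne u = (∏ k : PoleIndex N, (u - poleInt k)) * g u) ∧
    (∀ u, ‖u + 1 / 2‖ < N + 3 / 2 → g u ≠ 0) ∧
    ∀ k : PoleIndex N, g (poleInt k) *
      ∏ k' ∈ Finset.univ.erase k, ((poleInt k : ℂ) - poleInt k') = -2 * I * Real.pi := by
  obtain ⟨g, hg, h⟩ := exists_factorization_of_zeros Finset.univ
    (fun k : PoleIndex N => (poleInt k : ℂ))
    (fun a _ b _ hab => poleInt_injective N (Int.cast_injective (α := ℂ) hab)) expSubOne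
    differentiable_expSubOne (fun k _ => expSubOne_eq_zero_iff.2 ⟨_, rfl⟩)
  have hder : ∀ k : PoleIndex N, g (poleInt k) *
      ∏ k' ∈ Finset.univ.erase k, ((poleInt k : ℂ) - poleInt k') = -2 * I * Real.pi := by
    intro k
    have h1 : expSubOne = fun u => (u - poleInt k) *
        (g u * ∏ k' ∈ Finset.univ.erase k, (u - poleInt k')) := by
      funext u
      rw [h u, ← Finset.mul_prod_erase _ _ (Finset.mem_univ k)]
      ring
    have hd : Differentiable ℂ fun u => g u * ∏ k' ∈ Finset.univ.erase k, (u - poleInt k') := by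
      refine hg.mul ?_
      rw [← differentiableOn_univ]
      exact differentiableOn_finsetProd fun i _ => by fun_prop
    have h2 := ((hasDerivAt_id (poleInt k : ℂ)).sub_const (poleInt k : ℂ)).mul
      (hd (poleInt k)).hasDerivAt
    have h3 := (hasDerivAt_expSubOne_int (poleInt k)).unique
      (h2.congr_of_eventuallyEq (Eventually.of_forall fun u => congrFun h1 u))
    rw [h3]
    simp
  refine ⟨g, hg, h, fun u hu h0 => ?_, hder⟩
  have h1 : expSubOne u = 0 := by rw [h, h0, mul_zero]
  obtain ⟨n, rfl⟩ := expSubOne_eq_zero_iff.1 h1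
  have h2 : ((n : ℂ) + 1 / 2) = ((n + 1 / 2 : ℝ) : ℂ) := by push_cast; rfl
  rw [h2, Complex.norm_real, Real.norm_eq_abs, abs_lt] at hu
  have h3 : (-2 - (N : ℝ)) < n := by linarith
  have h4 : (n : ℝ) < N + 1 := by linarith
  have h3' : -2 - (N : ℤ) < n := by exact_mod_cast h3
  have h4' : n < (N : ℤ) + 1 := by exact_mod_cast h4
  obtain ⟨k, rfl⟩ := exists_poleInt (N := N) (n := n) (by omega) (by omega)
  have h5 := hder k
  rw [h0, zero_mul] at h5
  have : (-2 * I * Real.pi : ℂ) ≠ 0 := by simp [Real.pi_ne_zero]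
  exact this h5.symm

/-- The part of `e^{uℓ} / (e^{-2iπu} - 1)` that is holomorphic for `|u + 1/2| < N + 1`. -/
def regularQuotient (N : ℕ) (u ℓ : ℂ) : ℂ :=
  (2 * Real.pi * I)⁻¹ * ∮ v in C(-1 / 2, N + 1), exp (v * ℓ) / expSubOne v / (v - u)

/-- The circle meets the real axis at the half-integers `N + 1/2` and `-N - 3/2`; after doubling
this is a question of parity. -/
theorem expSubOne_ne_zero_of_mem_sphere {N : ℕ} {v : ℂ}
    (hv : v ∈ Metric.sphere (-1 / 2 : ℂ) (N + 1)) : expSubOne v ≠ 0 := by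
  intro h
  obtain ⟨n, rfl⟩ := expSubOne_eq_zero_iff.1 h
  rw [mem_sphere_iff_norm, show ((n : ℂ) - -1 / 2) = ((n + 1 / 2 : ℝ) : ℂ) by push_cast; ring,
    Complex.norm_real, Real.norm_eq_abs] at hv
  have h2 : |2 * (n : ℝ) + 1| = 2 * N + 2 := by
    rw [show 2 * (n : ℝ) + 1 = 2 * (n + 1 / 2) by ring, abs_mul, hv, abs_two]; ring
  have h3 : |2 * n + 1| = 2 * (N : ℤ) + 2 := by exact_mod_cast h2
  rcases abs_eq (by positivity : 0 ≤ 2 * (N : ℤ) + 2) |>.1 h3 with h | h <;> omega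

theorem differentiableOn_regularQuotient (N : ℕ) :
    DifferentiableOn ℂ (fun p : ℂ × ℂ => regularQuotient N p.1 p.2)
      (Metric.ball (-1 / 2) (N + 1) ×ˢ univ) := by
  unfold regularQuotient
  refine DifferentiableOn.const_mul ?_ _
  simp only [circleIntegral]
  have hN : (0 : ℝ) ≤ N + 1 := by positivity
  set κ : ℝ → ℂ := fun θ => deriv (circleMap (-1 / 2) (N + 1)) θ /
    expSubOne (circleMap (-1 / 2) (N + 1) θ) with hκ
  have hO : IsOpen (Metric.ball (-1 / 2 : ℂ) (N + 1) ×ˢ (univ : Set ℂ)) :=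
    Metric.isOpen_ball.prod isOpen_univ
  have key : DifferentiableOn ℂ (fun p : ℂ × ℂ => ∫ θ in (0 : ℝ)..2 * Real.pi,
      κ θ * (exp (circleMap (-1 / 2) (N + 1) θ * p.2) / (circleMap (-1 / 2) (N + 1) θ - p.1)))
      (Metric.ball (-1 / 2) (N + 1) ×ˢ univ) := by
    intro p₀ hp₀
    obtain ⟨r, hr, hsub⟩ := Metric.isOpen_iff.1 Metric.isOpen_ball p₀.1 hp₀.1
    -- An intermediate radius separates `p.1` from the contour by open sets, so that the integrand
    -- is holomorphic on a product.
    obtain ⟨r', hr1, hr2⟩ := exists_between (show dist p₀.1 (-1 / 2) < N + 1 from hp₀.1)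
    have hO' : IsOpen (Metric.ball (-1 / 2 : ℂ) r' ×ˢ (univ : Set ℂ)) :=
      Metric.isOpen_ball.prod isOpen_univ
    have h1 := differentiableOn_pathIntegral (a := 0) (b := 2 * Real.pi) hO'
      (V := {v | r' < dist v (-1 / 2)})
      (γ := circleMap (-1 / 2) (N + 1)) (κ := κ)
      (f := fun (p : ℂ × ℂ) v => exp (v * p.2) / (v - p.1)) Real.two_pi_pos.le ?_
      (continuous_circleMap _ _).continuousOn ?_ ?_
    · exact (h1.differentiableAt (hO'.mem_nhds ⟨hr1, trivial⟩)).differentiableWithinAt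
    · simp_rw [div_eq_mul_inv]
      refine DifferentiableOn.mul (by fun_prop) (DifferentiableOn.inv (by fun_prop) ?_)
      rintro ⟨⟨u, ℓ⟩, v⟩ ⟨⟨hu, -⟩, hv⟩ h0
      simp only at h0
      rw [sub_eq_zero.1 h0] at hv
      exact lt_asymm hv (show dist u (-1 / 2) < r' from hu)
    · refine Continuous.continuousOn ?_
      refine Continuous.div ?_ (differentiable_expSubOne.continuous.comp
        (continuous_circleMap _ _)) fun θ => expSubOne_ne_zero_of_mem_sphere
          (circleMap_mem_sphere _ hN θ)
      simp only [funext (deriv_circleMap _ _)]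
      fun_prop
    · intro θ _
      have := circleMap_mem_sphere (-1 / 2) hN θ
      rw [Metric.mem_sphere] at this
      exact hr2.trans_eq this.symm
  refine key.congr fun p _ => intervalIntegral.integral_congr fun θ _ => ?_
  simp only [hκ, smul_eq_mul]
  ring

/-- The residue theorem, with a pole at `u` and one at each integer of the disc. The centre `-1/2`
makes these integers symmetric under `k ↦ -1 - k`, which exchanges the families attached to `-q` and
to `q`. -/
theorem regularQuotient_eq {N : ℕ} {u : ℂ} (ℓ : ℂ) (hu : ‖u + 1 / 2‖ < N + 1)
    (hu' : ∀ n : ℤ, u ≠ n) :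
    regularQuotient N u ℓ = exp (u * ℓ) / expSubOne u +
      (2 * Real.pi * I)⁻¹ * ∑ k : PoleIndex N, exp (poleInt k * ℓ) / (u - poleInt k) := by
  obtain ⟨g, hg, hfac, hne, hder⟩ := exists_expSubOne_factorization N
  let x : Option (PoleIndex N) → ℂ := fun o => o.elim u fun k => (poleInt k : ℂ)
  have hinj : Function.Injective x := by
    rintro (_ | a) (_ | b) h
    · rfl
    · exact absurd h (hu' _)
    · exact absurd h.symm (hu' _)
    · have : poleInt a = poleInt b := by simpa [x] using h
      rw [poleInt_injective N this]
  have hx : ∀ o, x o ∈ Metric.ball (-1 / 2 : ℂ) (N + 1) := by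
    rintro (_ | k) <;> rw [mem_ball_iff_norm] <;> simp only [x, Option.elim]
    · rwa [show u - -1 / 2 = u + 1 / 2 by ring]
    · rw [show (poleInt k : ℂ) - -1 / 2 = poleInt k + 1 / 2 by ring]
      exact norm_poleInt_add_half k
  have hgd : DifferentiableOn ℂ (fun v => exp (v * ℓ) / g v)
      (Metric.closedBall (-1 / 2 : ℂ) (N + 1)) := by
    refine DifferentiableOn.div (by fun_prop) hg.differentiableOn fun v hv => hne v ?_
    rw [mem_closedBall_iff_norm, show v - -1 / 2 = v + 1 / 2 by ring] at hv
    linarith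
  have h1 := residue_circle hgd hinj hx
  have hN : (0 : ℝ) ≤ N + 1 := by positivity
  have h2 : (∮ v in C(-1 / 2, N + 1), exp (v * ℓ) / expSubOne v / (v - u)) =
      ∮ v in C(-1 / 2, N + 1), exp (v * ℓ) / g v / ∏ o, (v - x o) := by
    refine circleIntegral.integral_congr hN fun v _ => ?_
    simp only [Fintype.prod_option, x, Option.elim, hfac v]
    rw [div_div, div_div]
    congr 1
    ring
  rw [regularQuotient, h2, h1, ← mul_assoc,
    inv_mul_cancel₀ (by simp [Real.pi_ne_zero]), one_mul, Fintype.sum_option, Finset.mul_sum]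
  have he1 : (Finset.univ.erase none : Finset (Option (PoleIndex N))) =
      Finset.univ.map Function.Embedding.some := by
    ext o; cases o <;> simp
  have he2 : ∀ k : PoleIndex N, (Finset.univ.erase (some k) : Finset (Option (PoleIndex N))) =
      insert none ((Finset.univ.erase k).map Function.Embedding.some) := by
    intro k; ext o; cases o <;> simp
  have hsn : ∀ o : PoleIndex N, x (some o) = (poleInt o : ℂ) := fun o => rfl
  have hn : x none = u := rfl
  congr 1
  · rw [he1, Finset.prod_map, hn, hfac u, div_div, mul_comm (g u)]
    rfl
  · refine Finset.sum_congr rfl fun k _ => ?_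
    rw [he2, Finset.prod_insert (by simp), Finset.prod_map, hsn, hn]
    simp only [Function.Embedding.some_apply, hsn]
    have h3 := hder k
    have h4 : g (poleInt k) ≠ 0 := by
      intro h0
      rw [h0, zero_mul] at h3
      have : (-2 * I * Real.pi : ℂ) ≠ 0 := by simp [Real.pi_ne_zero]
      exact this h3.symm
    have h5 : u - poleInt k ≠ 0 := sub_ne_zero.2 (hu' _)
    have h6 : (poleInt k : ℂ) - u ≠ 0 := sub_ne_zero.2 (hu' _).symm
    have hpi : (Real.pi : ℂ) ≠ 0 := by simp [Real.pi_ne_zero]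
    rw [div_div, mul_comm ((poleInt k : ℂ) - u), ← mul_assoc, h3]
    field_simp
    ring

end Entire

/-! ### The Cauchy transform on a segment -/

section Segment

open Topology Metric

theorem circleIntegral_inv_mul_inv {c x y : ℂ} {R : ℝ} (hx : x ∈ ball c R) (hy : y ∈ ball c R) :
    ∮ w in C(c, R), ((w - x) * (w - y))⁻¹ = 0 := by
  have hR : 0 < R := pos_of_mem_ball hx
  by_cases hxy : x = y
  · subst hxy
    have := circleIntegral.integral_sub_zpow_of_ne (n := -2) (by norm_num) c x R
    rw [← this]
    congr 1
    funext w
    rw [zpow_neg, ← pow_two]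
    rfl
  · have hinj : Function.Injective ![x, y] := by
      intro i j h
      fin_cases i <;> fin_cases j <;> simp at h ⊢
      · exact hxy h
      · exact hxy h.symm
    have h := residue_circle (c := c) (R := R) (g := fun _ => 1) (by fun_prop) hinj (by
      intro i; fin_cases i <;> simpa)
    have e0 : (Finset.univ.erase 0 : Finset (Fin 2)) = {1} := rfl
    have e1 : (Finset.univ.erase 1 : Finset (Fin 2)) = {0} := rfl
    simp only [one_div, Fin.prod_univ_two, Fin.sum_univ_two, Matrix.cons_val_zero,
      Matrix.cons_val_one, e0, e1, Finset.prod_singleton] at h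
    rw [h]
    have h1 : x - y ≠ 0 := sub_ne_zero.2 hxy
    have h2 : y - x ≠ 0 := sub_ne_zero.2 (Ne.symm hxy)
    field_simp
    ring

/-- Off the diagonal the quotient formula suffices. Near it, Cauchy's formula represents the
difference quotient by `(2iπ)⁻¹ ∮ φ(w) / ((w - s)(w - x)) dw`, which is visibly holomorphic in both
points; the subtracted constant drops out by `circleIntegral_inv_mul_inv`. -/
theorem differentiableOn_dslope_uncurry {V : Set ℂ} (hV : IsOpen V) {φ : ℂ → ℂ}
    (hφ : DifferentiableOn ℂ φ V) :
    DifferentiableOn ℂ (fun p : ℂ × ℂ => dslope φ p.2 p.1) (V ×ˢ V) := by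
  rintro ⟨x₀, s₀⟩ ⟨hx₀, hs₀⟩
  refine DifferentiableAt.differentiableWithinAt ?_
  by_cases hne : x₀ = s₀
  · subst hne
    obtain ⟨r, hr, hsub⟩ := nhds_basis_closedBall.mem_iff.1 (hV.mem_nhds hx₀)
    have hO : IsOpen (ball x₀ (r / 2) ×ˢ ball x₀ (r / 2)) := isOpen_ball.prod isOpen_ball
    have h1 := differentiableOn_pathIntegral (a := 0) (b := 2 * Real.pi) hO
      (V := {w | r / 2 < dist w x₀} ∩ V) (γ := circleMap x₀ r) (κ := deriv (circleMap x₀ r))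
      (f := fun (p : ℂ × ℂ) w => ((w - p.2) * (w - p.1))⁻¹ * φ w) Real.two_pi_pos.le ?_
      (continuous_circleMap _ _).continuousOn ?_ ?_
    · have h2 := h1.differentiableAt (hO.mem_nhds (show (x₀, x₀) ∈
        ball x₀ (r / 2) ×ˢ ball x₀ (r / 2) from ⟨mem_ball_self (half_pos hr),
          mem_ball_self (half_pos hr)⟩))
      refine (h2.const_mul (2 * Real.pi * I)⁻¹).congr_of_eventuallyEq ?_
      filter_upwards [hO.mem_nhds (show (x₀, x₀) ∈
        ball x₀ (r / 2) ×ˢ ball x₀ (r / 2) from ⟨mem_ball_self (half_pos hr),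
        mem_ball_self (half_pos hr)⟩)] with p hp
      obtain ⟨x, s⟩ := p
      have hb : ball x₀ (r / 2) ⊆ ball x₀ r := ball_subset_ball (by linarith)
      have hx := hb hp.1
      have hs := hb hp.2
      have hd : DifferentiableOn ℂ (dslope φ s) (closedBall x₀ r) :=
        ((Complex.differentiableOn_dslope (hV.mem_nhds (hsub (ball_subset_closedBall hs)))).2
          hφ).mono hsub
      have h3 := hd.circleIntegral_sub_inv_smul hx
      have hne1 : ∀ y ∈ ball x₀ r, ∀ w ∈ sphere x₀ r, w - y ≠ 0 := by
        intro y hy w hw h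
        rw [← sub_eq_zero.1 h, mem_ball, mem_sphere.1 hw] at hy
        exact lt_irrefl _ hy
      have hci : CircleIntegrable (fun w => ((w - s) * (w - x))⁻¹) x₀ r := by
        refine ContinuousOn.circleIntegrable hr.le (ContinuousOn.inv₀ (by fun_prop) fun w hw => ?_)
        exact mul_ne_zero (hne1 s hs w hw) (hne1 x hx w hw)
      have h4 : (∮ w in C(x₀, r), (w - x)⁻¹ • dslope φ s w) =
          ∮ w in C(x₀, r), (((w - s) * (w - x))⁻¹ * φ w - φ s * ((w - s) * (w - x))⁻¹) := by
        refine circleIntegral.integral_congr hr.le fun w hw => ?_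
        have e1 := hne1 s hs w hw
        have e2 := hne1 x hx w hw
        simp only [smul_eq_mul]
        rw [dslope_of_ne _ (sub_ne_zero.1 e1), slope_def_field]
        field_simp
      rw [circleIntegral.integral_sub, circleIntegral.integral_const_mul,
        circleIntegral_inv_mul_inv hs hx, mul_zero, sub_zero] at h4
      · simp only
        have h5 : (2 * Real.pi * I : ℂ) ≠ 0 := by simp [Real.pi_ne_zero]
        rw [← inv_mul_cancel_left₀ h5 (dslope φ s x), ← smul_eq_mul (2 * Real.pi * I : ℂ) _, ← h3,
          h4]
        rfl
      · exact ContinuousOn.circleIntegrable hr.le (ContinuousOn.mul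
          (ContinuousOn.inv₀ (by fun_prop) fun w hw =>
            mul_ne_zero (hne1 s hs w hw) (hne1 x hx w hw))
          (hφ.continuousOn.mono (sphere_subset_closedBall.trans hsub)))
      · exact hci.const_smul (a := φ s)
    · refine DifferentiableOn.mul (DifferentiableOn.inv (by fun_prop) ?_)
        (hφ.comp differentiableOn_snd fun p hp => hp.2.2)
      rintro ⟨⟨x, s⟩, w⟩ ⟨⟨hx, hs⟩, hw, -⟩ h0
      have hx' : dist x x₀ < r / 2 := hx
      have hs' : dist s x₀ < r / 2 := hs
      have hw' : r / 2 < dist w x₀ := hw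
      rcases mul_eq_zero.1 h0 with h | h
      · rw [sub_eq_zero.1 (show w - s = 0 from h)] at hw'; exact lt_asymm hw' hs'
      · rw [sub_eq_zero.1 (show w - x = 0 from h)] at hw'; exact lt_asymm hw' hx'
    · simp only [funext (deriv_circleMap _ _)]
      fun_prop
    · intro θ _
      have h2 := circleMap_mem_sphere x₀ hr.le θ
      refine ⟨?_, hsub (sphere_subset_closedBall h2)⟩
      show r / 2 < dist _ _
      rw [mem_sphere.1 h2]
      linarith
  · have hO : IsOpen {p : ℂ × ℂ | p.1 ≠ p.2} := isOpen_ne_fun continuous_fst continuous_snd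
    have hx : DifferentiableAt ℂ (fun p : ℂ × ℂ => φ p.1) (x₀, s₀) :=
      DifferentiableAt.comp (g := φ) (f := Prod.fst) (x₀, s₀)
        (hφ.differentiableAt (hV.mem_nhds hx₀)) differentiableAt_fst
    have hs : DifferentiableAt ℂ (fun p : ℂ × ℂ => φ p.2) (x₀, s₀) :=
      DifferentiableAt.comp (g := φ) (f := Prod.snd) (x₀, s₀)
        (hφ.differentiableAt (hV.mem_nhds hs₀)) differentiableAt_snd
    have h1 : DifferentiableAt ℂ (fun p : ℂ × ℂ => (φ p.1 - φ p.2) * (p.1 - p.2)⁻¹) (x₀, s₀) :=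
      (hx.sub hs).mul (DifferentiableAt.inv (by fun_prop) (sub_ne_zero.2 hne))
    refine h1.congr_of_eventuallyEq ?_
    filter_upwards [hO.mem_nhds hne] with p hp
    rw [dslope_of_ne _ hp, slope_def_field, div_eq_mul_inv]

/-- The integral `∫_{-q}^{q} φ(s) / (s - x) ds`. -/
def segmentTransform (q : ℝ) (φ : ℂ → ℂ) (x : ℂ) : ℂ := ∫ s in (-q)..q, φ s / ((s : ℂ) - x)

/-- The regular part of `∫_{-q}^{q} φ(s) / (s - x) ds` at the segment. -/
def segmentRegular (q : ℝ) (φ : ℂ → ℂ) (x : ℂ) : ℂ := ∫ s in (-q)..q, 1 * dslope φ (s : ℂ) x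

/-- The logarithm `log ((x - q) / (x + q))`, with its cut on `[-q, q]`. -/
def segmentLog (q : ℝ) (x : ℂ) : ℂ := log ((x - q) / (x + q))

theorem differentiableOn_segmentRegular {q : ℝ} (hq : 0 < q) {V : Set ℂ} (hV : IsOpen V)
    (hqV : ∀ s ∈ Icc (-q) q, (s : ℂ) ∈ V) {φ : ℂ → ℂ} (hφ : DifferentiableOn ℂ φ V) :
    DifferentiableOn ℂ (segmentRegular q φ) V :=
  differentiableOn_pathIntegral (f := fun x s => dslope φ s x) (γ := fun s => (s : ℂ))
    (κ := fun _ => 1) hV (by linarith)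
    (differentiableOn_dslope_uncurry hV hφ) (by fun_prop) (by fun_prop) hqV

theorem differentiableOn_segmentTransform {q : ℝ} (hq : 0 < q) {V S : Set ℂ} (hV : IsOpen V)
    (hS : ∀ s ∈ S, ∀ x ∈ V, s - x ≠ 0)
    (hqS : ∀ s ∈ Icc (-q) q, (s : ℂ) ∈ S) {φ : ℂ → ℂ} (hφ : DifferentiableOn ℂ φ S) :
    DifferentiableOn ℂ (segmentTransform q φ) V := by
  have h := differentiableOn_pathIntegral (f := fun x s => φ s * (s - x)⁻¹) (γ := fun s => (s : ℂ))
    (κ := fun _ => 1) (a := -q) (b := q) (V := S) hV (by linarith) ?_ (by fun_prop) (by fun_prop) hqS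
  · refine h.congr fun x _ => ?_
    simp only [segmentTransform, one_mul, div_eq_mul_inv]
  · refine (hφ.comp differentiableOn_snd fun p hp => hp.2).mul
      (DifferentiableOn.inv (by fun_prop) fun p hp => hS _ hp.2 _ hp.1)

/-- If the ratio is a real number `r ≤ 0`, then `x = (s + r q)/(1 - r)` is a convex combination of
`s` and `-q`, hence a point of the segment. -/
theorem segment_ratio_mem_slitPlane {q : ℝ} {x : ℂ} {s : ℝ} (hs : s ∈ Icc (-q) q)
    (hx : ∀ s ∈ Icc (-q) q, (s : ℂ) ≠ x) : (x - s) / (x + q) ∈ slitPlane := by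
  have hq : -q ≤ q := hs.1.trans hs.2
  have hq0 : x + q ≠ 0 := by
    intro h
    exact hx (-q) ⟨le_rfl, hq⟩ (by push_cast; linear_combination -h)
  rw [mem_slitPlane_iff_not_le_zero]
  intro hle
  rw [Complex.le_def] at hle
  obtain ⟨hre, him⟩ := hle
  set r := (x - s) / (x + q) with hr
  have hrr : r = ((r.re : ℝ) : ℂ) := by
    apply Complex.ext <;> simp
    simpa using him
  have hm : x - s = r * (x + q) := by rw [hr]; field_simp
  rw [hrr] at hm
  simp only [zero_re] at hre
  have h1 : (1 - r.re) ≠ 0 := by linarith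
  have h2 : x = ((s + r.re * q) / (1 - r.re) : ℝ) := by
    have h1' : (1 - (r.re : ℂ)) ≠ 0 := by exact_mod_cast h1
    push_cast
    rw [eq_div_iff h1']
    linear_combination hm
  refine hx _ ⟨?_, ?_⟩ h2.symm
  · rw [le_div_iff₀ (by linarith)]; nlinarith [hs.1]
  · rw [div_le_iff₀ (by linarith)]; nlinarith [hs.2]

/-- A primitive is `s ↦ log ((x - s)/(x + q))`, which never meets the cut of the logarithm and
vanishes at `s = -q`. -/
theorem integral_inv_sub_eq_segmentLog {q : ℝ} (hq : 0 < q) {x : ℂ}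
    (hx : ∀ s ∈ Icc (-q) q, (s : ℂ) ≠ x) :
    ∫ s in (-q)..q, ((s : ℂ) - x)⁻¹ = segmentLog q x := by
  have hq0 : x + q ≠ 0 := by
    intro h
    exact hx (-q) ⟨le_rfl, by linarith⟩ (by push_cast; linear_combination -h)
  have hd : ∀ s ∈ uIcc (-q) q, HasDerivAt (fun s : ℝ => log ((x - s) / (x + q)))
      ((s : ℂ) - x)⁻¹ s := by
    intro s hs
    rw [uIcc_of_le (by linarith)] at hs
    have h1 : HasDerivAt (fun s : ℝ => (x - s) / (x + q)) (-1 / (x + q)) s := by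
      have h2 : HasDerivAt (fun s : ℝ => (s : ℂ)) 1 s := (hasDerivAt_id s).ofReal_comp
      exact (h2.const_sub x).div_const _
    refine (h1.clog_real (segment_ratio_mem_slitPlane hs hx)).congr_deriv ?_
    have h3 : (s : ℂ) - x ≠ 0 := sub_ne_zero.2 (hx s hs)
    have h4 : x - (s : ℂ) ≠ 0 := sub_ne_zero.2 (hx s hs).symm
    field_simp
    ring
  rw [intervalIntegral.integral_eq_sub_of_hasDerivAt hd]
  · simp only [segmentLog]
    push_cast
    rw [sub_neg_eq_add, div_self hq0, log_one, sub_zero]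
  · refine ContinuousOn.intervalIntegrable (ContinuousOn.inv₀ (by fun_prop) fun s hs => ?_)
    rw [uIcc_of_le (by linarith)] at hs
    exact sub_ne_zero.2 (hx s hs)

/-- Subtracting `φ x` in the numerator isolates the singular part. Since its coefficient is the
value at `x`, exponentiation produces the power of `(x - q)/(x + q)` with exponent equal to the
phase. -/
theorem segmentTransform_eq {q : ℝ} (hq : 0 < q) {V : Set ℂ} (hV : IsOpen V)
    (hqV : ∀ s ∈ Icc (-q) q, (s : ℂ) ∈ V) {φ : ℂ → ℂ} (hφ : DifferentiableOn ℂ φ V) {x : ℂ}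
    (hxV : x ∈ V) (hx : ∀ s ∈ Icc (-q) q, (s : ℂ) ≠ x) :
    segmentTransform q φ x = φ x * segmentLog q x + segmentRegular q φ x := by
  have hqq : -q ≤ q := by linarith
  rw [← integral_inv_sub_eq_segmentLog hq hx, ← intervalIntegral.integral_const_mul,
    segmentRegular, ← intervalIntegral.integral_add, segmentTransform]
  · refine intervalIntegral.integral_congr fun s hs => ?_
    rw [uIcc_of_le hqq] at hs
    have h1 : (s : ℂ) - x ≠ 0 := sub_ne_zero.2 (hx s hs)
    have h2 : x - (s : ℂ) ≠ 0 := sub_ne_zero.2 (hx s hs).symm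
    rw [dslope_of_ne _ (hx s hs).symm, slope_def_field]
    field_simp
    ring
  · refine ContinuousOn.intervalIntegrable (continuousOn_const.mul
      (ContinuousOn.inv₀ (by fun_prop) fun s hs => ?_))
    rw [uIcc_of_le hqq] at hs
    exact sub_ne_zero.2 (hx s hs)
  · refine ContinuousOn.intervalIntegrable (continuousOn_const.mul ?_)
    rw [uIcc_of_le hqq]
    exact (differentiableOn_dslope_uncurry hV hφ).continuousOn.comp
      (f := fun s : ℝ => (x, (s : ℂ))) (by fun_prop) fun s hs => ⟨hxV, hqV s hs⟩

theorem exp_segmentLog {q : ℝ} {x : ℂ} (h1 : x - q ≠ 0) (h2 : x + q ≠ 0) :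
    exp (segmentLog q x) = (x - q) / (x + q) :=
  Complex.exp_log (div_ne_zero h1 h2)

theorem differentiableAt_segmentLog {q : ℝ} (hq : 0 < q) {x : ℂ}
    (hx : ∀ s ∈ Icc (-q) q, (s : ℂ) ≠ x) : DifferentiableAt ℂ (segmentLog q) x := by
  have hq0 : x + q ≠ 0 := by
    intro h
    exact hx (-q) ⟨le_rfl, by linarith⟩ (by push_cast; linear_combination -h)
  have h := segment_ratio_mem_slitPlane (s := q) ⟨by linarith, le_rfl⟩ hx
  unfold segmentLog
  exact DifferentiableAt.clog (DifferentiableAt.div (by fun_prop) (by fun_prop) hq0) h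

end Segment

/-! ### Geometry of the loop -/

section Geometry

/-- An open rectangle centred at `0`. -/
def box (a b : ℝ) : Set ℂ := {z | |z.re| < a ∧ |z.im| < b}

theorem isOpen_box (a b : ℝ) : IsOpen (box a b) :=
  (isOpen_lt continuous_re.abs continuous_const).inter
    (isOpen_lt continuous_im.abs continuous_const)

theorem convex_box (a b : ℝ) : Convex ℝ (box a b) := by
  have h : box a b = (Complex.reLm ⁻¹' Ioo (-a) a) ∩ (Complex.imLm ⁻¹' Ioo (-b) b) := by
    ext z
    simp [box, abs_lt]
  rw [h]
  exact ((convex_Ioo _ _).linear_preimage _).inter ((convex_Ioo _ _).linear_preimage _)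

theorem exists_bound_on_box {a b b' : ℝ} (hb : b < b') {φ : ℂ → ℂ}
    (hφ : ContinuousOn φ (strip b')) : ∃ M : ℝ, 0 ≤ M ∧ ∀ z ∈ box a b, ‖φ z‖ ≤ M := by
  have hc : IsCompact (Icc (-a) a ×ℂ Icc (-b) b) := isCompact_Icc.reProdIm isCompact_Icc
  obtain ⟨M, hM⟩ := hc.exists_bound_of_continuousOn (hφ.mono fun z hz => by
    rw [mem_reProdIm] at hz
    exact (abs_le.2 hz.2).trans_lt hb)
  refine ⟨max M 0, le_max_right _ _, fun z hz => (hM z ?_).trans (le_max_left _ _)⟩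
  rw [mem_reProdIm]
  exact ⟨abs_le.1 hz.1.le, abs_le.1 hz.2.le⟩

theorem exists_lower_bound_on_box {a b b' : ℝ} (hb : b < b') (ha0 : 0 ≤ a) (hb0 : 0 ≤ b) {φ : ℂ → ℂ}
    (hφ : ContinuousOn φ (strip b')) (hpos : ∀ z ∈ strip b', 0 < (φ z).re) :
    ∃ m : ℝ, 0 < m ∧ ∀ z ∈ box a b, m ≤ (φ z).re := by
  have hc : IsCompact (Icc (-a) a ×ℂ Icc (-b) b) := isCompact_Icc.reProdIm isCompact_Icc
  have hsub : Icc (-a) a ×ℂ Icc (-b) b ⊆ strip b' := fun z hz => by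
    rw [mem_reProdIm] at hz
    exact (abs_le.2 hz.2).trans_lt hb
  obtain ⟨x, hx, hmin⟩ := hc.exists_isMinOn ⟨0, by simp [mem_reProdIm, ha0, hb0]⟩
    (Complex.continuous_re.comp_continuousOn (hφ.mono hsub))
  refine ⟨(φ x).re, hpos x (hsub hx), fun z hz => hmin ?_⟩
  rw [mem_reProdIm]
  exact ⟨abs_le.1 hz.1.le, abs_le.1 hz.2.le⟩

theorem abs_le_of_ellipseForm_le {a b : ℝ} (ha : 0 < a) (hb : 0 < b) {z : ℂ}
    (h : ellipseForm a b z ≤ 1) : |z.re| ≤ a ∧ |z.im| ≤ b := by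
  unfold ellipseForm at h
  constructor
  · have : (z.re / a) ^ 2 ≤ 1 := by nlinarith [sq_nonneg (z.im / b)]
    rw [sq_le_one_iff_abs_le_one, abs_div, abs_of_pos ha, div_le_one ha] at this
    exact this
  · have : (z.im / b) ^ 2 ≤ 1 := by nlinarith [sq_nonneg (z.re / a)]
    rw [sq_le_one_iff_abs_le_one, abs_div, abs_of_pos hb, div_le_one hb] at this
    exact this

theorem ellipseForm_le_half {a b : ℝ} (ha : 0 < a) (hb : 0 < b) {z : ℂ}
    (h1 : |z.re| ≤ a / 2) (h2 : |z.im| ≤ b / 2) : ellipseForm a b z ≤ 1 / 2 := by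
  unfold ellipseForm
  have e1 : |z.re / a| ≤ 1 / 2 := by
    rw [abs_div, abs_of_pos ha, div_le_iff₀ ha]; linarith
  have e2 : |z.im / b| ≤ 1 / 2 := by
    rw [abs_div, abs_of_pos hb, div_le_iff₀ hb]; linarith
  have e3 := pow_le_pow_left₀ (abs_nonneg _) e1 2
  have e4 := pow_le_pow_left₀ (abs_nonneg _) e2 2
  rw [sq_abs] at e3 e4
  linarith

theorem closure_rect_subset (q δ ε : ℝ) :
    closure (rect q δ ε) ⊆ {z | |z.im| ≤ δ / 2 ∧ |z.re| ≤ q + ε} := by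
  refine closure_minimal (fun z hz => ⟨hz.1.le, hz.2.le⟩) ?_
  exact (isClosed_le continuous_im.abs continuous_const).inter
    (isClosed_le continuous_re.abs continuous_const)

theorem isOpen_rect (q δ ε : ℝ) : IsOpen (rect q δ ε) :=
  (isOpen_lt continuous_im.abs continuous_const).inter
    (isOpen_lt continuous_re.abs continuous_const)

theorem convex_rect (q δ ε : ℝ) : Convex ℝ (rect q δ ε) := by
  have h : rect q δ ε = box (q + ε) (δ / 2) := by
    ext z; exact and_comm
  rw [h]
  exact convex_box _ _

theorem isOpen_strip (δ : ℝ) : IsOpen (strip δ) :=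
  isOpen_lt continuous_im.abs continuous_const

theorem convex_strip (δ : ℝ) : Convex ℝ (strip δ) := by
  have h : strip δ = Complex.imLm ⁻¹' Ioo (-δ) δ := by
    ext z
    simp [strip, abs_lt]
  rw [h]
  exact (convex_Ioo _ _).linear_preimage _

end Geometry

/-! ### Moving poles -/

section MovingPoles

open Topology Metric Filter

/-- Two points of one family meet at a single time, as their velocities differ, so only finitely
many values of `|t|` are excluded. A positive gap remains at any other radius, and `ρ` is chosen so
that moving the starting points by less than `ρ` does not close it. -/
theorem exists_separating_radius {𝓚 : Type} [Finite 𝓚] {ι : 𝓚 → Type} [∀ k, Finite (ι k)]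
    (x₀ : ∀ k, ι k → ℂ) (v : ∀ k, ι k → ℂ) (hv : ∀ k, Function.Injective (v k))
    {r₁ : ℝ} (hr₁ : 0 < r₁) :
    ∃ r ρ : ℝ, 0 < r ∧ r < r₁ ∧ 0 < ρ ∧ ∃ T : Set ℂ, IsOpen T ∧ T ⊆ ball 0 r₁ ∧ sphere 0 r ⊆ T ∧
      ∀ t ∈ T, ∀ k i j, i ≠ j → ∀ x y : ℂ, ‖x - x₀ k i‖ < ρ → ‖y - x₀ k j‖ < ρ →
        x + t * v k i ≠ y + t * v k j := by
  let P := {p : Σ k, ι k × ι k // p.2.1 ≠ p.2.2}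
  let d : P → ℂ := fun p => x₀ p.1.1 p.1.2.1 - x₀ p.1.1 p.1.2.2
  let u : P → ℂ := fun p => v p.1.1 p.1.2.1 - v p.1.1 p.1.2.2
  have hu : ∀ p, 0 < ‖u p‖ := fun p =>
    norm_pos_iff.2 (sub_ne_zero.2 fun h => p.2 (hv _ h))
  have hinf : ((Ioo 0 r₁) \ range fun p => ‖d p‖ / ‖u p‖).Nonempty :=
    ((Ioo_infinite hr₁).sdiff (finite_range _)).nonempty
  -- The finitely many excluded radii are the quotients `‖d p‖ / ‖u p‖`.
  obtain ⟨r, ⟨hr0, hr1⟩, hr⟩ := hinf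
  have hgap : ∀ p, 0 < |‖d p‖ - r * ‖u p‖| := by
    intro p
    refine abs_pos.2 fun h => hr ⟨p, ?_⟩
    simp only
    rw [div_eq_iff (hu p).ne']
    linarith
  have hev : ∀ᶠ ρ in 𝓝[>] (0 : ℝ), ∀ p, 2 * ρ < |‖d p‖ - r * ‖u p‖| := by
    refine eventually_all.2 fun p => ?_
    have h : Tendsto (fun ρ : ℝ => 2 * ρ) (𝓝[>] 0) (𝓝 (2 * 0)) :=
      (Continuous.tendsto (by fun_prop) _).mono_left nhdsWithin_le_nhds
    exact h.eventually (gt_mem_nhds (by simpa using hgap p))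
  obtain ⟨ρ, hρ, hρ0⟩ := (hev.and self_mem_nhdsWithin).exists
  refine ⟨r, ρ, hr0, hr1, hρ0, ball 0 r₁ ∩ ⋂ p : P, {t | 2 * ρ < ‖d p + t * u p‖}, ?_,
    inter_subset_left, ?_, ?_⟩
  · exact isOpen_ball.inter (isOpen_iInter_of_finite fun p =>
      isOpen_lt continuous_const (by fun_prop))
  · intro t ht
    have ht' : ‖t‖ = r := by simpa using ht
    refine ⟨by simpa [ht'] using hr1, mem_iInter.2 fun p => (hρ p).trans_le ?_⟩
    have h := abs_norm_sub_norm_le (d p) (-(t * u p))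
    rwa [sub_neg_eq_add, norm_neg, norm_mul, ht'] at h
  · rintro t ⟨-, ht⟩ k i j hij x y hx hy hxy
    have h := mem_iInter.1 ht ⟨⟨k, i, j⟩, hij⟩
    simp only [mem_ofPred_eq, d, u] at h
    have h2 : x₀ k i - x₀ k j + t * (v k i - v k j) = (y - x₀ k j) - (x - x₀ k i) := by
      linear_combination hxy
    rw [h2] at h
    have h3 := norm_sub_le (y - x₀ k j) (x - x₀ k i)
    linarith

variable {E : Type} [NormedAddCommGroup E] [NormedSpace ℂ E] [FiniteDimensional ℂ E]
  {𝓚 : Type} [Fintype 𝓚] {ι : 𝓚 → Type} [∀ k, Fintype (ι k)] [∀ k, DecidableEq (ι k)]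

/-- The part of the weight that has poles at moving points. -/
def poleWeight (A F : E → ℂ → ℂ) (num : 𝓚 → ℂ → ℂ) (s : 𝓚 → ℂ) (base : ∀ k, ι k → E → ℂ)
    (v : ∀ k, ι k → ℂ) (p : ℂ × E) (x : ℂ) : ℂ :=
  ∑ k, -(2 * Real.pi * I)⁻¹ * (A p.2 x * num k x *
    ((∏ i, (x - (base k i p.2 + p.1 * v k i))) * (F p.2 x - s k))⁻¹)

/-- Two expressions are compared at time `t`: `P`, a product times a Fredholm determinant with moved
poles, holomorphic near `t = 0` but requiring that `F` avoid the integers; and `Y`, the expansion in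
atoms, which requires distinct poles but puts no condition on `F`. They agree on the circle `|t| =
r`, so integrating `Y` over the circle extends `P` at `t = 0` to all parameters. -/
theorem exists_moving_poles {a b M r r₁ : ℝ} (hb : 0 < b) (hab : b < a) {V Ω : Set ℂ}
    (hV : IsOpen V) (hs : StarConvex ℝ 0 V) (hΩV : Ω ⊆ V) (hΓ : ∀ t, ellipse a b t ∈ Ω)
    {C : Set ℂ} (hC : ∀ x ∈ C, ellipseForm a b x < 1) (hCV : C ⊆ V) (hCΩ : Disjoint C Ω)
    {K : ℂ → ℂ → ℂ} (hK : DifferentiableOn ℂ (fun p : ℂ × ℂ => K p.1 p.2) (V ×ˢ V))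
    (hKM : ∀ x ∈ V, ∀ y ∈ V, ‖K x y‖ ≤ M) {W : Set E} (hW : IsOpen W)
    {w A F : E → ℂ → ℂ} (hw : DifferentiableOn ℂ (fun p : E × ℂ => w p.1 p.2) (W ×ˢ Ω))
    (hA : DifferentiableOn ℂ (fun p : E × ℂ => A p.1 p.2) (W ×ˢ V))
    (hF : DifferentiableOn ℂ (fun p : E × ℂ => F p.1 p.2) (W ×ˢ V))
    {num : 𝓚 → ℂ → ℂ} (hnum : ∀ k, Differentiable ℂ (num k)) {s : 𝓚 → ℂ}
    {base : ∀ k, ι k → E → ℂ} (hbase : ∀ k i, DifferentiableOn ℂ (base k i) W)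
    {v : ∀ k, ι k → ℂ} (hr : 0 < r) (hr₁ : r < r₁) {T : Set ℂ} (hT : IsOpen T)
    (hTr : T ⊆ ball 0 r₁) (hrT : sphere 0 r ⊆ T)
    (hroot : ∀ t ∈ ball (0 : ℂ) r₁, ∀ z ∈ W, ∀ k i, base k i z + t * v k i ∈ C)
    (hsep : ∀ t ∈ T, ∀ z ∈ W, ∀ k, Function.Injective fun i => base k i z + t * v k i) :
    ∃ φ : E → ℂ, DifferentiableOn ℂ φ W ∧ ∀ z ∈ W, (∀ x ∈ V, ∀ k, F z x ≠ s k) →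
      φ z = (∏ k, ∏ i, (F z (base k i z) - s k)) *
        fredDet K (ellipse a b) (fun t => ellipseDeriv a b t * (w z (ellipse a b t) +
          poleWeight A F num s base v (0, z) (ellipse a b t))) [] (Fin.elim0 : Fin 0 → ℂ) := by
  classical
  have ha : 0 < a := hb.trans hab
  set Γ := ellipse a b with hΓdef
  set Γ' := ellipseDeriv a b with hΓ'
  have hΓc : Continuous Γ := continuous_ellipse a b
  have hΓ'c : Continuous Γ' := continuous_ellipseDeriv a b
  have hΓV : ∀ t, Γ t ∈ V := fun t => hΩV (hΓ t)
  let root : (Σ k, ι k) → ℂ × E → ℂ := fun r p => base r.1 r.2 p.2 + p.1 * v r.1 r.2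
  let f : (Σ k, ι k) → ℂ × E → ℂ := fun r p => F p.2 (root r p) - s r.1
  -- The residue at a root with the factor `1 / f` removed. The sign comes from the `-(2iπ)⁻¹` in
  -- `poleWeight`.
  let m : (Σ k, ι k) → ℂ × E → ℂ := fun r p => -(A p.2 (root r p) * num r.1 (root r p) *
    (∏ j ∈ Finset.univ.erase r.2, (root r p - root ⟨r.1, j⟩ p))⁻¹)
  have hroot' : ∀ r, DifferentiableOn ℂ (root r) (ball 0 r₁ ×ˢ W) := fun r =>
    ((hbase r.1 r.2).comp differentiableOn_snd fun p hp => hp.2).add (by fun_prop)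
  have hrootV : ∀ r, ∀ p ∈ ball (0 : ℂ) r₁ ×ˢ W, root r p ∈ V := fun r p hp =>
    hCV (hroot p.1 hp.1 p.2 hp.2 _ _)
  have hf : ∀ r, DifferentiableOn ℂ (f r) (ball 0 r₁ ×ˢ W) := fun r =>
    (hF.comp (f := fun p : ℂ × E => (p.2, root r p)) (differentiableOn_snd.prodMk (hroot' r))
      fun p hp => ⟨hp.2, hrootV r p hp⟩).sub_const _
  have hTW : T ×ˢ W ⊆ ball (0 : ℂ) r₁ ×ˢ W := prod_mono hTr subset_rfl
  have hm : ∀ r, DifferentiableOn ℂ (m r) (T ×ˢ W) := by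
    intro r
    refine ((((hA.comp (f := fun p : ℂ × E => (p.2, root r p)) (differentiableOn_snd.prodMk (hroot' r))
      fun p hp => ⟨hp.2, hrootV r p hp⟩).mono hTW).mul
      ((hnum r.1).comp_differentiableOn ((hroot' r).mono hTW))).mul
      (DifferentiableOn.inv (differentiableOn_finsetProd fun j _ =>
        ((hroot' r).mono hTW).sub ((hroot' ⟨r.1, j⟩).mono hTW)) fun p hp => ?_)).neg
    exact Finset.prod_ne_zero_iff.2 fun j hj => sub_ne_zero.2 fun h =>
      (Finset.ne_of_mem_erase hj) (hsep p.1 hp.1 p.2 hp.2 r.1 h).symm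
  let l : List (ℂ × E → ℂ × ℂ × ℂ) :=
    (Finset.univ : Finset (Σ k, ι k)).toList.map fun r p => (f r p, m r p, root r p)
  let Y : ℂ × E → ℂ := fun p =>
    fredExp K Γ (fun t => Γ' t * w p.2 (Γ t)) (l.map fun y => y p) (Fin.elim0 : Fin 0 → ℂ)
  have hY : DifferentiableOn ℂ Y (T ×ˢ W) := by
    have h := differentiableOn_fredExp (ρ := fun (p : ℂ × E) x => w p.2 x) (hT.prod hW) hV hΩV hK hKM
      hΓc hΓ hΓ'c (hw.comp (f := fun p : (ℂ × E) × ℂ => (p.1.2, p.2)) (by fun_prop)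
        fun p hp => ⟨hp.1.2, hp.2⟩) l (by
      intro y hy
      obtain ⟨r, -, rfl⟩ := List.mem_map.1 hy
      exact ⟨((hf r).mono hTW).prodMk ((hm r).prodMk ((hroot' r).mono hTW)),
        fun p hp => hrootV r p (hTW hp)⟩) 0
    exact h.comp (f := fun p : ℂ × E => (p, (Fin.elim0 : Fin 0 → ℂ))) (by fun_prop)
      fun p hp => ⟨hp, fun i => i.elim0⟩
  -- The mean of `Y` over the circle only involves times in `T`, where the roots are distinct.
  refine ⟨fun z => (2 * Real.pi * I)⁻¹ * ∮ t in C(0, r), (t - 0)⁻¹ • Y (t, z), ?_, ?_⟩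
  · refine DifferentiableOn.const_mul ?_ _
    have h := differentiableOn_pathIntegral (a := 0) (b := 2 * Real.pi) hW (V := T)
      (γ := circleMap 0 r) (κ := fun θ => deriv (circleMap 0 r) θ * (circleMap 0 r θ - 0)⁻¹)
      (f := fun z t => Y (t, z)) Real.two_pi_pos.le
      (hY.comp (f := fun p : E × ℂ => (p.2, p.1)) (by fun_prop) fun p hp => ⟨hp.2, hp.1⟩)
      (continuous_circleMap _ _).continuousOn ?_ ?_
    · simp only [mul_assoc] at h
      exact h
    · refine ContinuousOn.mul ?_ (ContinuousOn.inv₀ (by fun_prop) fun θ _ => ?_)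
      · simp only [funext (deriv_circleMap _ _)]
        fun_prop
      · rw [sub_zero]
        exact circleMap_ne_center hr.ne'
    · exact fun θ _ => hrT (circleMap_mem_sphere 0 hr.le θ)
  · intro z hz hzF
    let w₁ : ℂ → ℂ → ℂ := fun t x => w z x + poleWeight A F num s base v (t, z) x
    let P : ℂ → ℂ := fun t => (∏ r, f r (t, z)) *
      fredDet K Γ (fun u => Γ' u * w₁ t (Γ u)) [] (Fin.elim0 : Fin 0 → ℂ)
    have hslice : ∀ {S : Set ℂ}, DifferentiableOn ℂ (fun t : ℂ => (t, z)) S := by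
      intro S; fun_prop
    have hpole : DifferentiableOn ℂ
        (fun p : ℂ × ℂ => poleWeight A F num s base v (p.1, z) p.2) (ball 0 r₁ ×ˢ Ω) := by
      unfold poleWeight
      refine DifferentiableOn.fun_sum fun k _ => DifferentiableOn.const_mul ?_ _
      refine ((hA.comp (f := fun p : ℂ × ℂ => (z, p.2)) (by fun_prop)
        fun p hp => ⟨hz, hΩV hp.2⟩).mul ((hnum k).comp_differentiableOn (by fun_prop))).mul
        (DifferentiableOn.inv ((differentiableOn_finsetProd fun i _ => by
          simp only; fun_prop).mul
          ((hF.comp (f := fun p : ℂ × ℂ => (z, p.2)) (by fun_prop)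
            fun p hp => ⟨hz, hΩV hp.2⟩).sub_const _)) fun p hp => ?_)
      refine mul_ne_zero (Finset.prod_ne_zero_iff.2 fun i _ => sub_ne_zero.2 fun h => ?_)
        (sub_ne_zero.2 (hzF _ (hΩV hp.2) k))
      exact hCΩ.le_bot ⟨hroot p.1 hp.1 z hz k i, h ▸ hp.2⟩
    have hw₁ : DifferentiableOn ℂ (fun p : ℂ × ℂ => w₁ p.1 p.2) (ball 0 r₁ ×ˢ Ω) :=
      (hw.comp (f := fun p : ℂ × ℂ => (z, p.2)) (by fun_prop) fun p hp => ⟨hz, hp.2⟩).add hpole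
    have hP : DifferentiableOn ℂ P (ball 0 r₁) := by
      refine DifferentiableOn.mul (differentiableOn_finsetProd fun r _ =>
        (hf r).comp (f := fun t => (t, z)) hslice fun t ht => ⟨ht, hz⟩) ?_
      have h := differentiableOn_fredDet (L := []) isOpen_ball hV hΩV hK hKM hΓc hΓ hΓ'c hw₁
        (by simp) 0
      exact h.comp (f := fun t : ℂ => (t, (Fin.elim0 : Fin 0 → ℂ))) (by fun_prop)
        fun t ht => ⟨ht, fun i => i.elim0⟩
    have hYP : ∀ t ∈ sphere (0 : ℂ) r, Y (t, z) = P t := by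
      intro t ht
      have htT := hrT ht
      have htz : (t, z) ∈ ball (0 : ℂ) r₁ ×ˢ W := ⟨hTr htT, hz⟩
      have hwc : Continuous fun u => Γ' u * w z (Γ u) := hΓ'c.mul
        (hw.continuousOn.comp_continuous (f := fun u => (z, Γ u)) (by fun_prop)
          fun u => ⟨hz, hΓ u⟩)
      have hfne : ∀ r, f r (t, z) ≠ 0 := fun r => sub_ne_zero.2 (hzF _ (hrootV r _ htz) _)
      simp only [Y, P]
      rw [fredExp_eq hV hK hKM hΓc hΓV hwc _ ?_ (fun i => i.elim0)]
      · simp only [l, List.map_map, Function.comp_def]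
        rw [Finset.prod_map_toList]
        congr 1
        unfold fredDet
        congr 1
        funext n
        rw [fredIter_eq_of_functional_eq (w := fun u => Γ' u * w z (Γ u)) (L :=
          (Finset.univ : Finset (Σ k, ι k)).toList.map fun r =>
            (m r (t, z) / f r (t, z), root r (t, z))) hV hK hΓc hΓV hwc ?_ ?_ n
            (fun i => i.elim0)]
        · intro cx hcx
          obtain ⟨r, -, rfl⟩ := List.mem_map.1 hcx
          exact hrootV r _ htz
        · intro ψ hψ
          -- As `F` avoids `s k` on `V`, the factor `(F - s k)⁻¹` counts as holomorphic, and the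
          -- roots are the only poles inside the loop.
          let G : 𝓚 → ℂ → ℂ := fun k x => A z x * num k x * (F z x - s k)⁻¹ * ψ x
          have hG : ∀ k, DifferentiableOn ℂ (G k) V := fun k =>
            (((hA.comp (f := fun x : ℂ => (z, x)) (by fun_prop) fun x hx => ⟨hz, hx⟩).mul
              (hnum k).differentiableOn).mul (DifferentiableOn.inv
                ((hF.comp (f := fun x : ℂ => (z, x)) (by fun_prop)
                  fun x hx => ⟨hz, hx⟩).sub_const _)
                fun x hx => sub_ne_zero.2 (hzF x hx k))).mul hψ
          have hres := fun k => residue_ellipse hb hab hV hs hΓV (hG k)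
            (x := fun i => root ⟨k, i⟩ (t, z)) (hsep t htT z hz k)
            (fun i => hrootV ⟨k, i⟩ _ htz) (fun i => hC _ (hroot t htz.1 z hz k i))
          have hψc : Continuous fun u => ψ (Γ u) := hψ.continuousOn.comp_continuous hΓc hΓV
          have hne : ∀ k u, ∏ i, (Γ u - root ⟨k, i⟩ (t, z)) ≠ 0 := fun k u =>
            Finset.prod_ne_zero_iff.2 fun i _ => sub_ne_zero.2 fun h =>
              hCΩ.le_bot ⟨hroot t htz.1 z hz k i, (show Γ u = base k i z + t * v k i from h) ▸ hΓ u⟩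
          have hint : ∀ k, IntervalIntegrable (fun u => -(2 * Real.pi * I)⁻¹ *
              (G k (Γ u) / (∏ i, (Γ u - root ⟨k, i⟩ (t, z))) * Γ' u)) volume 0 1 := fun k =>
            Continuous.intervalIntegrable (continuous_const.mul
              ((((hG k).continuousOn.comp_continuous hΓc hΓV).div
                (continuous_finsetProd _ fun i _ => hΓc.sub continuous_const) (hne k)).mul
                hΓ'c)) _ _
          have e1 : ∀ u, Γ' u * w₁ t (Γ u) * ψ (Γ u) = Γ' u * w z (Γ u) * ψ (Γ u) +
              ∑ k, -(2 * Real.pi * I)⁻¹ *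
                (G k (Γ u) / (∏ i, (Γ u - root ⟨k, i⟩ (t, z))) * Γ' u) := by
            intro u
            simp only [w₁, poleWeight, mul_add, add_mul, Finset.mul_sum, Finset.sum_mul]
            congr 1
            refine Finset.sum_congr rfl fun k _ => ?_
            simp only [G, root, mul_inv, div_eq_mul_inv]
            ring
          simp only [e1]
          have hint' : IntervalIntegrable (fun u => ∑ k, -(2 * Real.pi * I)⁻¹ *
              (G k (Γ u) / (∏ i, (Γ u - root ⟨k, i⟩ (t, z))) * Γ' u)) volume 0 1 := by
            simpa only [Finset.sum_fn] using IntervalIntegrable.sum Finset.univ fun k _ => hint k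
          have hint₀ : IntervalIntegrable (fun u => Γ' u * w z (Γ u) * ψ (Γ u)) volume 0 1 :=
            (hwc.mul hψc).intervalIntegrable _ _
          rw [intervalIntegral.integral_add hint₀ hint',
            intervalIntegral.integral_finsetSum fun k _ => hint k]
          congr 1
          rw [List.map_map, Finset.sum_map_toList, Fintype.sum_sigma]
          refine Finset.sum_congr rfl fun k _ => ?_
          rw [intervalIntegral.integral_const_mul, hres k, ← mul_assoc, neg_mul,
            inv_mul_cancel₀ (by simp [Real.pi_ne_zero]), neg_one_mul, ← Finset.sum_neg_distrib]
          refine Finset.sum_congr rfl fun i _ => ?_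
          simp only [Function.comp_apply, G, m, f, div_eq_mul_inv]
          ring
      · intro y hy
        simp only [l, List.map_map, List.mem_map, Function.comp_def] at hy
        obtain ⟨r, -, rfl⟩ := hy
        exact ⟨hfne r, hrootV r _ htz⟩
    have hcl : closedBall (0 : ℂ) r ⊆ ball 0 r₁ := closedBall_subset_ball hr₁
    have hcauchy := (hP.mono hcl).circleIntegral_sub_inv_smul (mem_ball_self hr)
    have h2 : (∮ t in C(0, r), (t - 0)⁻¹ • Y (t, z)) = ∮ t in C(0, r), (t - 0)⁻¹ • P t :=
      circleIntegral.integral_congr hr.le fun t ht => by simp only [hYP t ht]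
    simp only
    rw [h2, hcauchy, smul_eq_mul, inv_mul_cancel_left₀ (by simp [Real.pi_ne_zero])]
    simp only [P, f, root, w₁, zero_mul, add_zero]
    rw [← Fintype.prod_sigma']

end MovingPoles

/-! ### The weight of the integral kernel -/

section Weight

open Topology Metric Filter

/-- The standing assumptions on the widths of the domains and on the functions `ν` and `h`. -/
structure Admissible (c q δ ε : ℝ) (ν h : ℂ → ℂ) : Prop where
  c_pos : 0 < c
  q_pos : 0 < q
  δ_pos : 0 < δ
  ε_pos : 0 < ε
  δ_le : δ ≤ c / 8
  δ_le_q : δ ≤ q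
  diff_ν : DifferentiableOn ℂ ν (strip (2 * δ))
  diff_h : DifferentiableOn ℂ h (strip (2 * δ))

/-- A bounded convex neighbourhood of the elliptic loop and of its inside. -/
def nearBox (q δ ε : ℝ) : Set ℂ := box (2 * (q + ε) + 1) (3 * δ / 2)

/-- The part of `nearBox` inside the loop and away from it. -/
def core (q δ ε : ℝ) : Set ℂ := {x | ellipseForm (2 * (q + ε)) δ x < 3 / 4}

/-- A neighbourhood of the loop in `nearBox`. -/
def collar (q δ ε : ℝ) : Set ℂ := nearBox q δ ε ∩ {x | 3 / 4 < ellipseForm (2 * (q + ε)) δ x}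

/-- The exponent `γ ν_β(x)`. -/
def phase (ν h : ℂ → ℂ) {n : ℕ} (z : Params n) (x : ℂ) : ℂ :=
  z.2.2.2 * nuBeta ν h z.2.2.1 x

/-- The factor of the weight which is holomorphic inside the loop. -/
def amplitude (c q : ℝ) (ν h : ℂ → ℂ) {n : ℕ} (z : Params n) (x : ℂ) : ℂ :=
  (-1 / (2 * Real.pi)) * (x - q + I * c)⁻¹ *
    (∏ a, (x - z.1 a) * (x - z.2.1 a + I * c) * (x - z.1 a + I * c)⁻¹) *
    exp (z.2.2.2 * ((segmentRegular q ν x + I * z.2.2.1 * segmentRegular q h x) -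
      (segmentTransform q ν (x + I * c) + I * z.2.2.1 * segmentTransform q h (x + I * c))))

/-- The numerator of the kernel, without the factor `lieb`. -/
def weightNum (c q : ℝ) (ν h : ℂ → ℂ) {n : ℕ} (z : Params n) (x : ℂ) : ℂ :=
  amplitude c q ν h z x * ((x - q) * ∏ a, (x - z.2.1 a)⁻¹) *
    exp (phase ν h z x * segmentLog q x)

/-- The kernel without the factor `lieb`. -/
def weight (c q : ℝ) (ν h : ℂ → ℂ) {n : ℕ} (z : Params n) (x : ℂ) : ℂ :=
  weightNum c q ν h z x * (nuBeta ν h z.2.2.1 x * dslope expSubOne 0 (phase ν h z x))⁻¹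

/-- The open set of parameters with `μ_p` in the strip and `μ_h` in the rectangle. -/
def rootDomain (q δ ε : ℝ) (n : ℕ) : Set (Params n) :=
  (univ.pi fun _ => strip δ) ×ˢ (univ.pi fun _ => rect q δ ε) ×ˢ univ ×ˢ univ

theorem isOpen_nearBox (q δ ε : ℝ) : IsOpen (nearBox q δ ε) := isOpen_box _ _

theorem collar_subset (q δ ε : ℝ) : collar q δ ε ⊆ nearBox q δ ε := inter_subset_left

theorem disjoint_core_collar (q δ ε : ℝ) : Disjoint (core q δ ε) (collar q δ ε) :=
  disjoint_left.2 fun x h h' =>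
    lt_asymm (show ellipseForm (2 * (q + ε)) δ x < 3 / 4 from h) h'.2

theorem differentiable_dslope_expSubOne : Differentiable ℂ (dslope expSubOne 0) := by
  rw [← differentiableOn_univ, Complex.differentiableOn_dslope univ_mem]
  exact differentiable_expSubOne.differentiableOn

theorem mul_dslope_expSubOne (u : ℂ) : u * dslope expSubOne 0 u = expSubOne u := by
  have h := sub_smul_dslope expSubOne 0 u
  have h0 : expSubOne 0 = 0 := expSubOne_eq_zero_iff.2 ⟨0, by simp⟩
  rwa [sub_zero, h0, sub_zero, smul_eq_mul] at h

/-- The phase is `γ ν_β`, so dividing by `ν_β` times the difference quotient of `e^{-2iπu} - 1` has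
already cancelled the factor `γ`. The definition of `weight` thus includes the limit at `γ = 0`. -/
theorem weight_eq {c q : ℝ} {ν h : ℂ → ℂ} {n : ℕ} {z : Params n} (hz : z.2.2.2 ≠ 0) (x : ℂ) :
    weight c q ν h z x = z.2.2.2 * weightNum c q ν h z x / expSubOne (phase ν h z x) := by
  rw [weight, ← mul_dslope_expSubOne (phase ν h z x), phase, mul_assoc, mul_div_mul_left _ _ hz,
    div_eq_mul_inv]

theorem dslope_expSubOne_zero : dslope expSubOne 0 0 = -2 * I * Real.pi := by
  rw [dslope_same]
  simpa using (hasDerivAt_expSubOne_int 0).deriv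

theorem convex_nearBox (q δ ε : ℝ) : Convex ℝ (nearBox q δ ε) := convex_box _ _

/-- The poles of `lieb` are `±ic`, and the strip keeps a distance at least `c/2` from each of them.
-/
theorem norm_lieb_le {c : ℝ} (hc : 0 < c) {x : ℂ} (hx : |x.im| ≤ c / 2) :
    x ^ 2 + (c : ℂ) ^ 2 ≠ 0 ∧ ‖lieb c x‖ ≤ 8 / c := by
  have hfac : x ^ 2 + (c : ℂ) ^ 2 = (x + I * c) * (x - I * c) := by
    linear_combination (c : ℂ) ^ 2 * I_sq
  obtain ⟨h1, h2⟩ := abs_le.1 hx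
  have n1 : c / 2 ≤ ‖x + I * c‖ := by
    refine le_trans ?_ (abs_im_le_norm _)
    refine le_trans ?_ (le_abs_self _)
    simp; linarith
  have n2 : c / 2 ≤ ‖x - I * c‖ := by
    refine le_trans ?_ (abs_im_le_norm _)
    refine le_trans ?_ (neg_le_abs _)
    simp; linarith
  have n3 : c / 2 * (c / 2) ≤ ‖x ^ 2 + (c : ℂ) ^ 2‖ := by
    rw [hfac, norm_mul]
    gcongr
  have n4 : 0 < ‖x ^ 2 + (c : ℂ) ^ 2‖ := lt_of_lt_of_le (by positivity) n3
  refine ⟨norm_pos_iff.1 n4, ?_⟩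
  rw [lieb, norm_div, div_le_div_iff₀ n4 hc]
  have : ‖(2 * c : ℂ)‖ = 2 * c := by
    rw [norm_mul, Complex.norm_real, Real.norm_of_nonneg hc.le]; simp
  rw [this]
  nlinarith

namespace Admissible

theorem nearBox_subset {c q δ ε : ℝ} {ν h : ℂ → ℂ} (H : Admissible c q δ ε ν h)
    : nearBox q δ ε ⊆ strip (2 * δ) := by
  exact fun x hx => hx.2.trans (by linarith [H.δ_pos])

theorem zero_mem_nearBox {c q δ ε : ℝ} {ν h : ℂ → ℂ} (H : Admissible c q δ ε ν h)
    : (0 : ℂ) ∈ nearBox q δ ε := by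
  have := H.q_pos; have := H.δ_pos; have := H.ε_pos
  constructor <;> simp <;> linarith

theorem axis_pos {c q δ ε : ℝ} {ν h : ℂ → ℂ} (H : Admissible c q δ ε ν h)
    : 0 < 2 * (q + ε) := by
  linarith [H.q_pos, H.ε_pos]

theorem axis_lt {c q δ ε : ℝ} {ν h : ℂ → ℂ} (H : Admissible c q δ ε ν h)
    : δ < 2 * (q + ε) := by
  linarith [H.q_pos, H.ε_pos, H.δ_le_q]

theorem mem_nearBox_of_form_le {c q δ ε : ℝ} {ν h : ℂ → ℂ} (H : Admissible c q δ ε ν h)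
    {x : ℂ} (hx : ellipseForm (2 * (q + ε)) δ x ≤ 1) : x ∈ nearBox q δ ε := by
  obtain ⟨h1, h2⟩ := abs_le_of_ellipseForm_le H.axis_pos H.δ_pos hx
  exact ⟨by linarith, by linarith [H.δ_pos]⟩

theorem core_subset {c q δ ε : ℝ} {ν h : ℂ → ℂ} (H : Admissible c q δ ε ν h)
    : core q δ ε ⊆ nearBox q δ ε := by
  intro x hx
  have hx' : ellipseForm (2 * (q + ε)) δ x < 3 / 4 := hx
  exact H.mem_nearBox_of_form_le (by linarith)

theorem ellipse_mem_collar {c q δ ε : ℝ} {ν h : ℂ → ℂ} (H : Admissible c q δ ε ν h)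
    (t : ℝ) : ellipse (2 * (q + ε)) δ t ∈ collar q δ ε := by
  have h := ellipseForm_ellipse H.axis_pos H.δ_pos t
  refine ⟨H.mem_nearBox_of_form_le h.le, ?_⟩
  show 3 / 4 < ellipseForm _ _ _
  rw [h]; norm_num

theorem ofReal_mem_rect {c q δ ε : ℝ} {ν h : ℂ → ℂ} (H : Admissible c q δ ε ν h)
    {s : ℝ} (hs : s ∈ Icc (-q) q) : (s : ℂ) ∈ rect q δ ε := by
  constructor
  · simpa using H.δ_pos
  · rw [ofReal_re]
    exact (abs_le.2 hs).trans_lt (by linarith [H.ε_pos])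

/-- The rectangle reaches at most half of each semi-axis, the displacement adds at most a tenth, and
`2 · (3/5)² < 3/4`. This is the room in which the poles may move. -/
theorem add_mem_core {c q δ ε : ℝ} {ν h : ℂ → ℂ} (H : Admissible c q δ ε ν h)
    {x w : ℂ} (hx : x ∈ rect q δ ε) (hw : ‖w‖ ≤ δ / 10) : x + w ∈ core q δ ε := by
  have ha := H.axis_pos
  have hb := H.δ_pos
  have h1 : |(x + w).re| ≤ 3 / 5 * (2 * (q + ε)) := by
    rw [add_re]
    linarith [abs_add_le x.re w.re, hx.2, abs_re_le_norm w, H.axis_lt]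
  have h2 : |(x + w).im| ≤ 3 / 5 * δ := by
    rw [add_im]
    linarith [abs_add_le x.im w.im, hx.1, abs_im_le_norm w]
  show ellipseForm _ _ _ < 3 / 4
  unfold ellipseForm
  have e1 : |(x + w).re / (2 * (q + ε))| ≤ 3 / 5 := by
    rwa [abs_div, abs_of_pos ha, div_le_iff₀ ha]
  have e2 : |(x + w).im / δ| ≤ 3 / 5 := by
    rwa [abs_div, abs_of_pos hb, div_le_iff₀ hb]
  have e3 := pow_le_pow_left₀ (abs_nonneg _) e1 2
  have e4 := pow_le_pow_left₀ (abs_nonneg _) e2 2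
  rw [sq_abs] at e3 e4
  linarith

theorem rect_subset_core {c q δ ε : ℝ} {ν h : ℂ → ℂ} (H : Admissible c q δ ε ν h)
    : rect q δ ε ⊆ core q δ ε := by
  intro x hx
  simpa using H.add_mem_core hx (w := 0) (by rw [norm_zero]; linarith [H.δ_pos])

theorem sub_ne_zero {c q δ ε : ℝ} {ν h : ℂ → ℂ} (H : Admissible c q δ ε ν h)
    {x y : ℂ} (hx : x ∈ collar q δ ε) (hy : y ∈ rect q δ ε) : x - y ≠ 0 := by
  intro h
  rw [_root_.sub_eq_zero] at h
  exact (disjoint_core_collar q δ ε).le_bot ⟨H.rect_subset_core hy, h ▸ hx⟩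

theorem segment_ne {c q δ ε : ℝ} {ν h : ℂ → ℂ} (H : Admissible c q δ ε ν h)
    {x : ℂ} (hx : x ∈ collar q δ ε) : ∀ s ∈ Icc (-q) q, (s : ℂ) ≠ x := by
  intro s hs h
  exact H.sub_ne_zero hx (H.ofReal_mem_rect hs) (by rw [h, sub_self])

theorem add_ne_zero {c q δ ε : ℝ} {ν h : ℂ → ℂ} (H : Admissible c q δ ε ν h)
    {x y : ℂ} (hx : x ∈ nearBox q δ ε) (hy : |y.im| < δ) : x - y + I * c ≠ 0 := by
  intro h
  have h0 := congrArg Complex.im h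
  simp at h0
  have h1 := abs_lt.1 hx.2
  have h2 := abs_lt.1 hy
  linarith [H.δ_le, H.c_pos, H.δ_pos]

theorem abs_im_sub_le {c q δ ε : ℝ} {ν h : ℂ → ℂ} (H : Admissible c q δ ε ν h)
    {x y : ℂ} (hx : x ∈ nearBox q δ ε) (hy : y ∈ nearBox q δ ε) :
    |(x - y).im| ≤ c / 2 := by
  rw [sub_im, abs_le]
  have h1 := abs_lt.1 hx.2
  have h2 := abs_lt.1 hy.2
  constructor <;> linarith [H.δ_le, H.c_pos, H.δ_pos]

theorem differentiableOn_lieb {c q δ ε : ℝ} {ν h : ℂ → ℂ} (H : Admissible c q δ ε ν h)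
    : DifferentiableOn ℂ (fun p : ℂ × ℂ => lieb c (p.1 - p.2))
    (nearBox q δ ε ×ˢ nearBox q δ ε) := by
  unfold lieb
  simp_rw [div_eq_mul_inv]
  refine DifferentiableOn.mul (by fun_prop) (DifferentiableOn.inv (by fun_prop) fun p hp => ?_)
  exact (norm_lieb_le H.c_pos (H.abs_im_sub_le hp.1 hp.2)).1

theorem norm_lieb_sub_le {c q δ ε : ℝ} {ν h : ℂ → ℂ} (H : Admissible c q δ ε ν h)
    {x y : ℂ} (hx : x ∈ nearBox q δ ε) (hy : y ∈ nearBox q δ ε) :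
    ‖lieb c (x - y)‖ ≤ 8 / c := by
  exact (norm_lieb_le H.c_pos (H.abs_im_sub_le hx hy)).2

theorem ofReal_mem_nearBox {c q δ ε : ℝ} {ν h : ℂ → ℂ} (H : Admissible c q δ ε ν h)
    {s : ℝ} (hs : s ∈ Icc (-q) q) : (s : ℂ) ∈ nearBox q δ ε := by
  exact H.core_subset (H.rect_subset_core (H.ofReal_mem_rect hs))

theorem differentiableOn_phase {c q δ ε : ℝ} {ν h : ℂ → ℂ} (H : Admissible c q δ ε ν h)
    {n : ℕ} : DifferentiableOn ℂ (fun p : Params n × ℂ => phase ν h p.1 p.2)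
    (univ ×ˢ nearBox q δ ε) := by
  unfold phase nuBeta
  have h1 := H.diff_ν.comp (f := fun p : Params n × ℂ => p.2) (s := univ ×ˢ nearBox q δ ε)
    (by fun_prop) fun p hp => H.nearBox_subset hp.2
  have h2 := H.diff_h.comp (f := fun p : Params n × ℂ => p.2) (s := univ ×ˢ nearBox q δ ε)
    (by fun_prop) fun p hp => H.nearBox_subset hp.2
  exact DifferentiableOn.mul (by fun_prop) (h1.add (DifferentiableOn.mul (by fun_prop) h2))

theorem differentiableOn_shiftedTransform {c q δ ε : ℝ} {ν h : ℂ → ℂ} (H : Admissible c q δ ε ν h)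
    {φ : ℂ → ℂ} (hφ : DifferentiableOn ℂ φ (strip (2 * δ))) :
    DifferentiableOn ℂ (fun x => segmentTransform q φ (x + I * c)) (nearBox q δ ε) := by
  have h1 := differentiableOn_segmentTransform (V := {x | c / 2 < x.im}) (S := strip (2 * δ))
    H.q_pos (isOpen_lt continuous_const continuous_im) ?_ ?_ hφ
  · refine h1.comp (by fun_prop) fun x hx => ?_
    show c / 2 < (x + I * c).im
    have := abs_lt.1 hx.2
    simp
    linarith [H.δ_le, H.c_pos, H.δ_pos]
  · intro s hs x hx h
    have h1 : |s.im| < 2 * δ := hs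
    have h2 : c / 2 < x.im := hx
    rw [_root_.sub_eq_zero.1 h, abs_lt] at h1
    linarith [H.δ_le, H.c_pos, H.δ_pos]
  · intro s hs
    exact H.nearBox_subset (H.ofReal_mem_nearBox hs)

theorem differentiableOn_amplitude {c q δ ε : ℝ} {ν h : ℂ → ℂ} (H : Admissible c q δ ε ν h)
    {n : ℕ} :
    DifferentiableOn ℂ (fun p : Params n × ℂ => amplitude c q ν h p.1 p.2)
      (rootDomain q δ ε n ×ˢ nearBox q δ ε) := by
  unfold amplitude
  have hseg : ∀ s ∈ Icc (-q) q, (s : ℂ) ∈ nearBox q δ ε := fun s hs => H.ofReal_mem_nearBox hs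
  have hc : ∀ {φ : ℂ → ℂ}, DifferentiableOn ℂ φ (nearBox q δ ε) →
      DifferentiableOn ℂ (fun p : Params n × ℂ => φ p.2) (rootDomain q δ ε n ×ˢ nearBox q δ ε) :=
    fun hφ => hφ.comp (by fun_prop) fun p hp => hp.2
  have h1 := hc (differentiableOn_segmentRegular H.q_pos (isOpen_nearBox q δ ε) hseg
    (H.diff_ν.mono H.nearBox_subset))
  have h2 := hc (differentiableOn_segmentRegular H.q_pos (isOpen_nearBox q δ ε) hseg
    (H.diff_h.mono H.nearBox_subset))
  have h3 := hc (H.differentiableOn_shiftedTransform H.diff_ν)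
  have h4 := hc (H.differentiableOn_shiftedTransform H.diff_h)
  refine DifferentiableOn.mul (DifferentiableOn.mul (DifferentiableOn.mul (by fun_prop)
    (DifferentiableOn.inv (by fun_prop) fun p hp => ?_))
    (differentiableOn_finsetProd fun a _ => DifferentiableOn.mul (by fun_prop)
      (DifferentiableOn.inv (by fun_prop) fun p hp => ?_))) ?_
  · exact H.add_ne_zero hp.2 (by simpa using H.δ_pos)
  · exact H.add_ne_zero hp.2 (hp.1.1 a trivial)
  · exact (DifferentiableOn.mul (by fun_prop) ((h1.add (DifferentiableOn.mul (by fun_prop) h2)).sub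
      (h3.add (DifferentiableOn.mul (by fun_prop) h4)))).cexp

theorem differentiableOn_prod_inv {c q δ ε : ℝ} {ν h : ℂ → ℂ} (H : Admissible c q δ ε ν h)
    {n : ℕ} :
    DifferentiableOn ℂ (fun p : Params n × ℂ => ∏ a, (p.2 - p.1.2.1 a)⁻¹)
      (rootDomain q δ ε n ×ˢ collar q δ ε) := by
  refine differentiableOn_finsetProd fun a _ => DifferentiableOn.inv (by fun_prop) fun p hp => ?_
  exact H.sub_ne_zero hp.2 (hp.1.2.1 a trivial)

theorem differentiableOn_segmentLog {c q δ ε : ℝ} {ν h : ℂ → ℂ} (H : Admissible c q δ ε ν h)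
    : DifferentiableOn ℂ (segmentLog q) (collar q δ ε) := by
  exact fun x hx =>
    (differentiableAt_segmentLog H.q_pos (H.segment_ne hx)).differentiableWithinAt

theorem differentiableOn_weightNum {c q δ ε : ℝ} {ν h : ℂ → ℂ} (H : Admissible c q δ ε ν h)
    {n : ℕ} :
    DifferentiableOn ℂ (fun p : Params n × ℂ => weightNum c q ν h p.1 p.2)
      (rootDomain q δ ε n ×ˢ collar q δ ε) := by
  unfold weightNum
  refine ((H.differentiableOn_amplitude.mono (prod_mono subset_rfl (collar_subset q δ ε))).mul
    (DifferentiableOn.mul (by fun_prop) H.differentiableOn_prod_inv)).mul (DifferentiableOn.cexp ?_)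
  exact (H.differentiableOn_phase.mono (prod_mono (subset_univ _) (collar_subset q δ ε))).mul
    (H.differentiableOn_segmentLog.comp (by fun_prop) fun p hp => hp.2)

/-- Only the Cauchy transform at `x` itself is singular near the segment and gets split; the one at
`x + ic` stays at a positive distance. The two logarithms, from `ν` and from `h`, add up to the
phase times `segmentLog`. -/
theorem kernelNum_eq {c q δ ε : ℝ} {ν h : ℂ → ℂ} (H : Admissible c q δ ε ν h)
    {n : ℕ} (z : Params n) {x : ℂ} (hx : x ∈ collar q δ ε)
    (y : ℂ) : kernelNum c q z.1 z.2.1 (fun x => z.2.2.2 * nuBeta ν h z.2.2.1 x) x y =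
      weightNum c q ν h z x * lieb c (x - y) := by
  have hseg : ∀ s ∈ Icc (-q) q, (s : ℂ) ∈ nearBox q δ ε := fun s hs => H.ofReal_mem_nearBox hs
  have hqq : -q ≤ q := by linarith [H.q_pos]
  have hct : ∀ y : ℂ, (∀ s ∈ Icc (-q) q, (s : ℂ) ≠ y) →
      cauchyTransform q (fun x => 2 * I * Real.pi * (z.2.2.2 * nuBeta ν h z.2.2.1 x)) y =
        z.2.2.2 * (segmentTransform q ν y + I * z.2.2.1 * segmentTransform q h y) := by
    intro y hy
    have hint : ∀ {φ : ℂ → ℂ}, DifferentiableOn ℂ φ (strip (2 * δ)) →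
        IntervalIntegrable (fun s : ℝ => φ s / ((s : ℂ) - y)) volume (-q) q := by
      intro φ hφ
      refine ContinuousOn.intervalIntegrable ?_
      rw [uIcc_of_le hqq]
      refine ContinuousOn.div (hφ.continuousOn.comp (by fun_prop) fun s hs =>
        H.nearBox_subset (hseg s hs)) (by fun_prop) fun s hs => _root_.sub_ne_zero.2 (hy s hs)
    simp only [segmentTransform]
    rw [← intervalIntegral.integral_const_mul, ← intervalIntegral.integral_add (hint H.diff_ν)
      ((hint H.diff_h).const_mul _), ← intervalIntegral.integral_const_mul, cauchyTransform,
      ← intervalIntegral.integral_const_mul]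
    refine intervalIntegral.integral_congr fun s _ => ?_
    have hpi : (2 * I * Real.pi : ℂ) ≠ 0 := by simp [Real.pi_ne_zero]
    simp only [nuBeta]
    rw [mul_div_assoc, inv_mul_cancel_left₀ hpi]
    ring
  have hshift : ∀ s ∈ Icc (-q) q, (s : ℂ) ≠ x + I * c := by
    intro s hs h
    have h0 := congrArg Complex.im h
    have := abs_lt.1 hx.1.2
    simp at h0
    linarith [H.δ_le, H.c_pos, H.δ_pos]
  have hprod : (∏ a, ((x - z.1 a) * (x - z.2.1 a + I * c)) / ((x - z.2.1 a) * (x - z.1 a + I * c))) =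
      (∏ a, (x - z.1 a) * (x - z.2.1 a + I * c) * (x - z.1 a + I * c)⁻¹) *
        ∏ a, (x - z.2.1 a)⁻¹ := by
    rw [← Finset.prod_mul_distrib]
    exact Finset.prod_congr rfl fun a _ => by rw [div_eq_mul_inv, mul_inv]; ring
  rw [kernelNum, hct _ (H.segment_ne hx), hct _ hshift, hprod, segmentTransform_eq H.q_pos
    (isOpen_nearBox q δ ε) hseg (H.diff_ν.mono H.nearBox_subset) hx.1 (H.segment_ne hx),
    segmentTransform_eq H.q_pos
    (isOpen_nearBox q δ ε) hseg (H.diff_h.mono H.nearBox_subset) hx.1 (H.segment_ne hx),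
    weightNum, amplitude]
  have hexp : z.2.2.2 * (ν x * segmentLog q x + segmentRegular q ν x +
      I * z.2.2.1 * (h x * segmentLog q x + segmentRegular q h x)) -
      z.2.2.2 * (segmentTransform q ν (x + I * c) + I * z.2.2.1 * segmentTransform q h (x + I * c)) =
      z.2.2.2 * ((segmentRegular q ν x + I * z.2.2.1 * segmentRegular q h x) -
      (segmentTransform q ν (x + I * c) + I * z.2.2.1 * segmentTransform q h (x + I * c))) +
      phase ν h z x * segmentLog q x := by
    simp only [phase, nuBeta]; ring
  rw [hexp, Complex.exp_add]
  ring

theorem paramKernel_eq {c q δ ε : ℝ} {ν h : ℂ → ℂ} (H : Admissible c q δ ε ν h)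
    {n : ℕ} (z : Params n) {x : ℂ} (hx : x ∈ collar q δ ε)
    (y : ℂ) : paramKernel c q ν h z x y = weight c q ν h z x * lieb c (x - y) := by
  rw [paramKernel, scaledKernel]
  have hnum := H.kernelNum_eq z hx y
  split_ifs with h0
  · simp only [h0, zero_mul] at hnum
    rw [show (0 : ℂ → ℂ) = fun _ => 0 from rfl, hnum, weight, phase, h0, zero_mul,
      dslope_expSubOne_zero, div_eq_mul_inv]
    ring
  · rw [kernelU, hnum, weight_eq h0]
    simp only [expSubOne, phase]
    ring

end Admissible

end Weight

/-! ### Local analytic continuation of the regularized determinant -/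

section LocalContinuation

open Topology Metric Filter

/-- The unperturbed poles of the residue of the weight at an integer value of the phase. -/
def poleBase (q : ℝ) {n N : ℕ} (k : PoleIndex N) : (Fin k.2 ⊕ Fin n) → Params n → ℂ :=
  Sum.elim (fun _ _ => if k.1 then -q else q) fun a z => z.2.1 a

/-- The velocities of the moving poles. -/
def poleVelocity (n : ℕ) {N : ℕ} (k : PoleIndex N) : (Fin k.2 ⊕ Fin n) → ℂ :=
  Sum.elim (fun i => ((i : ℕ) + 1 : ℕ)) fun a => ((k.2 : ℕ) + 1 + a : ℕ)

/-- The numerator of the residue of the weight at an integer value of the phase. -/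
def poleNum (q : ℝ) {N : ℕ} (k : PoleIndex N) (x : ℂ) : ℂ :=
  (if k.1 then x - q else x + q) ^ ((k.2 : ℕ) + 1)

/-- The copies of `±q` have velocities `1, …, j` and the `μ_h` have `j + 1, j + 2, …`, so a multiple
pole splits into simple ones. -/
theorem poleVelocity_injective {n N : ℕ} (k : PoleIndex N) :
    Function.Injective (poleVelocity n k) := by
  rintro (i | a) (j | b) h <;> simp only [poleVelocity, Sum.elim_inl, Sum.elim_inr] at h <;>
    have h' := Nat.cast_injective (R := ℂ) h
  · exact congrArg Sum.inl (Fin.ext (by omega))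
  · exact absurd h' (by omega)
  · exact absurd h' (by omega)
  · exact congrArg Sum.inr (Fin.ext (by omega))

theorem norm_poleVelocity_le {n N : ℕ} (k : PoleIndex N) (i : Fin k.2 ⊕ Fin n) :
    ‖poleVelocity n k i‖ ≤ N + n + 1 := by
  have hk := k.2.2
  rcases i with i | a <;> simp only [poleVelocity, Sum.elim_inl, Sum.elim_inr, Complex.norm_natCast]
  · have : (i : ℕ) + 1 ≤ N + n + 1 := by omega
    exact_mod_cast this
  · have : (k.2 : ℕ) + 1 + a ≤ N + n + 1 := by omega
    exact_mod_cast this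

/-- The prefactor `x - q` shifts the orders: `k = j` gives `(x - q)^{j+1} / (x + q)^j` and `k = -1 -
j` gives `(x + q)^{j+1} / (x - q)^j`. Each integer thus contributes a pole at one endpoint only, and
`k = 0`, `k = -1` contribute none. -/
theorem pole_residue_eq {q : ℝ} {n N : ℕ} (k : PoleIndex N) (z : Params n) {x : ℂ}
    (h1 : x - q ≠ 0) (h2 : x + q ≠ 0) :
    (x - q) * (∏ a, (x - z.2.1 a)⁻¹) * exp (poleInt k * segmentLog q x) =
      poleNum q k x * (∏ i, (x - poleBase q k i z))⁻¹ := by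
  rw [Complex.exp_int_mul, exp_segmentLog h1 h2, Fintype.prod_sum_type, Finset.prod_inv_distrib]
  obtain ⟨s, j⟩ := k
  cases s
  · simp only [poleInt, poleBase, poleNum, Sum.elim_inl, Sum.elim_inr, Bool.false_eq_true, if_false,
      Finset.prod_const, Finset.card_univ, Fintype.card_fin]
    rw [show (-1 - ((j : ℕ) : ℤ)) = -(((j : ℕ) + 1 : ℕ) : ℤ) by push_cast; ring, zpow_neg,
      zpow_natCast, div_pow, mul_inv, inv_div, pow_succ (x - (q : ℂ))]
    field_simp
  · simp only [poleInt, poleBase, poleNum, Sum.elim_inl, Sum.elim_inr, if_true,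
      Finset.prod_const, Finset.card_univ, Fintype.card_fin]
    rw [zpow_natCast, div_pow, mul_inv, sub_neg_eq_add, pow_succ]
    field_simp

/-- The part of the weight which stays regular at the integer values of the phase between
`-1 - N` and `N`. -/
def regularWeight (c q : ℝ) (ν h : ℂ → ℂ) (N : ℕ) {n : ℕ} (z : Params n) (x : ℂ) : ℂ :=
  z.2.2.2 * amplitude c q ν h z x * ((x - q) * ∏ a, (x - z.2.1 a)⁻¹) *
    regularQuotient N (phase ν h z x) (segmentLog q x)

theorem weight_eq_add_poleWeight {c q : ℝ} {ν h : ℂ → ℂ} {n N : ℕ} {z : Params n} {x : ℂ}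
    (h1 : x - q ≠ 0) (h2 : x + q ≠ 0) (hz : z.2.2.2 ≠ 0)
    (hF : ‖phase ν h z x + 1 / 2‖ < N + 1) (hF' : ∀ m : ℤ, phase ν h z x ≠ m) :
    weight c q ν h z x = regularWeight c q ν h N z x +
      poleWeight (fun z x => z.2.2.2 * amplitude c q ν h z x) (phase ν h) (poleNum q (N := N))
        (fun k => poleInt k) (poleBase q) (poleVelocity n) (0, z) x := by
  rw [weight_eq hz, weightNum, regularWeight, regularQuotient_eq _ hF hF', poleWeight]
  have h3 : ∀ k : PoleIndex N, -(2 * Real.pi * I)⁻¹ * (z.2.2.2 * amplitude c q ν h z x *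
      poleNum q k x * ((∏ i, (x - (poleBase q k i z + 0 * poleVelocity n k i))) *
        (phase ν h z x - poleInt k))⁻¹) =
      -(2 * Real.pi * I)⁻¹ * (z.2.2.2 * amplitude c q ν h z x *
        ((x - q) * ∏ a, (x - z.2.1 a)⁻¹) *
          (exp (poleInt k * segmentLog q x) / (phase ν h z x - poleInt k))) := by
    intro k
    simp only [zero_mul, add_zero]
    have := pole_residue_eq k z h1 h2
    rw [mul_inv (∏ i, (x - poleBase q k i z)), div_eq_mul_inv]
    linear_combination (2 * Real.pi * I)⁻¹ * (z.2.2.2 * amplitude c q ν h z x) *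
      (phase ν h z x - poleInt k)⁻¹ * this
  simp only [h3]
  rw [← Finset.mul_sum, ← Finset.mul_sum]
  ring

/-- Matching of zeros with denominators: `G(1 - u)` has a zero of order `j` at `u = j`, `G(2 + w)`
one of order `j` at `w = -1 - j`, and each `e^{-2iπy} - 1` a simple zero at every integer. These are
the multiplicities of the poles of the weight. -/
theorem exists_barnesG_mul_eq (n N : ℕ) : ∃ Q : ℂ × ℂ × (Fin n → ℂ) → ℂ, Differentiable ℂ Q ∧
    ∀ (u w : ℂ) (y : Fin n → ℂ), barnesG (1 - u) * barnesG (2 + w) * ∏ a, expSubOne (y a) =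
      Q (u, w, y) * ∏ k : PoleIndex N, (((if k.1 then u else w) - poleInt k) ^ (k.2 : ℕ) *
        ∏ a, (y a - poleInt k)) := by
  obtain ⟨g, hg, hG⟩ := exists_barnesG_factorization N
  obtain ⟨e, he, hE, -, -⟩ := exists_expSubOne_factorization N
  refine ⟨fun p => (∏ j ∈ Finset.range N, (-1) ^ (j + 1)) * g (-p.1) * g (1 + p.2.1) *
    ∏ a, e (p.2.2 a), ?_, fun u w y => ?_⟩
  · refine Differentiable.mul (Differentiable.mul (Differentiable.mul (by fun_prop)
      (hg.comp (by fun_prop))) (hg.comp (by fun_prop))) ?_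
    rw [← differentiableOn_univ]
    exact differentiableOn_finsetProd fun a _ => (he.comp (by fun_prop)).differentiableOn
  · have h1 := hG (-u)
    have h2 := hG (1 + w)
    rw [← sub_eq_add_neg] at h1
    rw [show (1 : ℂ) + (1 + w) = 2 + w by ring] at h2
    have h3 : ∏ k : PoleIndex N, ((if k.1 then u else w) - (poleInt k : ℂ)) ^ (k.2 : ℕ) =
        (∏ j ∈ Finset.range N, (u - (j + 1)) ^ (j + 1)) *
          ∏ j ∈ Finset.range N, (1 + w + (j + 1)) ^ (j + 1) := by
      -- The index `j = 0` has exponent `0`; without it, each half of `PoleIndex N` matches the `N`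
      -- zeros split off from `G`.
      rw [Fintype.prod_prod_type, Fintype.prod_bool, Fin.prod_univ_succ, Fin.prod_univ_succ,
        Finset.prod_range, Finset.prod_range]
      simp [poleInt]
      left
      refine Finset.prod_congr rfl fun j _ => ?_
      congr 1
      ring
    have h4 : ∏ j ∈ Finset.range N, (-u + ((j : ℂ) + 1)) ^ (j + 1) =
        (∏ j ∈ Finset.range N, (-1) ^ (j + 1)) * ∏ j ∈ Finset.range N, (u - (j + 1)) ^ (j + 1) := by
      rw [← Finset.prod_mul_distrib]
      refine Finset.prod_congr rfl fun j _ => ?_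
      rw [← mul_pow]
      congr 1
      ring
    rw [h1, h2, h4, Finset.prod_mul_distrib, h3, Finset.prod_comm]
    simp only [hE, Finset.prod_mul_distrib]
    ring

/-- The domain of a local continuation. -/
def localDomain (q δ ε : ℝ) {n : ℕ} (μ₀ : Fin n → ℂ) (ρ X : ℝ) : Set (Params n) :=
  (univ.pi fun _ => strip δ) ×ˢ (univ.pi fun a => rect q δ ε ∩ ball (μ₀ a) ρ) ×ˢ
    ball 0 X ×ˢ ball 0 X

theorem isOpen_localDomain (q δ ε : ℝ) {n : ℕ} (μ₀ : Fin n → ℂ) (ρ X : ℝ) :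
    IsOpen (localDomain q δ ε μ₀ ρ X) :=
  (isOpen_set_pi finite_univ fun _ _ => isOpen_strip δ).prod
    ((isOpen_set_pi finite_univ fun _ _ => (isOpen_rect q δ ε).inter isOpen_ball).prod
      (isOpen_ball.prod isOpen_ball))

theorem localDomain_subset (q δ ε : ℝ) {n : ℕ} (μ₀ : Fin n → ℂ) (ρ X : ℝ) :
    localDomain q δ ε μ₀ ρ X ⊆ rootDomain q δ ε n :=
  fun _ hz => ⟨hz.1, fun a _ => (hz.2.1 a trivial).1, trivial, trivial⟩

namespace Admissible

theorem fredholmTerm_paramKernel {c q δ ε : ℝ} {ν h : ℂ → ℂ} (H : Admissible c q δ ε ν h) {n : ℕ}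
    {z : Params n} (hw : ContinuousOn (weight c q ν h z) (collar q δ ε)) (k : ℕ) :
    fredholmTerm (ellipse (2 * (q + ε)) δ) (paramKernel c q ν h z) k =
      fredIter (fun x y => lieb c (x - y)) (ellipse (2 * (q + ε)) δ)
        (fun t => ellipseDeriv (2 * (q + ε)) δ t * weight c q ν h z (ellipse (2 * (q + ε)) δ t)) []
        k (Fin.elim0 : Fin 0 → ℂ) / k.factorial := by
  rw [← deriv_ellipse, ← fredholmTerm_eq H.differentiableOn_lieb (continuous_ellipse _ _)
    fun t => (H.ellipse_mem_collar t).1]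
  · unfold fredholmTerm
    simp only [H.paramKernel_eq z (H.ellipse_mem_collar _)]
  · rw [deriv_ellipse]
    exact (continuous_ellipseDeriv _ _).mul
      (hw.comp_continuous (continuous_ellipse _ _) H.ellipse_mem_collar)

theorem fredholmDet_eq {c q δ ε : ℝ} {ν h : ℂ → ℂ} (H : Admissible c q δ ε ν h) {n : ℕ}
    {z : Params n} (hw : ContinuousOn (weight c q ν h z) (collar q δ ε)) :
    fredholmDet (ellipse (2 * (q + ε)) δ) (paramKernel c q ν h z) =
      fredDet (fun x y => lieb c (x - y)) (ellipse (2 * (q + ε)) δ)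
        (fun t => ellipseDeriv (2 * (q + ε)) δ t * weight c q ν h z (ellipse (2 * (q + ε)) δ t)) []
        (Fin.elim0 : Fin 0 → ℂ) :=
  tsum_congr fun k => H.fredholmTerm_paramKernel hw k

theorem norm_phase_le {q δ ε X M : ℝ} {ν h : ℂ → ℂ}
    (hMν : ∀ x ∈ nearBox q δ ε, ‖ν x‖ ≤ M) (hMh : ∀ x ∈ nearBox q δ ε, ‖h x‖ ≤ M) {n : ℕ}
    {z : Params n} (hβ : ‖z.2.2.1‖ ≤ X) (hγ : ‖z.2.2.2‖ ≤ X) {x : ℂ} (hx : x ∈ nearBox q δ ε) :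
    ‖phase ν h z x‖ ≤ X * (M + X * M) := by
  have hX : 0 ≤ X := (norm_nonneg _).trans hβ
  rw [phase, nuBeta, norm_mul]
  gcongr
  refine (norm_add_le _ _).trans ?_
  rw [norm_mul, norm_mul, norm_I, one_mul]
  gcongr
  · exact hMν x hx
  · exact hMh x hx

theorem differentiableOn_regularWeight {c q δ ε : ℝ} {ν h : ℂ → ℂ} (H : Admissible c q δ ε ν h)
    {n N : ℕ} {W : Set (Params n)} (hW : W ⊆ rootDomain q δ ε n)
    (hF : ∀ z ∈ W, ∀ x ∈ nearBox q δ ε, ‖phase ν h z x + 1 / 2‖ < N + 1) :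
    DifferentiableOn ℂ (fun p : Params n × ℂ => regularWeight c q ν h N p.1 p.2)
      (W ×ˢ collar q δ ε) := by
  unfold regularWeight
  have hsub := collar_subset q δ ε
  refine ((DifferentiableOn.mul (by fun_prop) (H.differentiableOn_amplitude.mono
    (prod_mono hW hsub))).mul (DifferentiableOn.mul (by fun_prop)
      (H.differentiableOn_prod_inv.mono (prod_mono hW subset_rfl)))).mul ?_
  refine (differentiableOn_regularQuotient N).comp
    (f := fun p : Params n × ℂ => (phase ν h p.1 p.2, segmentLog q p.2)) (DifferentiableOn.prodMk
    (H.differentiableOn_phase.mono (prod_mono (subset_univ _) hsub))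
    (H.differentiableOn_segmentLog.comp (by fun_prop) fun p hp => hp.2)) fun p hp => ⟨?_, trivial⟩
  rw [mem_ball, dist_eq_norm, neg_div, sub_neg_eq_add]
  exact hF p.1 hp.1 p.2 (hsub hp.2)

/-- The bounds on `β` and `γ` limit the integers that the phase can meet, and the restriction of the
`μ_h` to small balls lets one radius `r` separate the moving poles for all parameters. -/
theorem exists_local_continuation {c q δ ε X M : ℝ} {ν h : ℂ → ℂ} (H : Admissible c q δ ε ν h)
    (hMν : ∀ x ∈ nearBox q δ ε, ‖ν x‖ ≤ M) (hMh : ∀ x ∈ nearBox q δ ε, ‖h x‖ ≤ M)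
    {n : ℕ} (μ₀ : Fin n → ℂ) :
    ∃ ρ > 0, ∃ φ : Params n → ℂ, DifferentiableOn ℂ φ (localDomain q δ ε μ₀ ρ X) ∧
      ∀ z ∈ localDomain q δ ε μ₀ ρ X, z.2.2.2 ≠ 0 →
        (∀ x ∈ nearBox q δ ε, ∀ m : ℤ, phase ν h z x ≠ m) →
        φ z = regDet c q ν h (ellipse (2 * (q + ε)) δ) z := by
  -- A bound for the modulus of the phase, so that the phase stays in the disc of `regularQuotient
  -- N`.
  obtain ⟨N, hN⟩ := exists_nat_gt (X * (M + X * M))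
  have hδ := H.δ_pos
  let x₀ : ∀ k : PoleIndex N, Fin k.2 ⊕ Fin n → ℂ := fun k =>
    Sum.elim (fun _ => if k.1 then -q else q) μ₀
  -- Velocities are at most `N + n + 1`, so displacements stay within the `δ / 10` allowed by
  -- `add_mem_core`.
  obtain ⟨r, ρ, hr, hr₁, hρ, T, hT, hTr, hrT, hsep⟩ := exists_separating_radius x₀
    (poleVelocity n) poleVelocity_injective (r₁ := δ / 10 / (N + n + 1)) (by positivity)
  set W := localDomain q δ ε μ₀ ρ X with hWdef
  have hWsub : W ⊆ rootDomain q δ ε n := localDomain_subset _ _ _ _ _ _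
  have hF : ∀ z ∈ W, ∀ x ∈ nearBox q δ ε, ‖phase ν h z x + 1 / 2‖ < N + 1 := by
    intro z hz x hx
    have h1 := norm_phase_le hMν hMh (mem_ball_zero_iff.1 hz.2.2.1).le
      (mem_ball_zero_iff.1 hz.2.2.2).le hx
    have h2 := norm_add_le (phase ν h z x) (1 / 2)
    have h3 : ‖(1 / 2 : ℂ)‖ = 1 / 2 := by norm_num
    linarith
  have hbaserect : ∀ z ∈ W, ∀ (k : PoleIndex N) (i : Fin k.2 ⊕ Fin n),
      poleBase q k i z ∈ rect q δ ε := by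
    intro z hz k i
    have hq := H.q_pos
    rcases i with i | a
    · simp only [poleBase, Sum.elim_inl]
      split_ifs
      · exact_mod_cast H.ofReal_mem_rect (s := -q) ⟨le_rfl, by linarith⟩
      · exact H.ofReal_mem_rect ⟨by linarith, le_rfl⟩
    · exact (hz.2.1 a trivial).1
  have hbaseρ : ∀ z ∈ W, ∀ (k : PoleIndex N) (i : Fin k.2 ⊕ Fin n),
      ‖poleBase q k i z - x₀ k i‖ < ρ := by
    intro z hz k i
    rcases i with i | a
    · simpa [poleBase, x₀] using hρ
    · have := (hz.2.1 a trivial).2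
      rwa [mem_ball, dist_eq_norm] at this
  have hroot : ∀ t ∈ ball (0 : ℂ) (δ / 10 / (N + n + 1)), ∀ z ∈ W, ∀ (k : PoleIndex N)
      (i : Fin k.2 ⊕ Fin n), poleBase q k i z + t * poleVelocity n k i ∈ core q δ ε := by
    intro t ht z hz k i
    refine H.add_mem_core (hbaserect z hz k i) ?_
    have h1 : ‖t‖ < δ / 10 / (N + n + 1) := by simpa using ht
    rw [norm_mul]
    have h2 := mul_le_mul h1.le (norm_poleVelocity_le k i) (norm_nonneg _) (by positivity)
    rwa [div_mul_cancel₀ _ (by positivity)] at h2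
  have hdist : ∀ t ∈ T, ∀ z ∈ W, ∀ k : PoleIndex N,
      Function.Injective fun i => poleBase q k i z + t * poleVelocity n k i := by
    intro t ht z hz k i j hij
    by_contra hne
    exact hsep t ht k i j hne _ _ (hbaseρ z hz k i) (hbaseρ z hz k j) hij
  obtain ⟨φ, hφ, hφeq⟩ := exists_moving_poles (M := 8 / c) H.δ_pos H.axis_lt
    (isOpen_nearBox q δ ε) ((convex_nearBox q δ ε).starConvex H.zero_mem_nearBox)
    (collar_subset q δ ε) H.ellipse_mem_collar (C := core q δ ε)
    (fun x hx => lt_trans (show ellipseForm _ _ x < 3 / 4 from hx) (by norm_num)) H.core_subset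
    (disjoint_core_collar q δ ε) (K := fun x y => lieb c (x - y)) H.differentiableOn_lieb
    (fun x hx y hy => H.norm_lieb_sub_le hx hy) (isOpen_localDomain q δ ε μ₀ ρ X)
    (H.differentiableOn_regularWeight hWsub hF)
    (A := fun z x => z.2.2.2 * amplitude c q ν h z x)
    (DifferentiableOn.mul (by fun_prop)
      (H.differentiableOn_amplitude.mono (prod_mono hWsub subset_rfl)))
    (F := phase ν h) (H.differentiableOn_phase.mono (prod_mono (subset_univ _) subset_rfl))
    (num := poleNum q (N := N)) (fun k => by unfold poleNum; split_ifs <;> fun_prop)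
    (s := fun k => poleInt k) (base := poleBase q)
    (fun k i => by rcases i with i | a <;> simp only [poleBase, Sum.elim_inl, Sum.elim_inr] <;> fun_prop)
    (v := poleVelocity n) hr hr₁ hT hTr hrT hroot hdist
  obtain ⟨Q, hQ, hQeq⟩ := exists_barnesG_mul_eq n N
  have hqV : ((q : ℝ) : ℂ) ∈ nearBox q δ ε :=
    H.ofReal_mem_nearBox ⟨by linarith [H.q_pos], le_rfl⟩
  have hqV' : (-q : ℂ) ∈ nearBox q δ ε := by
    exact_mod_cast H.ofReal_mem_nearBox (s := -q) ⟨le_rfl, by linarith [H.q_pos]⟩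
  have hphase : ∀ f : Params n → ℂ, DifferentiableOn ℂ f W → (∀ z ∈ W, f z ∈ nearBox q δ ε) →
      DifferentiableOn ℂ (fun z => phase ν h z (f z)) W := fun f hf hfV =>
    H.differentiableOn_phase.comp (f := fun z => (z, f z)) (differentiableOn_id.prodMk hf)
      fun z hz => ⟨trivial, hfV z hz⟩
  refine ⟨ρ, hρ, fun z => Q (phase ν h z (-q), phase ν h z q, fun a => phase ν h z (z.2.1 a)) *
    φ z, ?_, ?_⟩
  · refine (hQ.comp_differentiableOn ?_).mul hφ
    refine (hphase _ (by fun_prop) fun _ _ => hqV').prodMk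
      ((hphase _ (by fun_prop) fun _ _ => hqV).prodMk (differentiableOn_pi.2 fun a =>
        hphase _ (by fun_prop) fun z hz => H.core_subset (H.rect_subset_core ?_)))
    exact (hz.2.1 a trivial).1
  · intro z hz hγ hint
    have hweq : ∀ x ∈ collar q δ ε, weight c q ν h z x = regularWeight c q ν h N z x +
        poleWeight (fun z x => z.2.2.2 * amplitude c q ν h z x) (phase ν h) (poleNum q (N := N))
          (fun k => poleInt k) (poleBase q) (poleVelocity n) (0, z) x := fun x hx =>
      weight_eq_add_poleWeight
        (H.sub_ne_zero hx (H.ofReal_mem_rect ⟨by linarith [H.q_pos], le_rfl⟩))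
        (by
          have := H.sub_ne_zero hx (H.ofReal_mem_rect (s := -q) ⟨le_rfl, by linarith [H.q_pos]⟩)
          rwa [ofReal_neg, sub_neg_eq_add] at this) hγ (hF z hz x hx.1) (hint x hx.1)
    have hwc : ContinuousOn (weight c q ν h z) (collar q δ ε) := by
      have h1 : ContinuousOn (fun x => weightNum c q ν h z x) (collar q δ ε) :=
        H.differentiableOn_weightNum.continuousOn.comp (f := fun x => (z, x)) (by fun_prop)
          fun x hx => ⟨hWsub hz, hx⟩
      have h2 : ContinuousOn (fun x => phase ν h z x) (collar q δ ε) :=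
        H.differentiableOn_phase.continuousOn.comp (f := fun x => (z, x)) (by fun_prop)
          fun x hx => ⟨trivial, hx.1⟩
      refine ((continuousOn_const.mul h1).div
        (differentiable_expSubOne.continuous.comp_continuousOn h2) fun x hx h0 => ?_).congr
          fun x _ => weight_eq hγ x
      obtain ⟨m, hm⟩ := expSubOne_eq_zero_iff.1 h0
      exact hint x hx.1 m hm
    have hfd := H.fredholmDet_eq hwc
    simp only [hweq _ (H.ellipse_mem_collar _)] at hfd
    have hB := hQeq (phase ν h z (-q)) (phase ν h z q) fun a => phase ν h z (z.2.1 a)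
    simp only [hφeq z hz fun x hx k => hint x hx _]
    rw [← hfd, ← mul_assoc, regDet]
    congr 1
    refine Eq.trans ?_ hB.symm
    congr 1
    refine Finset.prod_congr rfl fun k _ => ?_
    rw [Fintype.prod_sum_type]
    congr 1
    simp only [poleBase, Sum.elim_inl, Finset.prod_const, Finset.card_univ, Fintype.card_fin]
    split_ifs <;> rfl

end Admissible

end LocalContinuation

/-! ### Global analytic continuation of the regularized determinant -/

section GlobalContinuation

open Topology Metric Filter

theorem exists_glue {α β I : Type*} {W : I → Set α} {φ : I → α → β}
    (h : ∀ i j, EqOn (φ i) (φ j) (W i ∩ W j)) [Nonempty β] :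
    ∃ Φ : α → β, ∀ i, EqOn Φ (φ i) (W i) := by
  classical
  refine ⟨fun z => if hz : ∃ i, z ∈ W i then φ hz.choose z else Classical.arbitrary β,
    fun i z hz => ?_⟩
  have h' : ∃ i, z ∈ W i := ⟨i, hz⟩
  simp only [dif_pos h']
  exact h _ _ ⟨h'.choose_spec, hz⟩

/-- An open set of parameters for which the Fredholm determinant is well defined. -/
def baseDomain (q δ ε R₀ R₁ g : ℝ) (n : ℕ) : Set (Params n) :=
  (univ.pi fun _ => strip δ) ×ˢ (univ.pi fun _ => rect q δ ε) ×ˢ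
    ({β : ℂ | R₀ < β.re} ∩ ball 0 R₁) ×ˢ ball 0 g

theorem isOpen_baseDomain (q δ ε R₀ R₁ g : ℝ) (n : ℕ) : IsOpen (baseDomain q δ ε R₀ R₁ g n) :=
  (isOpen_set_pi finite_univ fun _ _ => isOpen_strip δ).prod
    ((isOpen_set_pi finite_univ fun _ _ => isOpen_rect q δ ε).prod
      (((isOpen_lt continuous_const continuous_re).inter isOpen_ball).prod isOpen_ball))

theorem convex_baseDomain (q δ ε R₀ R₁ g : ℝ) (n : ℕ) :
    Convex ℝ (baseDomain q δ ε R₀ R₁ g n) :=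
  (convex_pi fun _ _ => convex_strip δ).prod ((convex_pi fun _ _ => convex_rect q δ ε).prod
    (((convex_halfSpace_re_gt R₀).inter (convex_ball _ _)).prod (convex_ball _ _)))

theorem convex_localDomain (q δ ε : ℝ) {n : ℕ} (μ₀ : Fin n → ℂ) (ρ X : ℝ) :
    Convex ℝ (localDomain q δ ε μ₀ ρ X) :=
  (convex_pi fun _ _ => convex_strip δ).prod ((convex_pi fun _ _ =>
    (convex_rect q δ ε).inter (convex_ball _ _)).prod ((convex_ball _ _).prod (convex_ball _ _)))

theorem convex_largeDomain (q δ ε : ℝ) (n : ℕ) : Convex ℝ (largeDomain q δ ε n) :=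
  (convex_pi fun _ _ => convex_strip δ).prod ((convex_pi fun _ _ => convex_rect q δ ε).prod
    ((convex_halfSpace_re_ge (-ε)).prod (convex_ball _ _)))

theorem baseDomain_subset (q δ ε R₀ R₁ g : ℝ) (n : ℕ) :
    baseDomain q δ ε R₀ R₁ g n ⊆ rootDomain q δ ε n :=
  fun _ hz => ⟨hz.1, hz.2.1, trivial, trivial⟩

/-- With `w = -2iπu` and `‖w‖ ≤ 1/2`, one has `‖e^w - 1‖ ≥ ‖w‖ - ‖w‖² ≥ ‖w‖/2 = π ‖u‖`. -/
theorem norm_le_norm_expSubOne {u : ℂ} (hu : ‖u‖ ≤ 1 / 16) : ‖u‖ ≤ ‖expSubOne u‖ := by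
  set w := -2 * I * Real.pi * u with hw
  have hwn : ‖w‖ = 2 * Real.pi * ‖u‖ := by
    simp [hw, abs_of_pos Real.pi_pos]
  have h3 := Real.pi_gt_three
  have h4 := Real.pi_lt_four
  have hu0 := norm_nonneg u
  have hw1 : ‖w‖ ≤ 1 / 2 := by rw [hwn]; nlinarith
  have h5 := Complex.norm_exp_sub_one_sub_id_le (x := w) (by linarith)
  have h6 := norm_sub_norm_le w (-(exp w - 1 - w))
  rw [norm_neg, sub_neg_eq_add, add_sub_cancel] at h6
  have h7 : ‖w‖ ^ 2 ≤ ‖w‖ / 2 := by nlinarith [norm_nonneg w]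
  show ‖u‖ ≤ ‖exp w - 1‖
  nlinarith

theorem ne_intCast_of_norm_le {u : ℂ} (hu : ‖u‖ ≤ 1 / 16) (hu0 : u ≠ 0) (m : ℤ) : u ≠ m := by
  intro h
  have h1 : expSubOne u = 0 := expSubOne_eq_zero_iff.2 ⟨m, h⟩
  have h2 := norm_le_norm_expSubOne hu
  rw [h1, norm_zero] at h2
  exact hu0 (norm_le_zero_iff.1 h2)

/-- Bounds that make the weight regular on `baseDomain`. -/
structure Regular (q δ ε R₀ R₁ g : ℝ) (ν h : ℂ → ℂ) : Prop where
  nonneg : 0 ≤ R₀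
  lt : R₀ + 1 < R₁
  pos : 0 < g
  le_one : g ≤ 1
  one_le : ∀ β : ℂ, R₀ < β.re → ∀ x ∈ nearBox q δ ε, 1 ≤ ‖nuBeta ν h β x‖
  le : ∀ β ∈ ball (0 : ℂ) R₁, ∀ γ ∈ ball (0 : ℂ) g, ∀ x ∈ nearBox q δ ε,
    ‖γ * nuBeta ν h β x‖ ≤ 1 / 16

namespace Regular

variable {q δ ε R₀ R₁ g : ℝ} {ν h : ℂ → ℂ} {n : ℕ} {z : Params n}

theorem nuBeta_ne_zero (B : Regular q δ ε R₀ R₁ g ν h) (hz : z ∈ baseDomain q δ ε R₀ R₁ g n)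
    {x : ℂ} (hx : x ∈ nearBox q δ ε) : nuBeta ν h z.2.2.1 x ≠ 0 :=
  norm_pos_iff.1 (one_pos.trans_le (B.one_le _ hz.2.2.1.1 x hx))

theorem phase_ne (B : Regular q δ ε R₀ R₁ g ν h) (hz : z ∈ baseDomain q δ ε R₀ R₁ g n)
    (hγ : z.2.2.2 ≠ 0) {x : ℂ} (hx : x ∈ nearBox q δ ε) (m : ℤ) : phase ν h z x ≠ m :=
  ne_intCast_of_norm_le (B.le _ hz.2.2.1.2 _ hz.2.2.2 x hx)
    (mul_ne_zero hγ (B.nuBeta_ne_zero hz hx)) m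

theorem dslope_ne_zero (B : Regular q δ ε R₀ R₁ g ν h) (hz : z ∈ baseDomain q δ ε R₀ R₁ g n)
    {x : ℂ} (hx : x ∈ nearBox q δ ε) : dslope expSubOne 0 (phase ν h z x) ≠ 0 := by
  by_cases h0 : phase ν h z x = 0
  · rw [h0, dslope_expSubOne_zero]
    simp [Real.pi_ne_zero]
  · intro h1
    have h2 := norm_le_norm_expSubOne (B.le _ hz.2.2.1.2 _ hz.2.2.2 x hx)
    have h3 := mul_dslope_expSubOne (phase ν h z x)
    rw [h1, mul_zero] at h3
    rw [← phase, ← h3, norm_zero] at h2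
    exact h0 (norm_le_zero_iff.1 h2)

/-- Replacing `β` and `γ` by these fixed values, with the `μ`'s kept, gives an anchor at which `γ ≠
0` and the phase avoids the integers; all local continuations are compared there. -/
theorem mk_mem_baseDomain (B : Regular q δ ε R₀ R₁ g ν h) (hz : z ∈ rootDomain q δ ε n) :
    (z.1, z.2.1, ((R₀ + 1 / 2 : ℝ) : ℂ), ((g / 2 : ℝ) : ℂ)) ∈ baseDomain q δ ε R₀ R₁ g n := by
  have h1 := B.nonneg
  have h2 := B.lt
  have h3 := B.pos
  refine ⟨hz.1, hz.2.1, ⟨?_, ?_⟩, ?_⟩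
  · show R₀ < (((R₀ + 1 / 2 : ℝ) : ℂ)).re
    rw [ofReal_re]; linarith
  · rw [mem_ball_zero_iff, Complex.norm_real, Real.norm_of_nonneg (by linarith)]
    linarith
  · rw [mem_ball_zero_iff, Complex.norm_real, Real.norm_of_nonneg (by linarith)]
    linarith

theorem mk_mem_localDomain (B : Regular q δ ε R₀ R₁ g ν h) {μ₀ : Fin n → ℂ} {ρ X : ℝ}
    (hz : z ∈ localDomain q δ ε μ₀ ρ X) (hX : R₀ + 1 < X) :
    (z.1, z.2.1, ((R₀ + 1 / 2 : ℝ) : ℂ), ((g / 2 : ℝ) : ℂ)) ∈ localDomain q δ ε μ₀ ρ X := by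
  have h1 := B.nonneg
  have h3 := B.pos
  have h4 := B.le_one
  refine ⟨hz.1, hz.2.1, ?_, ?_⟩
  · rw [mem_ball_zero_iff, Complex.norm_real, Real.norm_of_nonneg (by linarith)]
    linarith
  · rw [mem_ball_zero_iff, Complex.norm_real, Real.norm_of_nonneg (by linarith)]
    linarith

end Regular

namespace Admissible

variable {c q δ ε R₀ R₁ g : ℝ} {ν h : ℂ → ℂ} {n : ℕ}

theorem differentiableOn_weight (H : Admissible c q δ ε ν h) (B : Regular q δ ε R₀ R₁ g ν h) :
    DifferentiableOn ℂ (fun p : Params n × ℂ => weight c q ν h p.1 p.2)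
      (baseDomain q δ ε R₀ R₁ g n ×ˢ collar q δ ε) := by
  unfold weight
  have h1 := H.differentiableOn_phase (n := n) |>.mono
    (prod_mono (subset_univ (baseDomain q δ ε R₀ R₁ g n)) (collar_subset q δ ε))
  have h2 : DifferentiableOn ℂ (fun p : Params n × ℂ => nuBeta ν h p.1.2.2.1 p.2)
      (baseDomain q δ ε R₀ R₁ g n ×ˢ collar q δ ε) := by
    unfold nuBeta
    have hs : MapsTo (fun p : Params n × ℂ => p.2)
        (baseDomain q δ ε R₀ R₁ g n ×ˢ collar q δ ε) (strip (2 * δ)) :=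
      fun p hp => H.nearBox_subset hp.2.1
    exact (H.diff_ν.comp (f := fun p : Params n × ℂ => p.2) (by fun_prop) hs).add
      (DifferentiableOn.mul (by fun_prop)
        (H.diff_h.comp (f := fun p : Params n × ℂ => p.2) (by fun_prop) hs))
  exact (H.differentiableOn_weightNum.mono
    (prod_mono (baseDomain_subset q δ ε R₀ R₁ g n) subset_rfl)).mul
    (DifferentiableOn.inv (h2.mul (differentiable_dslope_expSubOne.comp_differentiableOn h1))
      fun p hp => mul_ne_zero (B.nuBeta_ne_zero hp.1 hp.2.1) (B.dslope_ne_zero hp.1 hp.2.1))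

theorem continuousOn_weight (H : Admissible c q δ ε ν h) (B : Regular q δ ε R₀ R₁ g ν h)
    {z : Params n} (hz : z ∈ baseDomain q δ ε R₀ R₁ g n) :
    ContinuousOn (weight c q ν h z) (collar q δ ε) :=
  (H.differentiableOn_weight B).continuousOn.comp (f := fun x => (z, x)) (by fun_prop)
    fun _ hx => ⟨hz, hx⟩

theorem continuousOn_paramKernel (H : Admissible c q δ ε ν h) (B : Regular q δ ε R₀ R₁ g ν h)
    {z : Params n} (hz : z ∈ baseDomain q δ ε R₀ R₁ g n) :
    ContinuousOn (Function.uncurry (paramKernel c q ν h z))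
      (range (ellipse (2 * (q + ε)) δ) ×ˢ range (ellipse (2 * (q + ε)) δ)) := by
  have hr : range (ellipse (2 * (q + ε)) δ) ⊆ collar q δ ε := range_subset_iff.2 H.ellipse_mem_collar
  have h1 : ContinuousOn (fun p : ℂ × ℂ => weight c q ν h z p.1 * lieb c (p.1 - p.2))
      (collar q δ ε ×ˢ collar q δ ε) :=
    ((H.continuousOn_weight B hz).comp continuousOn_fst fun p hp => hp.1).mul
      (H.differentiableOn_lieb.continuousOn.mono
        (prod_mono (collar_subset q δ ε) (collar_subset q δ ε)))
  exact (h1.mono (prod_mono hr hr)).congr fun p hp => H.paramKernel_eq z (hr hp.1) p.2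

theorem summable_norm_fredholmTerm (H : Admissible c q δ ε ν h) (B : Regular q δ ε R₀ R₁ g ν h)
    {z : Params n} (hz : z ∈ baseDomain q δ ε R₀ R₁ g n) :
    Summable fun k => ‖fredholmTerm (ellipse (2 * (q + ε)) δ) (paramKernel c q ν h z) k‖ := by
  have hw := H.continuousOn_weight B hz
  simp only [H.fredholmTerm_paramKernel hw]
  exact summable_norm_fredIter (V := nearBox q δ ε) (fun x hx y hy => H.norm_lieb_sub_le hx hy)
    (fun t _ => (H.ellipse_mem_collar t).1) ((continuous_ellipseDeriv _ _).mul
      (hw.comp_continuous (continuous_ellipse _ _) H.ellipse_mem_collar)).continuousOn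
    (by simp) (fun i => i.elim0)

theorem differentiableOn_regDet (H : Admissible c q δ ε ν h) (B : Regular q δ ε R₀ R₁ g ν h) :
    DifferentiableOn ℂ (regDet c q ν h (ellipse (2 * (q + ε)) δ) : Params n → ℂ)
      (baseDomain q δ ε R₀ R₁ g n) := by
  have hphase : ∀ f : Params n → ℂ, DifferentiableOn ℂ f (baseDomain q δ ε R₀ R₁ g n) →
      (∀ z ∈ baseDomain q δ ε R₀ R₁ g n, f z ∈ nearBox q δ ε) →
      DifferentiableOn ℂ (fun z => z.2.2.2 * nuBeta ν h z.2.2.1 (f z))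
        (baseDomain q δ ε R₀ R₁ g n) := fun f hf hfV =>
    H.differentiableOn_phase.comp (f := fun z => (z, f z)) (differentiableOn_id.prodMk hf)
      fun z hz => ⟨trivial, hfV z hz⟩
  have hqV : ((q : ℝ) : ℂ) ∈ nearBox q δ ε :=
    H.ofReal_mem_nearBox ⟨by linarith [H.q_pos], le_rfl⟩
  have hqV' : (-q : ℂ) ∈ nearBox q δ ε := by
    exact_mod_cast H.ofReal_mem_nearBox (s := -q) ⟨le_rfl, by linarith [H.q_pos]⟩
  unfold regDet
  refine ((((differentiable_barnesG.comp_differentiableOn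
    ((hphase _ (by fun_prop) fun _ _ => hqV').const_sub 1)).mul
    (differentiable_barnesG.comp_differentiableOn
    ((hphase _ (by fun_prop) fun _ _ => hqV).const_add 2))).mul
    (differentiableOn_finsetProd fun a _ => differentiable_expSubOne.comp_differentiableOn
      (hphase _ (by fun_prop) fun z hz =>
        H.core_subset (H.rect_subset_core (hz.2.1 a trivial)))))).mul ?_
  have h1 := differentiableOn_fredDet (L := []) (isOpen_baseDomain q δ ε R₀ R₁ g n)
    (isOpen_nearBox q δ ε) (collar_subset q δ ε) H.differentiableOn_lieb
    (fun x hx y hy => H.norm_lieb_sub_le hx hy) (continuous_ellipse _ _) H.ellipse_mem_collar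
    (continuous_ellipseDeriv (2 * (q + ε)) δ) (H.differentiableOn_weight B) (by simp) 0
  exact (h1.comp (f := fun z => (z, (Fin.elim0 : Fin 0 → ℂ))) (by fun_prop)
    fun z hz => ⟨hz, fun i => i.elim0⟩).congr
      fun z hz => H.fredholmDet_eq (H.continuousOn_weight B hz)

/-- Every local continuation agrees with `regDet` near an anchor in its domain. Intersections of
local domains are convex and contain the anchors of their points, so the identity theorem gives
compatibility, and again gives equality with `regDet` on `baseDomain`, including at `γ = 0`. -/
theorem exists_continuation {M : ℝ} (H : Admissible c q δ ε ν h) (B : Regular q δ ε R₀ R₁ g ν h)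
    (hMν : ∀ x ∈ nearBox q δ ε, ‖ν x‖ ≤ M) (hMh : ∀ x ∈ nearBox q δ ε, ‖h x‖ ≤ M) :
    ∃ Φ : Params n → ℂ, AnalyticOnNhd ℂ Φ (rootDomain q δ ε n) ∧
      EqOn Φ (regDet c q ν h (ellipse (2 * (q + ε)) δ)) (baseDomain q δ ε R₀ R₁ g n) := by
  choose ρ hρ φ hφ hφeq using fun i : (Fin n → ℂ) × {X : ℝ // R₀ + 1 < X} =>
    H.exists_local_continuation (X := i.2) hMν hMh i.1
  have han : ∀ i, AnalyticOnNhd ℂ (φ i) (localDomain q δ ε i.1 (ρ i) i.2) := fun i =>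
    analyticOnNhd_of_differentiableOn (isOpen_localDomain _ _ _ _ _ _) (hφ i)
  have hg : ((g / 2 : ℝ) : ℂ) ≠ 0 := by
    exact_mod_cast (half_pos B.pos).ne'
  have hev : ∀ i, ∀ z ∈ localDomain q δ ε i.1 (ρ i) i.2,
      φ i =ᶠ[𝓝 (z.1, z.2.1, ((R₀ + 1 / 2 : ℝ) : ℂ), ((g / 2 : ℝ) : ℂ))]
        regDet c q ν h (ellipse (2 * (q + ε)) δ) := by
    intro i z hz
    have hO : IsOpen {z : Params n | z.2.2.2 ≠ 0} := isOpen_ne_fun (by fun_prop) continuous_const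
    filter_upwards [(isOpen_localDomain _ _ _ _ _ _).mem_nhds (B.mk_mem_localDomain hz i.2.2),
      (isOpen_baseDomain _ _ _ _ _ _ _).mem_nhds
        (B.mk_mem_baseDomain (localDomain_subset _ _ _ _ _ _ hz)), hO.mem_nhds hg] with y h1 h2 h3
    exact hφeq i y h1 h3 fun x hx m => B.phase_ne h2 h3 hx m
  obtain ⟨Φ, hΦ⟩ := exists_glue (W := fun i => localDomain q δ ε i.1 (ρ i) i.2) (φ := φ) (by
    intro i j z hz
    refine ((han i).mono inter_subset_left).eqOn_of_preconnected_of_eventuallyEq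
      ((han j).mono inter_subset_right)
      ((convex_localDomain _ _ _ _ _ _).inter (convex_localDomain _ _ _ _ _ _)).isPreconnected
      ⟨B.mk_mem_localDomain hz.1 i.2.2, B.mk_mem_localDomain hz.2 j.2.2⟩ ?_ hz
    exact (hev i z hz.1).trans (hev j z hz.2).symm)
  have hΦ' : ∀ i, ∀ z ∈ localDomain q δ ε i.1 (ρ i) i.2, Φ =ᶠ[𝓝 z] φ i := fun i z hz => by
    filter_upwards [(isOpen_localDomain _ _ _ _ _ _).mem_nhds hz] with y hy using hΦ i hy
  have hmem : ∀ z ∈ rootDomain q δ ε n, ∃ i, z ∈ localDomain q δ ε i.1 (ρ i) i.2 := by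
    intro z hz
    let X := max (R₀ + 1) (max ‖z.2.2.1‖ ‖z.2.2.2‖) + 1
    have hX : R₀ + 1 < X := (le_max_left _ _).trans_lt (lt_add_one _)
    refine ⟨(z.2.1, ⟨X, hX⟩), hz.1, fun a _ => ⟨hz.2.1 a trivial, mem_ball_self (hρ _)⟩, ?_, ?_⟩
    · exact mem_ball_zero_iff.2
        (((le_max_left _ _).trans (le_max_right _ _)).trans_lt (lt_add_one _))
    · exact mem_ball_zero_iff.2
        (((le_max_right _ _).trans (le_max_right _ _)).trans_lt (lt_add_one _))
  have hΦan : AnalyticOnNhd ℂ Φ (rootDomain q δ ε n) := by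
    intro z hz
    obtain ⟨i, hi⟩ := hmem z hz
    exact (han i z hi).congr (hΦ' i z hi).symm
  refine ⟨Φ, hΦan, fun z hz => ?_⟩
  have hzr := baseDomain_subset _ _ _ _ _ _ _ hz
  obtain ⟨i, hi⟩ := hmem z hzr
  refine (hΦan.mono (baseDomain_subset q δ ε R₀ R₁ g n)).eqOn_of_preconnected_of_eventuallyEq
    (analyticOnNhd_of_differentiableOn (isOpen_baseDomain _ _ _ _ _ _ _)
      (H.differentiableOn_regDet B)) (convex_baseDomain _ _ _ _ _ _ _).isPreconnected
    (B.mk_mem_baseDomain hzr) ?_ hz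
  exact (hΦ' i _ (B.mk_mem_localDomain hi i.2.2)).trans (hev i z hi)

/-- The real part of `h` is at least some `h₀ > 0` on the box, hence `‖ν_β‖ ≥ Re β · h₀ - M ≥ 1`
once `Re β > (M + 1)/h₀`. -/
theorem exists_regular (H : Admissible c q δ ε ν h)
    (hre : ∀ z ∈ strip (2 * δ), 0 < (h z).re) : ∃ M R₀ : ℝ, 0 < R₀ ∧
      (∀ x ∈ nearBox q δ ε, ‖ν x‖ ≤ M) ∧ (∀ x ∈ nearBox q δ ε, ‖h x‖ ≤ M) ∧
      ∀ R₁, R₀ + 1 < R₁ → ∃ g, Regular q δ ε R₀ R₁ g ν h := by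
  have hδ := H.δ_pos
  have hb : 3 * δ / 2 < 2 * δ := by linarith
  obtain ⟨M₁, hM₁, hν⟩ := exists_bound_on_box (a := 2 * (q + ε) + 1) hb H.diff_ν.continuousOn
  obtain ⟨M₂, hM₂, hh⟩ := exists_bound_on_box (a := 2 * (q + ε) + 1) hb H.diff_h.continuousOn
  obtain ⟨h₀, hh₀, hlow⟩ := exists_lower_bound_on_box (a := 2 * (q + ε) + 1) hb
    (by linarith [H.axis_pos]) (by linarith) H.diff_h.continuousOn hre
  set M := max M₁ M₂
  have hM : 0 ≤ M := hM₁.trans (le_max_left _ _)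
  have hMν : ∀ x ∈ nearBox q δ ε, ‖ν x‖ ≤ M := fun x hx => (hν x hx).trans (le_max_left _ _)
  have hMh : ∀ x ∈ nearBox q δ ε, ‖h x‖ ≤ M := fun x hx => (hh x hx).trans (le_max_right _ _)
  have hR₀ : 0 < (M + 1) / h₀ := by positivity
  refine ⟨M, (M + 1) / h₀, hR₀, hMν, hMh, fun R₁ hR₁ => ?_⟩
  have hR₁0 : 0 < R₁ := by linarith
  have hpos : 0 < 16 * (M + R₁ * M) + 1 := by positivity
  -- On the box `‖ν_β‖ ≤ M + R₁ M`, so this `g` brings the phase below the threshold `1/16` of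
  -- `norm_le_norm_expSubOne`.
  refine ⟨1 / (16 * (M + R₁ * M) + 1), hR₀.le, hR₁, by positivity, ?_, ?_, ?_⟩
  · rw [div_le_one hpos]
    have : 0 ≤ 16 * (M + R₁ * M) := by positivity
    linarith
  · intro β hβ x hx
    have h1 : M + 1 < β.re * h₀ := (div_lt_iff₀ hh₀).1 hβ
    have h2 : β.re * h₀ ≤ ‖β‖ * ‖h x‖ := by
      have e1 := re_le_norm β
      have e2 := (hlow x hx).trans (re_le_norm (h x))
      have e3 := norm_nonneg β
      gcongr
    have h3 := norm_sub_norm_le (I * β * h x) (-ν x)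
    rw [sub_neg_eq_add, norm_neg, norm_mul, norm_mul, norm_I, one_mul, add_comm] at h3
    have h4 := hMν x hx
    rw [nuBeta]
    linarith
  · intro β hβ γ hγ x hx
    have h1 : ‖nuBeta ν h β x‖ ≤ M + R₁ * M := by
      refine (norm_add_le _ _).trans ?_
      rw [norm_mul, norm_mul, norm_I, one_mul]
      have := (mem_ball_zero_iff.1 hβ).le
      gcongr
      · exact hMν x hx
      · exact hMh x hx
    have h2 := (mem_ball_zero_iff.1 hγ).le
    rw [norm_mul]
    refine (mul_le_mul h2 h1 (norm_nonneg _) (by positivity)).trans ?_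
    rw [one_div, inv_mul_le_iff₀ hpos]
    linarith

theorem counterclockwiseAround_ellipse (H : Admissible c q δ ε ν h) :
    CounterclockwiseAround (ellipse (2 * (q + ε)) δ) (closure (rect q δ ε)) := by
  refine ⟨isSimpleLoop_ellipse H.axis_pos H.δ_pos, fun z hz => ?_⟩
  obtain ⟨h1, h2⟩ := closure_rect_subset q δ ε hz
  have hf : ellipseForm (2 * (q + ε)) δ z < 1 :=
    (ellipseForm_le_half H.axis_pos H.δ_pos (by linarith) h1).trans_lt (by norm_num)
  have hr := notMem_range_ellipse H.axis_pos H.δ_pos hf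
  exact ⟨hr, (windingNumber_ellipse H.δ_pos H.axis_lt hr).1 hf⟩

theorem mem_nearBox_of_mem_inside (H : Admissible c q δ ε ν h) {x : ℂ}
    (hx : x ∈ range (ellipse (2 * (q + ε)) δ) ∪ inside (ellipse (2 * (q + ε)) δ)) :
    x ∈ nearBox q δ ε := by
  rcases hx with ⟨t, rfl⟩ | ⟨hr, hw⟩
  · exact (H.ellipse_mem_collar t).1
  · exact H.mem_nearBox_of_form_le ((windingNumber_ellipse H.δ_pos H.axis_lt hr).2 hw)

end Admissible

/-- `betaRect` has nonempty interior, so the small domain contains an open set meeting every slice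
with fixed `μ`'s. The large domain is convex and the identity theorem applies, although neither
domain is open. -/
theorem eqOn_largeDomain {q δ ε γ₀ : ℝ} {β₀ : ℂ} {n : ℕ} (hre : 0 < β₀.re) (him : 0 < β₀.im)
    (hγ₀ : 0 < γ₀) (hsub : smallDomain q δ ε β₀ γ₀ n ⊆ largeDomain q δ ε n)
    {Φ Ψ : Params n → ℂ} (hΦ : AnalyticOnNhd ℂ Φ (largeDomain q δ ε n))
    (hΨ : AnalyticOnNhd ℂ Ψ (largeDomain q δ ε n)) (h : EqOn Ψ Φ (smallDomain q δ ε β₀ γ₀ n)) :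
    EqOn Ψ Φ (largeDomain q δ ε n) := by
  intro z hz
  set O : Set (Params n) := (univ.pi fun _ => strip δ) ×ˢ (univ.pi fun _ => rect q δ ε) ×ˢ
    ({β : ℂ | β₀.re < β.re} ∩ {β : ℂ | β.re < 10 * β₀.re} ∩ {β : ℂ | |β.im| < β₀.im}) ×ˢ
      ball 0 γ₀ with hOdef
  have hO : IsOpen O := (isOpen_set_pi finite_univ fun _ _ => isOpen_strip δ).prod
    ((isOpen_set_pi finite_univ fun _ _ => isOpen_rect q δ ε).prod
      ((((isOpen_lt continuous_const continuous_re).inter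
        (isOpen_lt continuous_re continuous_const)).inter
        (isOpen_lt continuous_im.abs continuous_const)).prod isOpen_ball))
  have hOs : O ⊆ smallDomain q δ ε β₀ γ₀ n := fun y hy =>
    ⟨hy.1, hy.2.1, ⟨le_of_lt hy.2.2.1.1.1, le_of_lt hy.2.2.1.1.2, le_of_lt hy.2.2.1.2⟩, hy.2.2.2⟩
  have hz₁ : (z.1, z.2.1, ((2 * β₀.re : ℝ) : ℂ), (0 : ℂ)) ∈ O := by
    refine ⟨hz.1, hz.2.1, ⟨⟨?_, ?_⟩, ?_⟩, mem_ball_self hγ₀⟩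
    · show β₀.re < ((2 * β₀.re : ℝ) : ℂ).re
      rw [ofReal_re]; linarith
    · show ((2 * β₀.re : ℝ) : ℂ).re < 10 * β₀.re
      rw [ofReal_re]; linarith
    · show |((2 * β₀.re : ℝ) : ℂ).im| < β₀.im
      rwa [ofReal_im, abs_zero]
  refine hΨ.eqOn_of_preconnected_of_eventuallyEq hΦ (convex_largeDomain q δ ε n).isPreconnected
    (hsub (hOs hz₁)) ?_ hz
  filter_upwards [hO.mem_nhds hz₁] with y hy using h (hOs hy)

end GlobalContinuation

end NLSM

end

/-! ### The choice of the loop and of the constants -/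

theorem mainTheorem4 (c q : ℝ) (hc : 0 < c) (hq : 0 < q) (m : ℕ) :
    ∃ ε₀ > (0 : ℝ), ∃ δ₀ > (0 : ℝ), ∀ ε δ : ℝ, 0 < ε → ε ≤ ε₀ → 0 < δ → δ ≤ δ₀ →
    ∀ ν h : ℂ → ℂ,
      DifferentiableOn ℂ ν (NLSM.strip (2 * δ)) →
      DifferentiableOn ℂ h (NLSM.strip (2 * δ)) →
      (∀ z ∈ NLSM.strip (2 * δ), 0 < (h z).re) →
      (∃ B : ℝ, ∀ z ∈ NLSM.strip (2 * δ), |(h z).im| ≤ B) →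
    ∃ Γ : ℝ → ℂ,
      NLSM.CounterclockwiseAround Γ (closure (NLSM.rect q δ ε)) ∧
      Set.range Γ ⊆ NLSM.strip (2 * δ) ∧
      ∃ R > (0 : ℝ), ∃ η > (0 : ℝ), ∀ β₀ : ℂ, R ≤ β₀.re → 0 < β₀.im → β₀.im ≤ η →
      ∃ g > (0 : ℝ), ∀ γ₀ : ℝ, 0 < γ₀ → γ₀ ≤ g →
        -- no zeros on or inside the loop, uniformly in the parameters
        (∃ κ > (0 : ℝ), ∀ β ∈ NLSM.betaRect β₀, ∀ γ ∈ Metric.ball (0 : ℂ) γ₀,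
          ∀ x ∈ Set.range Γ ∪ NLSM.inside Γ,
            (γ ≠ 0 →
              Complex.exp (-2 * Complex.I * Real.pi * (γ * NLSM.nuBeta ν h β x)) - 1 ≠ 0) ∧
            κ * ‖γ‖ ≤
              ‖Complex.exp (-2 * Complex.I * Real.pi * (γ * NLSM.nuBeta ν h β x)) - 1‖) ∧
        ∀ n ≤ m,
          -- the Fredholm determinant is well defined on the small domain
          (∀ z ∈ NLSM.smallDomain q δ ε β₀ γ₀ n,
            ContinuousOn (Function.uncurry (NLSM.paramKernel c q ν h z))
              (Set.range Γ ×ˢ Set.range Γ) ∧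
            Summable fun k => ‖NLSM.fredholmTerm Γ (NLSM.paramKernel c q ν h z) k‖) ∧
          -- holomorphy on the small domain
          AnalyticOnNhd ℂ (NLSM.regDet c q ν h Γ : NLSM.Params n → ℂ)
            (NLSM.smallDomain q δ ε β₀ γ₀ n) ∧
          -- unique analytic continuation to the large domain
          NLSM.smallDomain q δ ε β₀ γ₀ n ⊆ NLSM.largeDomain q δ ε n ∧
          ∃ Φ : NLSM.Params n → ℂ,
            (AnalyticOnNhd ℂ Φ (NLSM.largeDomain q δ ε n) ∧
              Set.EqOn Φ (NLSM.regDet c q ν h Γ) (NLSM.smallDomain q δ ε β₀ γ₀ n)) ∧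
            ∀ Ψ : NLSM.Params n → ℂ,
              AnalyticOnNhd ℂ Ψ (NLSM.largeDomain q δ ε n) →
              Set.EqOn Ψ (NLSM.regDet c q ν h Γ) (NLSM.smallDomain q δ ε β₀ γ₀ n) →
              Set.EqOn Ψ Φ (NLSM.largeDomain q δ ε n) := by
  -- `δ ≤ c/8` keeps the box away from the poles at `±ic` of `lieb` and from those of the shifted
  -- factors. `δ ≤ q` makes the real semi-axis the longer one. Any `ε₀` would do.
  refine ⟨1, one_pos, min (c / 8) q, lt_min (by positivity) hq, ?_⟩
  intro ε δ hε _ hδ hδ₀ ν h hν hh hre _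
  have H : NLSM.Admissible c q δ ε ν h :=
    ⟨hc, hq, hδ, hε, hδ₀.trans (min_le_left _ _), hδ₀.trans (min_le_right _ _), hν, hh⟩
  obtain ⟨M, R₀, hR₀, hMν, hMh, hreg⟩ := H.exists_regular hre
  refine ⟨NLSM.ellipse (2 * (q + ε)) δ, H.counterclockwiseAround_ellipse,
    Set.range_subset_iff.2 fun t => H.nearBox_subset (H.ellipse_mem_collar t).1, 2 * R₀,
    by positivity, 1, one_pos, fun β₀ hβre hβim _ => ?_⟩
  -- The radius bounds `|β|` on `betaRect β₀` strictly; `Re β₀ ≥ 2 R₀` gives both `Re β > R₀` and a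
  -- radius above `R₀ + 1`.
  obtain ⟨g, B⟩ := hreg (10 * β₀.re + β₀.im + 1) (by linarith)
  refine ⟨g, B.pos, fun γ₀ hγ₀ hγ₀g => ?_⟩
  have hβ : ∀ β ∈ NLSM.betaRect β₀, R₀ < β.re ∧
      β ∈ Metric.ball (0 : ℂ) (10 * β₀.re + β₀.im + 1) := by
    rintro β ⟨h1, h2, h3⟩
    refine ⟨by linarith, mem_ball_zero_iff.2 ?_⟩
    have h4 := Complex.norm_le_abs_re_add_abs_im β
    rw [abs_of_pos (show 0 < β.re by linarith)] at h4
    linarith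
  have hγ : ∀ γ ∈ Metric.ball (0 : ℂ) γ₀, γ ∈ Metric.ball (0 : ℂ) g :=
    fun γ hγ => Metric.ball_subset_ball hγ₀g hγ
  -- `κ = 1` works, since `|e^{-2iπu} - 1| ≥ |u|` at `u = γ ν_β(x)` and `|ν_β(x)| ≥ 1`.
  refine ⟨⟨1, one_pos, fun β hβ' γ hγ' x hx => ?_⟩, fun n _ => ?_⟩
  · have hxV := H.mem_nearBox_of_mem_inside hx
    have h1 := NLSM.norm_le_norm_expSubOne (B.le β (hβ β hβ').2 γ (hγ γ hγ') x hxV)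
    have h2 := B.one_le β (hβ β hβ').1 x hxV
    have h3 : 1 * ‖γ‖ ≤ ‖NLSM.expSubOne (γ * NLSM.nuBeta ν h β x)‖ := by
      refine le_trans ?_ h1
      rw [norm_mul, one_mul]
      exact le_mul_of_one_le_right (norm_nonneg _) h2
    refine ⟨fun hγ0 => norm_pos_iff.1 (lt_of_lt_of_le ?_ h3), h3⟩
    rw [one_mul]
    exact norm_pos_iff.2 hγ0
  · have hsub : NLSM.smallDomain q δ ε β₀ γ₀ n ⊆
        NLSM.baseDomain q δ ε R₀ (10 * β₀.re + β₀.im + 1) g n :=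
      fun z hz => ⟨hz.1, hz.2.1, hβ _ hz.2.2.1, hγ _ hz.2.2.2⟩
    have hsl : NLSM.smallDomain q δ ε β₀ γ₀ n ⊆ NLSM.largeDomain q δ ε n := by
      intro z hz
      refine ⟨hz.1, hz.2.1, ?_, ?_⟩
      · show -ε ≤ z.2.2.1.re
        linarith [(hβ _ hz.2.2.1).1]
      · exact Metric.ball_subset_ball (by linarith [B.le_one]) hz.2.2.2
    obtain ⟨Φ, hΦan, hΦ⟩ := H.exists_continuation (n := n) B hMν hMh
    have hlr : NLSM.largeDomain q δ ε n ⊆ NLSM.rootDomain q δ ε n :=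
      fun z hz => ⟨hz.1, hz.2.1, trivial, trivial⟩
    refine ⟨fun z hz => ⟨H.continuousOn_paramKernel B (hsub hz),
      H.summable_norm_fredholmTerm B (hsub hz)⟩, ?_, hsl, Φ, ⟨hΦan.mono hlr, hΦ.mono hsub⟩,
      fun Ψ hΨ hΨeq => ?_⟩
    · exact (NLSM.analyticOnNhd_of_differentiableOn (NLSM.isOpen_baseDomain _ _ _ _ _ _ _)
        (H.differentiableOn_regDet B)).mono hsub
    · exact NLSM.eqOn_largeDomain (by linarith) hβim hγ₀ hsl (hΦan.mono hlr) hΨ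
        (hΨeq.trans (hΦ.mono hsub).symm)
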